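/- A knot (a knot diagram on the sphere, up to Reidemeister moves) is called \emph{bipartite} if it has a \emph{matched diagram}, that is, a diagram whose set of crossings can be split into disjoint pairs such that the two crossings of each pair form a full twist of two counter-directed strands: one strand runs through the first crossing and then directly through the second, the other strand runs through the second and then directly through the first, each strand is once the upper and once the lower one, and both crossings have the same sign. For a diagram $D$ of a knot $K$ let $A$ be its Alexander matrix over $\mathbb{Z}[t,t^{-1}]$ (obtained by Fox calculus from the Wirtinger presentation of the knot group, with one column deleted; it presents the first homology of the infinite cyclic cover of the knot complement). The $m$-th Alexander ideal $I_m(K)\subseteq\mathbb{Z}[t,t^{-1}]$ is the ideal generated by all minors of $A$ of size $n-m+1$, where $n$ is the smaller one of the numbers of rows and columns of $A$ (the whole ring if $n-m+1\le 0$). \textbf{Theorem.} (a) Let $K$ be a bipartite knot and $m\ge 0$. If the Alexander ideal $I_m(K)$, computed from any diagram of $K$, is non-trivial, i.e. $I_m(K)\neq\mathbb{Z}[t,t^{-1}]$, then $1+t\notin I_m(K)$. (Equivalently, a knot with a non-trivial Alexander ideal that contains $1+t$ has no matched diagram.) (b) There exist knots that are not bipartite, i.e. that have no matched diagram (Przytycki's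 conjecture, part of Problem 1.60 in Kirby's list). -/

import Mathlib

/-!
Oriented knot diagrams on the sphere are encoded by signed Gauss words: one runs once along the
knot and records every passage through a crossing.  A signed Gauss word determines the cyclic
order of the four half-edges at each crossing, hence a cellular decomposition of a closed oriented
surface; the word is a knot diagram on the sphere exactly if this surface has Euler
characteristic 2.  Knots are knot diagrams up to Reidemeister moves.
-/

open scoped LaurentPolynomial

namespace BipartiteKnots

/-- One passage of the knot through a crossing: the name of the crossing, whether the passage is
the upper one, and whether the crossing is positive. -/
@[ext]
structure Letter where
  label : ℕ
  isOver : Bool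
  isPos : Bool
  deriving DecidableEq

/-- The other passage through the same crossing. -/
def Letter.mate (x : Letter) : Letter := ⟨x.label, !x.isOver, x.isPos⟩

/-- Renaming of a crossing. -/
def Letter.relabel (f : ℕ → ℕ) (x : Letter) : Letter := ⟨f x.label, x.isOver, x.isPos⟩

/-- Signed Gauss words: every crossing that occurs is passed exactly twice, once above and once
below, and its two passages carry the same sign. The word is read cyclically. -/
structure IsGaussWord (w : List Letter) : Prop where
  nodup : w.Nodup
  mate_mem : ∀ x ∈ w, x.mate ∈ w
  eq_or_eq_mate : ∀ x ∈ w, ∀ y ∈ w, y.label = x.label → y = x ∨ y = x.mate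

/-- `i` and `k` are the two passages through one crossing. -/
def Meets (w : List Letter) (i k : Fin w.length) : Prop :=
  i ≠ k ∧ (w.get i).label = (w.get k).label

instance (w : List Letter) (i k : Fin w.length) : Decidable (Meets w i k) :=
  inferInstanceAs (Decidable (_ ∧ _))

/-- The strand met at the passage `i` crosses from the right to the left. (A crossing is positive
if the upper strand is turned counterclockwise into the lower one.) -/
def FromRight (w : List Letter) (i : Fin w.length) : Prop :=
  (w.get i).isOver = (w.get i).isPos

/-- The edges of the diagram are numbered by `Fin w.length`: the edge `i` leads from the passage
`i` to the passage `finRotate _ i` that follows it cyclically. A dart `(i, b)` is the edge `i`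
traversed forwards (`b = true`) or backwards (`b = false`). `FaceStep w d d'` says that a traveller
along `d` who turns left at the crossing at the end of `d` continues along `d'`. -/
inductive FaceStep (w : List Letter) : Fin w.length × Bool → Fin w.length × Bool → Prop
  | fwd_fwd (i k : Fin w.length) : Meets w (finRotate _ i) k → FromRight w (finRotate _ i) →
      FaceStep w (i, true) (k, true)
  | fwd_bwd (i e : Fin w.length) : Meets w (finRotate _ i) (finRotate _ e) →
      ¬ FromRight w (finRotate _ i) → FaceStep w (i, true) (e, false)
  | bwd_bwd (i e : Fin w.length) : Meets w i (finRotate _ e) → FromRight w i →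
      FaceStep w (i, false) (e, false)
  | bwd_fwd (i k : Fin w.length) : Meets w i k → ¬ FromRight w i →
      FaceStep w (i, false) (k, true)

/-- The faces (complementary regions) of the diagram: darts that have the same region on their
left are identified. -/
def Face (w : List Letter) : Type := Quot (FaceStep w)

/-- The diagram lies on the sphere: it is the circle without crossings, or `V - E + F = 2`, where
`V = w.length / 2` and `E = w.length`. -/
def IsSpherical (w : List Letter) : Prop :=
  w = [] ∨ 2 * Nat.card (Face w) = w.length + 4

/-- Oriented knot diagrams. -/
structure KnotDiagram where
  word : List Letter
  isGaussWord : IsGaussWord word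
  isSpherical : IsSpherical word

/-- The letters `x`, `y` in this order or in the opposite one. -/
def ordered (b : Bool) (x y : Letter) : List Letter := if b then [x, y] else [y, x]

/-- The elementary changes of a Gauss word: choice of another starting point, renaming of the
crossings, and the three Reidemeister moves with all orientations of the strands. -/
inductive ReidemeisterStep : List Letter → List Letter → Prop
  | rotate (u v : List Letter) : ReidemeisterStep (u ++ v) (v ++ u)
  | relabel (f : ℕ → ℕ) (hf : Function.Injective f) (w : List Letter) :
      ReidemeisterStep w (w.map (Letter.relabel f))
  /-- A kink is added. -/
  | r1 (a : ℕ) (o s : Bool) (w : List Letter) :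
      ReidemeisterStep w ([⟨a, o, s⟩, ⟨a, !o, s⟩] ++ w)
  /-- A piece of the knot is pushed over another one; `d` tells whether they are parallel. -/
  | r2 (a b : ℕ) (s d : Bool) (u v : List Letter) :
      ReidemeisterStep (u ++ v)
        ([⟨a, true, s⟩, ⟨b, true, !s⟩] ++ u ++
          ordered d ⟨a, false, s⟩ ⟨b, false, !s⟩ ++ v)
  /-- Three strands bound a triangle, and one of them is moved across the crossing of the other
  two. The top strand meets the middle one in `a` and the bottom one in `b`, and the middle
  strand meets the bottom one in `c`; `α`, `β`, `γ` are the orders in which the top, middle and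
  bottom strand pass through their two crossings. The hypotheses on `α`, `β`, `γ` and the signs
  say that the strands are placed like three oriented straight lines in the plane. Here the
  strands follow one another along the knot as top, middle, bottom. -/
  | r3 (a b c : ℕ) (sa sb sc α β γ : Bool) (u v w : List Letter)
      (hβ : (α = β) ↔ (sb = sc)) (hγ : (α = γ) ↔ (sa = sc)) :
      ReidemeisterStep
        (ordered α ⟨a, true, sa⟩ ⟨b, true, sb⟩ ++ u ++
          ordered β ⟨a, false, sa⟩ ⟨c, true, sc⟩ ++ v ++
          ordered γ ⟨b, false, sb⟩ ⟨c, false, sc⟩ ++ w)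
        (ordered (!α) ⟨a, true, sa⟩ ⟨b, true, sb⟩ ++ u ++
          ordered (!β) ⟨a, false, sa⟩ ⟨c, true, sc⟩ ++ v ++
          ordered (!γ) ⟨b, false, sb⟩ ⟨c, false, sc⟩ ++ w)
  /-- The same move, if the strands follow one another as top, bottom, middle. -/
  | r3' (a b c : ℕ) (sa sb sc α β γ : Bool) (u v w : List Letter)
      (hβ : (α = β) ↔ (sb = sc)) (hγ : (α = γ) ↔ (sa = sc)) :
      ReidemeisterStep
        (ordered α ⟨a, true, sa⟩ ⟨b, true, sb⟩ ++ u ++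
          ordered γ ⟨b, false, sb⟩ ⟨c, false, sc⟩ ++ v ++
          ordered β ⟨a, false, sa⟩ ⟨c, true, sc⟩ ++ w)
        (ordered (!α) ⟨a, true, sa⟩ ⟨b, true, sb⟩ ++ u ++
          ordered (!γ) ⟨b, false, sb⟩ ⟨c, false, sc⟩ ++ v ++
          ordered (!β) ⟨a, false, sa⟩ ⟨c, true, sc⟩ ++ w)

/-- Knots: knot diagrams up to the equivalence relation generated by the steps above, all
intermediate words being knot diagrams. -/
def Knot : Type := Quot fun D D' : KnotDiagram => ReidemeisterStep D.word D'.word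

/-- The knot represented by a diagram. -/
def KnotDiagram.knot (D : KnotDiagram) : Knot := Quot.mk _ D

/-- The passage `y` follows the passage `x` immediately in the cyclic word `w`. -/
def Follows (w : List Letter) (x y : Letter) : Prop := ∃ u, w ~r (x :: y :: u)

/-- The crossings `a` and `b` form a matched pair: two counter-directed strands are twisted about
each other by a full twist. One strand runs through `a` and then directly through `b`, the other
one through `b` and then directly through `a`; each is once the upper and once the lower one, and
the crossings have the same sign `s`. -/
def IsMatchedPair (w : List Letter) (a b : ℕ) : Prop :=
  a ≠ b ∧ ∃ o s : Bool,
    Follows w ⟨a, o, s⟩ ⟨b, !o, s⟩ ∧ Follows w ⟨b, o, s⟩ ⟨a, !o, s⟩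

/-- Matched diagrams: the crossings are split into disjoint matched pairs `{a, σ a}`. -/
def KnotDiagram.IsMatched (D : KnotDiagram) : Prop :=
  ∃ σ : ℕ → ℕ, ∀ x ∈ D.word,
    σ (σ x.label) = x.label ∧ IsMatchedPair D.word x.label (σ x.label)

/-- A knot is bipartite if it has a matched diagram. -/
def Knot.IsBipartite (K : Knot) : Prop := ∃ D : KnotDiagram, D.knot = K ∧ D.IsMatched

noncomputable section

/-- The ideal generated by the minors of size `k` of a matrix. -/
def minorIdeal {R ι κ : Type*} [CommRing R] (A : Matrix ι κ R) (k : ℕ) : Ideal R :=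
  Ideal.span (Set.range fun p : (Fin k ↪ ι) × (Fin k ↪ κ) => (A.submatrix p.1 p.2).det)

/-- The power `t` or `t⁻¹` that belongs to a positive or a negative crossing. -/
def tPow (s : Bool) : ℤ[T;T⁻¹] := if s then LaurentPolynomial.T 1 else LaurentPolynomial.T (-1)

/-- The Alexander matrix of a diagram, obtained by Fox calculus from the Wirtinger presentation of
the knot group with one generator for each edge of the diagram. The row of a passage `i` with
incoming edge `j` and outgoing edge `i` is the relation `x i = x j` if `i` is the upper passage, and
`x i = t ^ s * x j + (1 - t ^ s) * x k` if `i` is the lower passage through a crossing of sign `s`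
whose upper passage is `k`. The column of the first edge is deleted, so that the matrix presents the
first homology group of the infinite cyclic cover of the knot complement. -/
def KnotDiagram.alexanderMatrix (D : KnotDiagram) :
    Matrix (Fin D.word.length) {e : Fin D.word.length // (e : ℕ) ≠ 0} ℤ[T;T⁻¹] :=
  Matrix.of fun i e =>
    if (D.word.get i).isOver then
      (if e.1 = i then 1 else 0) - (if finRotate _ e.1 = i then 1 else 0)
    else
      (if e.1 = i then 1 else 0)
        - (if finRotate _ e.1 = i then tPow (D.word.get i).isPos else 0)
        - (if Meets D.word i e.1 then 1 - tPow (D.word.get i).isPos else 0)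

/-- The `m`-th Alexander ideal, generated by the minors of size `n - m + 1` of the Alexander matrix,
where `n` is the smaller one of the numbers of its rows and columns. It is the whole ring if
`n - m + 1 ≤ 0`. -/
def KnotDiagram.alexanderIdeal (D : KnotDiagram) (m : ℕ) : Ideal ℤ[T;T⁻¹] :=
  minorIdeal D.alexanderMatrix
    (min (Fintype.card (Fin D.word.length))
      (Fintype.card {e : Fin D.word.length // (e : ℕ) ≠ 0}) + 1 - m)

end

end BipartiteKnots

/-! The Alexander ideals are read off from the module that represents colorings of a diagram: a
strand of color x that passes under a strand of color c at a crossing of sign s continues with the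
color t^s x + (1 - t^s) c, and the strand at the starting point has color zero. `Presents` says that
a module carries the universal coloring. Every Reidemeister step induces a natural bijection between
colorings, and the solutions of the Alexander matrix are the colorings. By Fitting's lemma
(`fittingIdeal_eq`) the ideals can therefore be computed from any presentation of this module,
obtained from any diagram of the knot.

A matched diagram, read from a suitable starting point, is a sequence of blocks of two letters, each
block being one strand of a matched pair. Let d i be the change of color along the block i, and τ i
the other block of its pair. Then d (τ i) = -d i, and d i is a fixed multiple of the difference
between the color at the beginning of τ i and the color at the end of i, that is, of a signed sum of
changes d j. If all twists are undone, the knot becomes a simple closed curve and the pairs become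
chords at its left or right; chords on the same side are not interlaced (`IsBlockWord.planar`,
proved with homology modulo two). Hence the contributions of j and τ j cancel if j is on the same
side as i: the changes at the left depend only on those at the right, and conversely. The
coefficients are ±(1 - t⁻¹) at the left and ±(1 - t) at the right. Eliminating the blocks at the
right leaves a presentation matrix with entries in ℤ + ℤ(1 - t)(1 - t⁻¹), which are invariant under
t ↦ t⁻¹.

An ideal I generated by symmetric elements has the property that r - r(t⁻¹) = (t - t⁻¹) q with q in
I, for every r in I. For r = 1 + t the left side is t - t⁻¹, so q = 1 and I is the whole ring. This
proves (a).

For (b), the Alexander module of the pretzel knot (3, -3, 3) is the sum of the cyclic modules with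
the relations 2 - t⁻¹ and 2 - t. Its second ideal contains t(2 - t⁻¹) + (2 - t) = 1 + t, but it is
proper, since both generators vanish for t = -1 modulo 3. -/

namespace BipartiteKnots

/-! ### Fitting ideals: ideals of minors depend only on the presented module. -/

section Fitting

variable {R : Type*} [CommRing R] {M : Type*} [AddCommGroup M] [Module R M]

/-- A multilinear form takes values in an ideal on a span if it does so on the spanning set. -/
theorem multilinear_mem_of_span {V : Type*} [AddCommGroup V] [Module R V] {n : ℕ}
    (f : MultilinearMap R (fun _ : Fin n => V) R) (S : Set V) (I : Ideal R)
    (h : ∀ v : Fin n → V, (∀ i, v i ∈ S) → f v ∈ I) (v : Fin n → V)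
    (hv : ∀ i, v i ∈ Submodule.span R S) : f v ∈ I := by
  -- The positions in `s` hold arbitrary vectors of the span and all others hold generators; the
  -- induction frees one position at a time.
  have key : ∀ s : Finset (Fin n), ∀ v : Fin n → V, (∀ i ∈ s, v i ∈ Submodule.span R S) →
      (∀ i, i ∉ s → v i ∈ S) → f v ∈ I := by
    intro s
    induction s using Finset.induction_on with
    | empty => exact fun v _ h' => h v fun i => h' i (by simp)
    | insert a s ha ih =>
      intro v h1 h2
      have aux : ∀ x ∈ Submodule.span R S, f (Function.update v a x) ∈ I := by
        intro x hx
        induction hx using Submodule.span_induction with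
        | mem x hx =>
          refine ih _ (fun i hi => ?_) (fun i hi => ?_)
          · rw [Function.update_of_ne (by rintro rfl; exact ha hi)]
            exact h1 i (Finset.mem_insert_of_mem hi)
          · by_cases hia : i = a
            · subst hia; simpa using hx
            · rw [Function.update_of_ne hia]
              exact h2 i (by simp [hia, hi])
        | zero => simp
        | add x y _ _ hx hy => rw [f.map_update_add]; exact I.add_mem hx hy
        | smul r x _ hx => rw [f.map_update_smul]; exact I.mul_mem_left _ hx
      simpa using aux (v a) (h1 a (Finset.mem_insert_self _ _))
  exact key Finset.univ v (fun i _ => hv i) (fun i hi => absurd (Finset.mem_univ i) hi)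

/-- Minors with possibly repeated rows and columns belong to the ideal of minors. -/
theorem det_mem_minorIdeal {ι κ : Type*} (A : Matrix ι κ R) {k : ℕ} (p : Fin k → ι)
    (q : Fin k → κ) : (A.submatrix p q).det ∈ minorIdeal A k := by
  by_cases hp : Function.Injective p
  · by_cases hq : Function.Injective q
    · exact Ideal.subset_span ⟨(⟨p, hp⟩, ⟨q, hq⟩), rfl⟩
    · simp only [Function.Injective, not_forall] at hq
      obtain ⟨i, j, hij, hne⟩ := hq
      rw [Matrix.det_zero_of_column_eq hne fun l => by simp [hij]]
      exact Ideal.zero_mem _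
  · simp only [Function.Injective, not_forall] at hp
    obtain ⟨i, j, hij, hne⟩ := hp
    rw [Matrix.det_zero_of_row_eq hne (by ext l; simp [hij])]
    exact Ideal.zero_mem _

theorem minorIdeal_le_iff {ι κ : Type*} (A : Matrix ι κ R) {k : ℕ} (I : Ideal R) :
    minorIdeal A k ≤ I ↔ ∀ (p : Fin k → ι) (q : Fin k → κ), (A.submatrix p q).det ∈ I := by
  refine ⟨fun h p q => h (det_mem_minorIdeal A p q), fun h => Ideal.span_le.2 ?_⟩
  rintro _ ⟨⟨p, q⟩, rfl⟩
  exact h p q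

theorem minorIdeal_zero {ι κ : Type*} (A : Matrix ι κ R) : minorIdeal A 0 = ⊤ := by
  rw [Ideal.eq_top_iff_one]
  simpa using det_mem_minorIdeal A (k := 0) Fin.elim0 Fin.elim0

/-- The relations between the elements of a family. -/
def relations {κ : Type*} [Fintype κ] (x : κ → M) : Submodule R (κ → R) :=
  LinearMap.ker (Fintype.linearCombination R x)

theorem mem_relations {κ : Type*} [Fintype κ] (x : κ → M) (v : κ → R) :
    v ∈ relations x ↔ ∑ k, v k • x k = 0 := by
  simp [relations, Fintype.linearCombination_apply]

/-- The rows of `A` generate the relations between the generators `x` of a module. -/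
structure IsPresentation {ι κ : Type*} [Fintype κ] (A : Matrix ι κ R) (x : κ → M) : Prop where
  span_eq_top : Submodule.span R (Set.range x) = ⊤
  relations_eq : relations x = Submodule.span R (Set.range A)

/-- The matrix whose rows are all relations of a family. -/
def relationMatrix {κ : Type*} [Fintype κ] (x : κ → M) : Matrix (relations (R := R) x) κ R :=
  fun v => v.1

/-- A minor is multilinear in its rows, so rows that are combinations of the rows of `A` yield
combinations of minors of `A`. -/
theorem minorIdeal_of_span {ι ι' κ : Type*} (A : Matrix ι κ R) (B : Matrix ι' κ R)
    (h : ∀ i, B i ∈ Submodule.span R (Set.range A)) (k : ℕ) :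
    minorIdeal B k ≤ minorIdeal A k := by
  rw [minorIdeal_le_iff]
  intro p q
  let f : MultilinearMap R (fun _ : Fin k => κ → R) R :=
    (Matrix.detRowAlternating (R := R) (n := Fin k)).toMultilinearMap.compLinearMap
      fun _ => LinearMap.funLeft R R q
  refine multilinear_mem_of_span f (Set.range A) _ (fun v hv => ?_) (fun i => B (p i))
    (fun i => h _)
  choose r hr using hv
  have : v = fun i => A (r i) := funext fun i => (hr i).symm
  subst this
  exact det_mem_minorIdeal A r q

/-- The ideal depends only on the span of the rows, so the matrix may be replaced by that of all
relations, which is determined by the generators alone. -/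
theorem IsPresentation.minorIdeal_eq {ι κ : Type*} [Fintype κ] {A : Matrix ι κ R} {x : κ → M}
    (h : IsPresentation A x) (k : ℕ) :
    minorIdeal A k = minorIdeal (relationMatrix (R := R) x) k := by
  apply le_antisymm
  · refine minorIdeal_of_span _ _ (fun i => Submodule.subset_span ?_) k
    refine ⟨⟨A i, ?_⟩, rfl⟩
    rw [h.relations_eq]
    exact Submodule.subset_span ⟨i, rfl⟩
  · refine minorIdeal_of_span _ _ (fun i => ?_) k
    rw [← h.relations_eq]
    exact i.2

/-- The Fitting ideal of a generating family, in the numbering of Alexander ideals. -/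
def fittingIdeal (R : Type*) [CommRing R] {M : Type*} [AddCommGroup M] [Module R M]
    {κ : Type*} [Fintype κ] (x : κ → M) (m : ℕ) : Ideal R :=
  minorIdeal (relationMatrix (R := R) x) (Fintype.card κ + 1 - m)

theorem minorIdeal_relationMatrix_reindex_le {κ κ' : Type*} [Fintype κ] [Fintype κ'] (x : κ → M)
    (e : κ' ≃ κ) (k : ℕ) :
    minorIdeal (relationMatrix (R := R) (x ∘ e)) k ≤ minorIdeal (relationMatrix (R := R) x) k := by
  rw [minorIdeal_le_iff]
  intro p q
  have hmem : ∀ v : relations (R := R) (x ∘ e),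
      (fun j => v.1 (e.symm j)) ∈ relations (R := R) x := by
    intro v
    have := (mem_relations _ _).1 v.2
    rw [mem_relations, ← this, ← e.sum_comp]
    simp
  convert det_mem_minorIdeal (relationMatrix (R := R) x) (fun i => ⟨_, hmem (p i)⟩)
    (fun i => e (q i)) using 2
  ext i j
  simp [relationMatrix]

theorem fittingIdeal_reindex {κ κ' : Type*} [Fintype κ] [Fintype κ'] (x : κ → M) (e : κ' ≃ κ)
    (m : ℕ) : fittingIdeal R (x ∘ e) m = fittingIdeal R x m := by
  unfold fittingIdeal
  rw [Fintype.card_congr e]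
  apply le_antisymm (minorIdeal_relationMatrix_reindex_le x e _)
  have h := minorIdeal_relationMatrix_reindex_le (R := R) (x ∘ e) e.symm (Fintype.card κ + 1 - m)
  rwa [Function.comp_assoc, e.self_comp_symm, Function.comp_id] at h

/-- A redundant generator adds a column and one relation that expresses it by the others. The new
relation has the entry 1 in the new column, so the size of the minors goes up by one and the ideal
stays the same. -/
theorem fittingIdeal_option {κ : Type*} [Fintype κ] (x : κ → M)
    (hx : Submodule.span R (Set.range x) = ⊤) (y : M) (m : ℕ) :
    fittingIdeal R (fun j : Option κ => j.elim y x) m = fittingIdeal R x m := by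
  classical
  obtain ⟨a, ha⟩ : ∃ a : κ → R, ∑ k, a k • x k = y := by
    have : y ∈ Submodule.span R (Set.range x) := by rw [hx]; trivial
    exact (Submodule.mem_span_range_iff_exists_fun R).1 this
  set A := relationMatrix (R := R) x
  let B : Matrix (Option (relations (R := R) x)) (Option κ) R := Matrix.of fun i j =>
    i.elim (j.elim 1 fun k => - a k) fun v => j.elim 0 v.1
  have hB : IsPresentation B (fun j : Option κ => j.elim y x) := by
    refine ⟨?_, ?_⟩
    · rw [eq_top_iff, ← hx]
      refine Submodule.span_mono ?_
      rintro _ ⟨k, rfl⟩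
      exact ⟨some k, rfl⟩
    · apply le_antisymm
      · intro v hv
        rw [mem_relations] at hv
        simp only [Fintype.sum_option, Option.elim] at hv
        have hu : (fun k => v (some k) + v none * a k) ∈ relations (R := R) x := by
          rw [mem_relations, ← hv, ← ha, Finset.smul_sum, ← Finset.sum_add_distrib]
          refine Finset.sum_congr rfl fun k _ => ?_
          module
        have : v = v none • B none + B (some ⟨_, hu⟩) := by
          ext j
          cases j <;> simp [B]
        rw [this]
        exact Submodule.add_mem _ (Submodule.smul_mem _ _ (Submodule.subset_span ⟨none, rfl⟩))
          (Submodule.subset_span ⟨some _, rfl⟩)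
      · rw [Submodule.span_le]
        rintro _ ⟨i, rfl⟩
        rw [SetLike.mem_coe, mem_relations]
        rcases i with _ | v
        · simp [Fintype.sum_option, B, ← ha]
        · have := (mem_relations _ _).1 v.2
          simpa [Fintype.sum_option, B] using this
  have hAB : ∀ k (p : Fin k → relations (R := R) x) (q : Fin k → Option κ),
      (B.submatrix (fun i => some (p i)) q).det ∈ minorIdeal A k := by
    intro k p q
    by_cases hq : ∃ i, q i = none
    · obtain ⟨i, hi⟩ := hq
      rw [Matrix.det_eq_zero_of_column_eq_zero i fun l => by simp [hi, B]]
      exact Ideal.zero_mem _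
    · push Not at hq
      have : ∀ i, ∃ r, q i = some r := fun i => Option.ne_none_iff_exists'.1 (hq i)
      choose r hr using this
      convert det_mem_minorIdeal A p r using 2
      ext i j
      simp [B, hr, A, relationMatrix]
  have hsucc : ∀ k, minorIdeal B (k + 1) = minorIdeal A k := by
    intro k
    apply le_antisymm
    · refine Ideal.span_le.2 ?_
      rintro _ ⟨⟨p, q⟩, rfl⟩
      -- The rows of a minor are distinct, so at most one of them is the new relation. Expanding
      -- along it (or along any row, if it is absent) leaves minors made of old relations, which
      -- vanish if they use the new column.
      obtain ⟨i₀, hi₀⟩ : ∃ i₀ : Fin (k + 1), ∀ i, i ≠ i₀ → p i ≠ none := by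
        by_cases h : ∃ i, p i = none
        · obtain ⟨i₀, h0⟩ := h
          exact ⟨i₀, fun i hi h' => hi (p.injective (h'.trans h0.symm))⟩
        · push Not at h
          exact ⟨0, fun i _ => h i⟩
      have : ∀ i : Fin k, ∃ r, p (i₀.succAbove i) = some r := fun i =>
        Option.ne_none_iff_exists'.1 (hi₀ _ (Fin.succAbove_ne i₀ i))
      choose r hr using this
      simp only [SetLike.mem_coe]
      rw [Matrix.det_succ_row _ i₀]
      refine Ideal.sum_mem _ fun j _ => Ideal.mul_mem_left _ _ ?_
      convert hAB k r (fun i => q (j.succAbove i)) using 2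
      ext i l
      simp [hr]
    · rw [minorIdeal_le_iff]
      intro p q
      have h := det_mem_minorIdeal B (k := k + 1) (Fin.cons none fun i => some (p i))
        (Fin.cons none fun i => some (q i))
      rw [Matrix.det_succ_column_zero, Fin.sum_univ_succ] at h
      convert h using 1
      rw [Finset.sum_eq_zero (fun i _ => by simp [B])]
      simp only [Matrix.submatrix_apply, Fin.cons_zero, Fin.val_zero, pow_zero, one_mul, add_zero]
      rw [show B none none = 1 from rfl, one_mul]
      rfl
  unfold fittingIdeal
  rw [← hB.minorIdeal_eq, Fintype.card_option]
  -- The subtraction is truncated: for large `m` both sizes are zero and both ideals are the whole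
  -- ring.
  rcases Nat.lt_or_ge (Fintype.card κ + 1) m with h | h
  · rw [show Fintype.card κ + 1 + 1 - m = 0 by omega, show Fintype.card κ + 1 - m = 0 by omega,
      minorIdeal_zero, minorIdeal_zero]
  · rw [show Fintype.card κ + 1 + 1 - m = (Fintype.card κ + 1 - m) + 1 by omega, hsucc]

theorem fittingIdeal_sum {κ : Type*} [Fintype κ] (x : κ → M)
    (hx : Submodule.span R (Set.range x) = ⊤) (m n : ℕ) (y : Fin n → M) :
    fittingIdeal R (Sum.elim x y) m = fittingIdeal R x m := by
  induction n with
  | zero =>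
    rw [← fittingIdeal_reindex x (Equiv.sumEmpty κ (Fin 0))]
    congr 1
    ext j
    rcases j with j | j
    · rfl
    · exact j.elim0
  | succ n ih =>
    rw [← ih (fun i => y i.succ),
      ← fittingIdeal_option (Sum.elim x fun i : Fin n => y i.succ) _ (y 0)]
    · let e : κ ⊕ Fin (n + 1) ≃ Option (κ ⊕ Fin n) :=
        ((Equiv.refl κ).sumCongr (finSuccEquiv n)).trans
          { toFun := Sum.elim (fun k => some (Sum.inl k))
              fun o => o.elim none fun i => some (Sum.inr i)
            invFun := fun o => o.elim (Sum.inr none) (Sum.elim Sum.inl fun i => Sum.inr (some i))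
            left_inv := by rintro (k | _ | i) <;> rfl
            right_inv := by rintro (_ | k | i) <;> rfl }
      rw [← fittingIdeal_reindex _ e]
      congr 1
      ext j
      rcases j with j | j
      · rfl
      · refine Fin.cases ?_ (fun i => ?_) j <;> simp [e]
    · rw [eq_top_iff, ← hx]
      refine Submodule.span_mono ?_
      rintro _ ⟨k, rfl⟩
      exact ⟨Sum.inl k, rfl⟩

/-- Fitting's lemma: the ideals do not depend on the generators. -/
theorem fittingIdeal_eq {κ κ' : Type*} [Fintype κ] [Fintype κ'] (x : κ → M) (y : κ' → M)
    (hx : Submodule.span R (Set.range x) = ⊤) (hy : Submodule.span R (Set.range y) = ⊤) (m : ℕ) :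
    fittingIdeal R x m = fittingIdeal R y m := by
  have hx' : fittingIdeal R (x ∘ (Fintype.equivFin κ).symm) m = fittingIdeal R x m :=
    fittingIdeal_reindex x _ m
  have hy' : fittingIdeal R (y ∘ (Fintype.equivFin κ').symm) m = fittingIdeal R y m :=
    fittingIdeal_reindex y _ m
  rw [← hx', ← hy']
  set x' := x ∘ (Fintype.equivFin κ).symm
  set y' := y ∘ (Fintype.equivFin κ').symm
  -- Both families are compared with their union, in which either one is redundant.
  have h1 := fittingIdeal_sum x' (by simpa [x', Set.range_comp] using hx) m _ y'
  have h2 := fittingIdeal_sum y' (by simpa [y', Set.range_comp] using hy) m _ x'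
  rw [← h1, ← h2, ← fittingIdeal_reindex (Sum.elim y' x') (Equiv.sumComm _ _)]
  congr 1
  ext j
  rcases j with j | j <;> rfl

theorem IsPresentation.minorIdeal_eq_of_isPresentation {ι κ ι' κ' : Type*} [Fintype κ]
    [Fintype κ'] {A : Matrix ι κ R} {x : κ → M} {B : Matrix ι' κ' R} {y : κ' → M}
    (hA : IsPresentation A x) (hB : IsPresentation B y) (m : ℕ) :
    minorIdeal A (Fintype.card κ + 1 - m) = minorIdeal B (Fintype.card κ' + 1 - m) := by
  rw [hA.minorIdeal_eq, hB.minorIdeal_eq]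
  exact fittingIdeal_eq x y hA.span_eq_top hB.span_eq_top m

end Fitting

/-! ### Modules that represent systems of linear conditions. -/

section Universal

variable {R : Type} [CommRing R]

/-- A condition on families of elements of modules. -/
abbrev System (R : Type) [CommRing R] (J : Type) : Type 1 :=
  ∀ (X : Type) [AddCommGroup X] [Module R X], (J → X) → Prop

/-- The family `x` satisfies the condition, and every other such family is its image under exactly
one linear map. -/
structure IsUniversal {J : Type} (P : System R J) {M : Type} [AddCommGroup M] [Module R M]
    (x : J → M) : Prop where
  mem : P M x
  existsUnique : ∀ (X : Type) [AddCommGroup X] [Module R X] (c : J → X), P X c →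
    ∃! φ : M →ₗ[R] X, (fun j => φ (x j)) = c

/-- Universal families are transported along natural bijections. -/
theorem IsUniversal.transport {J J' : Type} {P : System R J} {Q : System R J'}
    (F : ∀ (X : Type) [AddCommGroup X] [Module R X], (J → X) → J' → X)
    (G : ∀ (X : Type) [AddCommGroup X] [Module R X], (J' → X) → J → X)
    (hF : ∀ (X : Type) [AddCommGroup X] [Module R X] (c : J → X), P X c → Q X (F X c))
    (hG : ∀ (X : Type) [AddCommGroup X] [Module R X] (c : J' → X), Q X c → P X (G X c))
    (natF : ∀ (X Y : Type) [AddCommGroup X] [Module R X] [AddCommGroup Y] [Module R Y]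
      (φ : X →ₗ[R] Y) (c : J → X), (fun j => φ (F X c j)) = F Y fun j => φ (c j))
    (natG : ∀ (X Y : Type) [AddCommGroup X] [Module R X] [AddCommGroup Y] [Module R Y]
      (φ : X →ₗ[R] Y) (c : J' → X), (fun j => φ (G X c j)) = G Y fun j => φ (c j))
    (hGF : ∀ (X : Type) [AddCommGroup X] [Module R X] (c : J → X), P X c → G X (F X c) = c)
    (hFG : ∀ (X : Type) [AddCommGroup X] [Module R X] (c : J' → X), Q X c → F X (G X c) = c)
    {M : Type} [AddCommGroup M] [Module R M] {x : J → M} (hx : IsUniversal P x) :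
    IsUniversal Q (F M x) := by
  refine ⟨hF M x hx.mem, fun X _ _ c hc => ?_⟩
  obtain ⟨φ, h1, h2⟩ := hx.existsUnique X (G X c) (hG X c hc)
  refine ⟨φ, ?_, fun ψ hψ => h2 ψ ?_⟩
  · simp only [natF]
    rw [h1, hFG X c hc]
  · have := natG M X ψ (F M x)
    rw [hψ, hGF M x hx.mem] at this
    exact this

/-- The solutions of a homogeneous system of linear equations. -/
def matrixSystem {ι κ : Type} [Fintype κ] (A : Matrix ι κ R) : System R κ :=
  fun _ _ _ c => ∀ i, ∑ k, A i k • c k = 0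

/-- Uniqueness, tested on the quotient by the span of `x`, shows that `x` generates; existence,
tested on the cokernel of `A`, shows that every relation is a combination of rows. -/
theorem IsUniversal.isPresentation {ι κ : Type} [Fintype κ] {A : Matrix ι κ R} {M : Type}
    [AddCommGroup M] [Module R M] {x : κ → M} (hx : IsUniversal (matrixSystem A) x) :
    IsPresentation A x := by
  classical
  refine ⟨?_, ?_⟩
  · obtain ⟨φ, -, h⟩ := hx.existsUnique (M ⧸ Submodule.span R (Set.range x)) (fun _ => 0)
      (fun i => by simp)
    have h1 := h (Submodule.mkQ _) (by
      ext k
      exact (Submodule.Quotient.mk_eq_zero _).2 (Submodule.subset_span ⟨k, rfl⟩))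
    have h2 := h 0 (by ext k; simp)
    rw [eq_top_iff]
    intro y _
    rw [← Submodule.Quotient.mk_eq_zero, ← Submodule.mkQ_apply, h1, ← h2]
    rfl
  · apply le_antisymm
    · intro v hv
      have key : ∀ v : κ → R, ∑ k, v k • (Submodule.Quotient.mk (Pi.single k 1) :
          (κ → R) ⧸ Submodule.span R (Set.range A)) = Submodule.Quotient.mk v := by
        intro v
        conv_rhs => rw [pi_eq_sum_univ v]
        rw [← Submodule.mkQ_apply, map_sum]
        refine Finset.sum_congr rfl fun k _ => ?_
        rw [map_smul, Submodule.mkQ_apply]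
        congr 2
        ext j
        simp [Pi.single_apply, eq_comm]
      obtain ⟨φ, h1, -⟩ := hx.existsUnique ((κ → R) ⧸ Submodule.span R (Set.range A))
        (fun k => Submodule.Quotient.mk (Pi.single k 1)) (fun i => by
          rw [key]
          exact (Submodule.Quotient.mk_eq_zero _).2 (Submodule.subset_span ⟨i, rfl⟩))
      rw [← Submodule.Quotient.mk_eq_zero, ← key]
      have := congrArg φ ((mem_relations _ _).1 hv)
      simpa [fun k => congrFun h1 k] using this
    · rw [Submodule.span_le]
      rintro _ ⟨i, rfl⟩
      exact (mem_relations _ _).2 (hx.mem i)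

theorem exists_isUniversal_matrixSystem {ι κ : Type} [Fintype κ] (A : Matrix ι κ R) :
    ∃ (M : Type) (_ : AddCommGroup M) (_ : Module R M) (x : κ → M),
      IsUniversal (matrixSystem A) x := by
  classical
  refine ⟨(κ → R) ⧸ Submodule.span R (Set.range A), inferInstance, inferInstance,
    fun k => Submodule.Quotient.mk (Pi.single k 1), ?_, ?_⟩
  · intro i
    have : ∑ k, A i k • (Pi.single k 1 : κ → R) = A i := by
      ext j
      simp [Finset.sum_apply, Pi.single_apply]
    simp only [← Submodule.mkQ_apply, ← map_smul, ← map_sum]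
    rw [this]
    exact (Submodule.Quotient.mk_eq_zero _).2 (Submodule.subset_span ⟨i, rfl⟩)
  · intro X _ _ c hc
    refine ⟨Submodule.liftQ _ (Fintype.linearCombination R c) ?_, ?_, ?_⟩
    · rw [Submodule.span_le]
      rintro _ ⟨i, rfl⟩
      simpa [Fintype.linearCombination_apply] using hc i
    · ext k
      simp
    · intro ψ hψ
      refine Submodule.linearMap_qext _ (LinearMap.pi_ext' fun k => LinearMap.ext_ring ?_)
      simpa using congrFun hψ k

end Universal

/-! ### Colorings of Gauss words, and invariance under rotation, renaming and the first two
Reidemeister moves. -/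

section Coloring

variable {X Y : Type} [AddCommGroup X] [Module ℤ[T;T⁻¹] X] [AddCommGroup Y] [Module ℤ[T;T⁻¹] Y]

/-- The color of the strand behind a passage, computed from the color `x` in front of it and the
colors `c` of the upper strands of the crossings. -/
noncomputable def pass (c : ℕ → X) (x : X) (l : Letter) : X :=
  if l.isOver then x else tPow l.isPos • x + (1 - tPow l.isPos) • c l.label

/-- The color at the end of a sequence of passages. -/
noncomputable def endColor (c : ℕ → X) (w : List Letter) (x : X) : X := w.foldl (pass c) x

/-- The color changes from `x` to `y` along `w`, and `c` gives the colors of the upper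
passages. -/
def Runs (c : ℕ → X) : List Letter → X → X → Prop
  | [], x, y => x = y
  | l :: w, x, y => (l.isOver = true → c l.label = x) ∧ Runs c w (pass c x l) y

theorem runs_append (c : ℕ → X) (u v : List Letter) (x y : X) :
    Runs c (u ++ v) x y ↔ ∃ z, Runs c u x z ∧ Runs c v z y := by
  induction u generalizing x with
  | nil => simp [Runs]
  | cons l u ih => simp [Runs, ih, and_assoc]

theorem Runs.endColor_eq {c : ℕ → X} {w : List Letter} {x y : X} (h : Runs c w x y) :
    endColor c w x = y := by
  induction w generalizing x with
  | nil => exact h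
  | cons l w ih => exact ih h.2

theorem runs_congr {c c' : ℕ → X} {w : List Letter}
    (h : ∀ a ∈ w.map Letter.label, c a = c' a) (x y : X) : Runs c w x y ↔ Runs c' w x y := by
  induction w generalizing x with
  | nil => rfl
  | cons l w ih =>
    simp only [List.map_cons, List.mem_cons, forall_eq_or_imp] at h
    simp only [Runs, pass, h.1, ih h.2]

/-- The coefficients t^s and 1 - t^s add up to 1, so a coloring can be translated by a constant. -/
theorem Runs.sub {c c' : ℕ → X} {w : List Letter} {z : X}
    (h : ∀ a ∈ w.map Letter.label, c' a = c a - z) {x y : X} (hr : Runs c w x y) :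
    Runs c' w (x - z) (y - z) := by
  induction w generalizing x with
  | nil => simpa [Runs] using hr
  | cons l w ih =>
    simp only [List.map_cons, List.mem_cons, forall_eq_or_imp] at h
    refine ⟨fun ho => by rw [h.1, hr.1 ho], ?_⟩
    have := ih h.2 hr.2
    convert this using 1
    unfold pass
    split_ifs
    · rfl
    · rw [h.1]; module

theorem map_endColor (φ : X →ₗ[ℤ[T;T⁻¹]] Y) (c : ℕ → X) (w : List Letter) (x : X) :
    φ (endColor c w x) = endColor (fun a => φ (c a)) w (φ x) := by
  induction w generalizing x with
  | nil => rfl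
  | cons l w ih =>
    simp only [endColor, List.foldl_cons] at ih ⊢
    rw [ih]
    congr 1
    unfold pass
    split_ifs <;> simp

/-- The colorings of a word for which the initial strand has the color zero. -/
def coloringSystem (w : List Letter) : System ℤ[T;T⁻¹] ℕ :=
  fun _ _ _ c => (∀ a, a ∉ w.map Letter.label → c a = 0) ∧ Runs c w 0 0

/-- The module `M` carries a universal coloring of `w`. -/
def Presents (w : List Letter) (M : Type) [AddCommGroup M] [Module ℤ[T;T⁻¹] M] : Prop :=
  ∃ c : ℕ → M, IsUniversal (coloringSystem w) c

theorem tPow_mul_not (s : Bool) : tPow s * tPow (!s) = 1 := by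
  cases s <;> rw [← LaurentPolynomial.T_zero, tPow, tPow] <;>
    simp only [Bool.not_false, Bool.not_true, if_true, Bool.false_eq_true, if_false] <;>
    rw [← LaurentPolynomial.T_add] <;> rfl

theorem tPow_smul_not (s : Bool) (x : X) : tPow s • tPow (!s) • x = x := by
  rw [smul_smul, tPow_mul_not, one_smul]

theorem tPow_not_smul (s : Bool) (x : X) : tPow (!s) • tPow s • x = x := by
  rw [smul_smul, mul_comm, tPow_mul_not, one_smul]

/-- Serves to show that the crossings taking part in a Reidemeister move do not occur in the rest of
the word. -/
theorem IsGaussWord.count_le {w : List Letter} (h : IsGaussWord w) (a : ℕ) :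
    (w.map Letter.label).count a ≤ 2 := by
  rw [List.count_eq_length_filter, List.filter_map, List.length_map]
  set l := w.filter ((fun x => x == a) ∘ Letter.label) with hl
  have hmem : ∀ y ∈ l, y ∈ w ∧ y.label = a := fun y hy => by simpa [hl] using hy
  rcases hl' : l with _ | ⟨x, l'⟩
  · simp
  · rw [← hl']
    have hx := hmem x (by simp [hl'])
    have : l ⊆ [x, x.mate] := by
      intro y hy
      have hy := hmem y hy
      simpa using h.eq_or_eq_mate x hx.1 y hy.1 (hy.2.trans hx.2.symm)
    exact ((h.nodup.filter _).subperm this).length_le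

theorem count_ordered (b : Bool) (x y : Letter) (a : ℕ) :
    ((ordered b x y).map Letter.label).count a = [x.label].count a + [y.label].count a := by
  cases b <;> simp [ordered, List.count_cons, add_comm]

/-- Subtracting the color at the new starting point restores the normalization there. Outside the
labels of the word the value must remain zero, hence the case distinction in `F`. -/
theorem Presents.rotate {u v : List Letter} {M : Type} [AddCommGroup M] [Module ℤ[T;T⁻¹] M]
    (h : Presents (u ++ v) M) : Presents (v ++ u) M := by
  classical
  obtain ⟨c₀, h₀⟩ := h
  let F : List Letter → List Letter → ∀ (X : Type) [AddCommGroup X] [Module ℤ[T;T⁻¹] X],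
      (ℕ → X) → ℕ → X := fun u v X _ _ c a =>
    if a ∈ (u ++ v).map Letter.label then c a - endColor c u 0 else 0
  have hmem : ∀ (u v : List Letter) a,
      a ∈ (u ++ v).map Letter.label ↔ a ∈ (v ++ u).map Letter.label := by
    intro u v a
    simp [or_comm]
  have hF : ∀ (u v : List Letter) (X : Type) [AddCommGroup X] [Module ℤ[T;T⁻¹] X] (c : ℕ → X),
      coloringSystem (u ++ v) X c → coloringSystem (v ++ u) X (F u v X c) ∧
        endColor (F u v X c) v 0 = - endColor c u 0 := by
    intro u v X _ _ c hc
    obtain ⟨z, h1, h2⟩ := (runs_append _ _ _ _ _).1 hc.2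
    have hz : endColor c u 0 = z := h1.endColor_eq
    have hc' : ∀ a ∈ (u ++ v).map Letter.label, F u v X c a = c a - z := by
      intro a ha
      simp only [F, if_pos ha, hz]
    have h1' := h1.sub (c' := F u v X c) (z := z) (fun a ha => hc' a (by
      rw [List.map_append]; exact List.mem_append_left _ ha))
    have h2' := h2.sub (c' := F u v X c) (z := z) (fun a ha => hc' a (by
      rw [List.map_append]; exact List.mem_append_right _ ha))
    rw [sub_self, zero_sub] at h1' h2'
    refine ⟨⟨fun a ha => ?_, (runs_append _ _ _ _ _).2 ⟨_, h2', h1'⟩⟩, ?_⟩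
    · rw [← hmem u v] at ha
      simp only [F, if_neg ha]
    · rw [hz, h2'.endColor_eq]
  have hnat : ∀ (u v : List Letter) (X Y : Type) [AddCommGroup X] [Module ℤ[T;T⁻¹] X]
      [AddCommGroup Y] [Module ℤ[T;T⁻¹] Y] (φ : X →ₗ[ℤ[T;T⁻¹]] Y) (c : ℕ → X),
      (fun a => φ (F u v X c a)) = F u v Y fun a => φ (c a) := by
    intro u v X Y _ _ _ _ φ c
    ext a
    simp only [F]
    split_ifs
    · rw [map_sub, map_endColor, map_zero]
    · exact map_zero φ
  have hinv : ∀ (u v : List Letter) (X : Type) [AddCommGroup X] [Module ℤ[T;T⁻¹] X] (c : ℕ → X),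
      coloringSystem (u ++ v) X c → F v u X (F u v X c) = c := by
    intro u v X _ _ c hc
    ext a
    have := (hF u v X c hc).2
    by_cases ha : a ∈ (u ++ v).map Letter.label
    · have h1 : F u v X c a = c a - endColor c u 0 := if_pos ha
      have h2 : F v u X (F u v X c) a = F u v X c a - endColor (F u v X c) v 0 :=
        if_pos ((hmem u v a).1 ha)
      rw [h2, h1, this]
      abel
    · rw [hc.1 a ha]
      exact if_neg (fun h => ha ((hmem u v a).2 h))
  exact ⟨_, h₀.transport (F u v) (F v u) (fun X _ _ c hc => (hF u v X c hc).1)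
    (fun X _ _ c hc => (hF v u X c hc).1) (hnat u v) (hnat v u) (hinv u v) (hinv v u)⟩

theorem map_label_relabel (f : ℕ → ℕ) (w : List Letter) :
    (w.map (Letter.relabel f)).map Letter.label = (w.map Letter.label).map f := by
  simp [Function.comp_def, Letter.relabel]

theorem runs_relabel (f : ℕ → ℕ) (c : ℕ → X) (w : List Letter) (x y : X) :
    Runs c (w.map (Letter.relabel f)) x y ↔ Runs (c ∘ f) w x y := by
  induction w generalizing x with
  | nil => rfl
  | cons l w ih => simp only [List.map_cons, Runs, ih]; rfl

theorem presents_relabel_iff (f : ℕ → ℕ) (hf : Function.Injective f) (w : List Letter) (M : Type)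
    [AddCommGroup M] [Module ℤ[T;T⁻¹] M] :
    Presents w M ↔ Presents (w.map (Letter.relabel f)) M := by
  let F : ∀ (X : Type) [AddCommGroup X] [Module ℤ[T;T⁻¹] X], (ℕ → X) → ℕ → X :=
    fun X _ _ c => Function.extend f c 0
  let G : ∀ (X : Type) [AddCommGroup X] [Module ℤ[T;T⁻¹] X], (ℕ → X) → ℕ → X :=
    fun X _ _ c => c ∘ f
  have hGF : ∀ (X : Type) [AddCommGroup X] [Module ℤ[T;T⁻¹] X] (c : ℕ → X), G X (F X c) = c :=
    fun X _ _ c => funext fun a => hf.extend_apply c 0 a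
  have hF : ∀ (X : Type) [AddCommGroup X] [Module ℤ[T;T⁻¹] X] (c : ℕ → X),
      coloringSystem w X c → coloringSystem (w.map (Letter.relabel f)) X (F X c) := by
    intro X _ _ c hc
    refine ⟨fun a ha => ?_, ?_⟩
    · rw [map_label_relabel] at ha
      by_cases h : ∃ b, f b = a
      · obtain ⟨b, rfl⟩ := h
        simp only [F, hf.extend_apply]
        exact hc.1 b fun hb => ha (List.mem_map_of_mem hb)
      · simp [F, Function.extend_apply' _ _ _ h]
    · rw [runs_relabel]
      have := hGF X c
      simp only [G] at this
      rw [this]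
      exact hc.2
  have hG : ∀ (X : Type) [AddCommGroup X] [Module ℤ[T;T⁻¹] X] (c : ℕ → X),
      coloringSystem (w.map (Letter.relabel f)) X c → coloringSystem w X (G X c) := by
    intro X _ _ c hc
    refine ⟨fun a ha => hc.1 _ ?_, (runs_relabel f c w 0 0).1 hc.2⟩
    rw [map_label_relabel, List.mem_map_of_injective hf]
    exact ha
  have hFG : ∀ (X : Type) [AddCommGroup X] [Module ℤ[T;T⁻¹] X] (c : ℕ → X),
      coloringSystem (w.map (Letter.relabel f)) X c → F X (G X c) = c := by
    intro X _ _ c hc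
    ext a
    by_cases h : ∃ b, f b = a
    · obtain ⟨b, rfl⟩ := h
      simp [F, G, hf.extend_apply]
    · rw [hc.1 a]
      · simp [F, Function.extend_apply' _ _ _ h]
      · rw [map_label_relabel, List.mem_map]
        rintro ⟨b, -, hb⟩
        exact h ⟨b, hb⟩
  have hnF : ∀ (X Y : Type) [AddCommGroup X] [Module ℤ[T;T⁻¹] X] [AddCommGroup Y]
      [Module ℤ[T;T⁻¹] Y] (φ : X →ₗ[ℤ[T;T⁻¹]] Y) (c : ℕ → X),
      (fun a => φ (F X c a)) = F Y fun a => φ (c a) := by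
    intro X Y _ _ _ _ φ c
    ext a
    by_cases h : ∃ b, f b = a
    · obtain ⟨b, rfl⟩ := h
      simp [F, hf.extend_apply]
    · simp [F, Function.extend_apply' _ _ _ h]
  have hnG : ∀ (X Y : Type) [AddCommGroup X] [Module ℤ[T;T⁻¹] X] [AddCommGroup Y]
      [Module ℤ[T;T⁻¹] Y] (φ : X →ₗ[ℤ[T;T⁻¹]] Y) (c : ℕ → X),
      (fun a => φ (G X c a)) = G Y fun a => φ (c a) := fun _ _ _ _ _ _ _ _ => rfl
  constructor
  · rintro ⟨c, hc⟩
    exact ⟨_, hc.transport F G hF hG hnF hnG (fun X _ _ c _ => hGF X c) hFG⟩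
  · rintro ⟨c, hc⟩
    exact ⟨_, hc.transport G F hG hF hnG hnF hFG (fun X _ _ c _ => hGF X c)⟩

theorem presents_congr {w w' : List Letter}
    (h : ∀ (X : Type) [AddCommGroup X] [Module ℤ[T;T⁻¹] X] (c : ℕ → X),
      coloringSystem w X c ↔ coloringSystem w' X c) (M : Type) [AddCommGroup M]
    [Module ℤ[T;T⁻¹] M] : Presents w M ↔ Presents w' M := by
  constructor
  · rintro ⟨c, hc⟩
    exact ⟨c, (h M c).1 hc.mem, fun X _ _ c' h' => hc.existsUnique X c' ((h X c').2 h')⟩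
  · rintro ⟨c, hc⟩
    exact ⟨c, (h M c).2 hc.mem, fun X _ _ c' h' => hc.existsUnique X c' ((h X c').1 h')⟩

/-- If the lower passage comes first, the relation says t^s (c a - x) = 0, and t^s is a unit. -/
theorem runs_kink (c : ℕ → X) (a : ℕ) (o s : Bool) (x y : X) :
    Runs c [⟨a, o, s⟩, ⟨a, !o, s⟩] x y ↔ c a = x ∧ y = x := by
  cases o
  · simp only [Runs, pass, Bool.false_eq_true, if_false, Bool.not_false, if_true, false_imp_iff,
      true_and, true_imp_iff]
    have key : c a = tPow s • x + (1 - tPow s) • c a ↔ c a = x := by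
      constructor
      · intro h
        have h2 : tPow s • c a = tPow s • x := by
          rw [← sub_eq_zero] at h ⊢
          rw [← h]
          module
        rw [← tPow_not_smul s (c a), h2, tPow_not_smul]
      · rintro rfl; module
    rw [key]
    constructor
    · rintro ⟨rfl, rfl⟩; exact ⟨rfl, by module⟩
    · rintro ⟨rfl, rfl⟩; exact ⟨rfl, by module⟩
  · simp only [Runs, pass, if_true, Bool.not_true, Bool.false_eq_true, if_false, true_imp_iff,
      false_imp_iff, true_and]
    constructor
    · rintro ⟨rfl, rfl⟩; exact ⟨rfl, by module⟩
    · rintro ⟨rfl, rfl⟩; exact ⟨rfl, by module⟩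

theorem presents_kink_iff (a : ℕ) (o s : Bool) (w : List Letter)
    (hw : IsGaussWord ([⟨a, o, s⟩, ⟨a, !o, s⟩] ++ w)) (M : Type) [AddCommGroup M]
    [Module ℤ[T;T⁻¹] M] :
    Presents w M ↔ Presents ([⟨a, o, s⟩, ⟨a, !o, s⟩] ++ w) M := by
  have ha : a ∉ w.map Letter.label := by
    have := hw.count_le a
    rw [← List.count_eq_zero]
    simp at this ⊢
    omega
  refine presents_congr (fun X _ _ c => ?_) M
  simp only [coloringSystem, runs_append, runs_kink]
  constructor
  · rintro ⟨h1, h2⟩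
    exact ⟨fun b hb => h1 b fun h => hb (by simp at h ⊢; tauto), 0, ⟨h1 a ha, rfl⟩, h2⟩
  · rintro ⟨h1, z, ⟨h2, rfl⟩, h3⟩
    refine ⟨fun b hb => ?_, h3⟩
    by_cases hba : b = a
    · rw [hba, h2]
    · exact h1 b (by simp at hb ⊢; tauto)

theorem runs_over_over (c : ℕ → X) (b : Bool) (i j : ℕ) (s s' : Bool) (x y : X) :
    Runs c (ordered b ⟨i, true, s⟩ ⟨j, true, s'⟩) x y ↔ c i = x ∧ c j = x ∧ y = x := by
  cases b <;> simp [ordered, Runs, pass] <;> tauto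

/-- The word begins with the upper piece, so the two new upper passages have the initial color zero.
This is also the prescribed value outside the labels of the old word, so the same functions `c`
color both words. The opposite signs cancel on the lower piece. -/
theorem presents_r2_iff (a b : ℕ) (s d : Bool) (u v : List Letter)
    (hw : IsGaussWord ([⟨a, true, s⟩, ⟨b, true, !s⟩] ++ u ++
          ordered d ⟨a, false, s⟩ ⟨b, false, !s⟩ ++ v)) (M : Type) [AddCommGroup M]
    [Module ℤ[T;T⁻¹] M] :
    Presents (u ++ v) M ↔ Presents ([⟨a, true, s⟩, ⟨b, true, !s⟩] ++ u ++
          ordered d ⟨a, false, s⟩ ⟨b, false, !s⟩ ++ v) M := by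
  have ha : a ∉ (u ++ v).map Letter.label := by
    have := hw.count_le a
    rw [← List.count_eq_zero]
    simp only [List.map_append, List.count_append, count_ordered, List.map_cons, List.map_nil,
      List.count_cons, List.count_nil, beq_self_eq_true, if_true] at this ⊢
    omega
  have hb : b ∉ (u ++ v).map Letter.label := by
    have := hw.count_le b
    rw [← List.count_eq_zero]
    simp only [List.map_append, List.count_append, count_ordered, List.map_cons, List.map_nil,
      List.count_cons, List.count_nil, beq_self_eq_true, if_true] at this ⊢
    omega
  refine presents_congr (fun X _ _ c => ?_) M
  have hmem : ∀ e, e ∈ (([⟨a, true, s⟩, ⟨b, true, !s⟩] : List Letter) ++ u ++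
      ordered d ⟨a, false, s⟩ ⟨b, false, !s⟩ ++ v).map Letter.label ↔
      e = a ∨ e = b ∨ e ∈ (u ++ v).map Letter.label := by
    intro e
    cases d <;> simp [ordered] <;> grind
  have h1 : ∀ x y : X, Runs c [⟨a, true, s⟩, ⟨b, true, !s⟩] x y ↔ c a = x ∧ c b = x ∧ y = x :=
    runs_over_over c true a b s _
  have h2 : c a = 0 → c b = 0 → ∀ x y : X,
      Runs c (ordered d ⟨a, false, s⟩ ⟨b, false, !s⟩) x y ↔ y = x := by
    intro ha hb x y
    cases d <;> simp [ordered, Runs, pass, ha, hb, tPow_smul_not, tPow_not_smul, eq_comm]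
  simp only [coloringSystem, hmem, runs_append, h1]
  constructor
  · rintro ⟨h3, z, h4, h5⟩
    have ha := h3 a ha
    have hb := h3 b hb
    refine ⟨fun e he => h3 e fun h => he (Or.inr (Or.inr h)), z, ⟨z, ⟨0, ⟨ha, hb, rfl⟩, h4⟩, ?_⟩, h5⟩
    exact (h2 ha hb _ _).2 rfl
  · rintro ⟨h3, z, ⟨z', ⟨_, ⟨ha, hb, rfl⟩, h4⟩, h6⟩, h5⟩
    rw [h2 ha hb] at h6
    subst h6
    refine ⟨fun e he => ?_, z, h4, h5⟩
    by_cases h : e = a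
    · rw [h, ha]
    by_cases h' : e = b
    · rw [h', hb]
    exact h3 e (by tauto)

end Coloring

/-! ### The third Reidemeister move, and invariance of the Alexander module. -/

section ThirdMove

variable {X : Type} [AddCommGroup X] [Module ℤ[T;T⁻¹] X]

/-- The third Reidemeister move changes only the color of the middle strand over the bottom
strand. -/
noncomputable def rescale (k : ℕ) (sa β : Bool) (X : Type) [AddCommGroup X]
    [Module ℤ[T;T⁻¹] X] (c : ℕ → X) : ℕ → X :=
  Function.update c k (tPow (xor sa β) • c k)

theorem rescale_self (k : ℕ) (sa β : Bool) (c : ℕ → X) :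
    rescale k sa β X c k = tPow (xor sa β) • c k := by
  simp [rescale]

theorem rescale_of_ne {k e : ℕ} (h : e ≠ k) (sa β : Bool) (c : ℕ → X) :
    rescale k sa β X c e = c e := by
  simp [rescale, h]

/-- The top strand has color zero, so passing under it multiplies by t^{±1}. The move decides
whether the middle strand does this before or after it crosses the bottom strand. -/
theorem runs_middle_iff {c c' : ℕ → X} {a k : ℕ} (ha : c a = 0) (ha' : c' a = 0)
    {sa β : Bool} (hk : c' k = tPow (xor sa β) • c k) (sc : Bool) (x y : X) :
    Runs c (ordered β ⟨a, false, sa⟩ ⟨k, true, sc⟩) x y ↔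
      Runs c' (ordered (!β) ⟨a, false, sa⟩ ⟨k, true, sc⟩) x y := by
  cases β
  · simp only [Bool.xor_false] at hk
    simp only [ordered, Runs, pass, Bool.false_eq_true, if_false, if_true, Bool.not_false,
      true_imp_iff, false_imp_iff, true_and, ha, ha', smul_zero, add_zero, hk]
    refine and_congr_left fun _ => ⟨fun h => by rw [h], fun h => ?_⟩
    rw [← tPow_not_smul sa (c k), h, tPow_not_smul]
  · simp only [Bool.xor_true] at hk
    simp only [ordered, Runs, pass, Bool.false_eq_true, if_false, if_true, Bool.not_true,
      true_imp_iff, false_imp_iff, true_and, ha, ha', smul_zero, add_zero, hk]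
    refine and_congr_left fun _ => ⟨fun h => by rw [h, tPow_not_smul], fun h => ?_⟩
    rw [← h, tPow_smul_not]

/-- On the bottom strand the contribution of the middle strand is multiplied by t^{±1} on exactly
one side of the move. The condition `h` on orientations makes the rescaling of `c k` compensate for
this. -/
theorem runs_bottom_iff {c c' : ℕ → X} {b k : ℕ} (hb : c b = 0) (hb' : c' b = 0)
    {sa sb β γ : Bool} (h : (β = γ) ↔ (sa = sb)) (hk : c' k = tPow (xor sa β) • c k) (sc : Bool)
    (x y : X) :
    Runs c (ordered γ ⟨b, false, sb⟩ ⟨k, false, sc⟩) x y ↔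
      Runs c' (ordered (!γ) ⟨b, false, sb⟩ ⟨k, false, sc⟩) x y := by
  have key : ∀ {p q : X}, p = q → (p = y ↔ q = y) := fun h => by rw [h]
  cases γ
  · simp only [ordered, Runs, pass, Bool.false_eq_true, if_false, if_true, Bool.not_false,
      false_imp_iff, true_and, hb, hb', smul_zero, add_zero, hk]
    have : xor sa β = sb := by cases β <;> cases sa <;> cases sb <;> simp_all
    rw [this]
    apply key
    module
  · simp only [ordered, Runs, pass, Bool.false_eq_true, if_false, if_true, Bool.not_true,
      false_imp_iff, true_and, hb, hb', smul_zero, add_zero, hk]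
    have : xor sa β = !sb := by cases β <;> cases sa <;> cases sb <;> simp_all
    rw [this]
    apply key
    simp only [smul_add, smul_smul]
    congr 1
    · rw [mul_comm]
    · rw [mul_left_comm, tPow_mul_not, mul_one]

/-- The word on one side of a third Reidemeister move; `p` tells whether the middle strand comes
before the bottom strand. -/
def triangleWord (p : Bool) (a b k : ℕ) (sa sb sc α β γ : Bool) (u v w : List Letter) :
    List Letter :=
  bif p then
    ordered α ⟨a, true, sa⟩ ⟨b, true, sb⟩ ++ u ++
      ordered β ⟨a, false, sa⟩ ⟨k, true, sc⟩ ++ v ++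
      ordered γ ⟨b, false, sb⟩ ⟨k, false, sc⟩ ++ w
  else
    ordered α ⟨a, true, sa⟩ ⟨b, true, sb⟩ ++ u ++
      ordered γ ⟨b, false, sb⟩ ⟨k, false, sc⟩ ++ v ++
      ordered β ⟨a, false, sa⟩ ⟨k, true, sc⟩ ++ w

theorem count_triangleWord (p : Bool) (a b k : ℕ) (sa sb sc α β γ : Bool) (u v w : List Letter)
    (e : ℕ) : ((triangleWord p a b k sa sb sc α β γ u v w).map Letter.label).count e =
      2 * [a].count e + 2 * [b].count e + 2 * [k].count e + (u.map Letter.label).count e +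
        (v.map Letter.label).count e + (w.map Letter.label).count e := by
  cases p <;> simp only [triangleWord, cond_true, cond_false, List.map_append, List.count_append,
    count_ordered] <;> ring

theorem coloringSystem_triangleWord {p : Bool} {a b k : ℕ} {sa sb sc α β γ : Bool}
    {u v w : List Letter} (hβ : (α = β) ↔ (sb = sc)) (hγ : (α = γ) ↔ (sa = sc))
    (hw : IsGaussWord (triangleWord p a b k sa sb sc α β γ u v w)) {c : ℕ → X}
    (hc : coloringSystem (triangleWord p a b k sa sb sc α β γ u v w) X c) :
    coloringSystem (triangleWord p a b k sa sb sc (!α) (!β) (!γ) u v w) X (rescale k sa β X c) := by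
  have h := hw.count_le
  simp only [count_triangleWord] at h
  have hak : a ≠ k := by
    rintro rfl
    have := h a
    simp only [List.count_cons, List.count_nil, beq_self_eq_true, if_true] at this
    omega
  have hbk : b ≠ k := by
    rintro rfl
    have := h b
    simp only [List.count_cons, List.count_nil, beq_self_eq_true, if_true] at this
    omega
  have hk := h k
  simp only [List.count_cons, List.count_nil, beq_self_eq_true, if_true] at hk
  have hku : k ∉ u.map Letter.label := by rw [← List.count_eq_zero]; omega
  have hkv : k ∉ v.map Letter.label := by rw [← List.count_eq_zero]; omega
  have hkw : k ∉ w.map Letter.label := by rw [← List.count_eq_zero]; omega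
  have hcongr : ∀ l : List Letter, k ∉ l.map Letter.label → ∀ x y : X,
      (Runs c l x y ↔ Runs (rescale k sa β X c) l x y) := fun l hl x y =>
    runs_congr (fun e he => (rescale_of_ne (by rintro rfl; exact hl he) sa β c).symm) x y
  -- The two hypotheses on the placement of the strands imply the third one, which relates middle
  -- and bottom strand.
  have hs : (β = γ) ↔ (sa = sb) := by
    revert hβ hγ
    cases α <;> cases β <;> cases γ <;> cases sa <;> cases sb <;> cases sc <;> simp
  have hca : rescale k sa β X c a = c a := rescale_of_ne hak sa β c
  have hcb : rescale k sa β X c b = c b := rescale_of_ne hbk sa β c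
  refine ⟨fun e he => ?_, ?_⟩
  · have he' : e ∉ (triangleWord p a b k sa sb sc α β γ u v w).map Letter.label := by
      rw [← List.count_eq_zero] at he ⊢
      rw [count_triangleWord] at he ⊢
      exact he
    by_cases hek : e = k
    · rw [hek, rescale_self, ← hek, hc.1 e he', smul_zero]
    · rw [rescale_of_ne hek, hc.1 e he']
  · have h2 := hc.2
    cases p
    · simp only [triangleWord, cond_false, runs_append, runs_over_over] at h2 ⊢
      obtain ⟨z5, ⟨z4, ⟨z3, ⟨z2, ⟨z1, ⟨ha, hb, rfl⟩, r1⟩, r2⟩, r3⟩, r4⟩, r5⟩ := h2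
      rw [ha] at hca
      rw [hb] at hcb
      exact ⟨z5, ⟨z4, ⟨z3, ⟨z2, ⟨0, ⟨hca, hcb, rfl⟩, (hcongr u hku _ _).1 r1⟩,
        (runs_bottom_iff hb hcb hs (rescale_self k sa β c) sc _ _).1 r2⟩,
        (hcongr v hkv _ _).1 r3⟩,
        (runs_middle_iff ha hca (rescale_self k sa β c) sc _ _).1 r4⟩, (hcongr w hkw _ _).1 r5⟩
    · simp only [triangleWord, cond_true, runs_append, runs_over_over] at h2 ⊢
      obtain ⟨z5, ⟨z4, ⟨z3, ⟨z2, ⟨z1, ⟨ha, hb, rfl⟩, r1⟩, r2⟩, r3⟩, r4⟩, r5⟩ := h2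
      rw [ha] at hca
      rw [hb] at hcb
      exact ⟨z5, ⟨z4, ⟨z3, ⟨z2, ⟨0, ⟨hca, hcb, rfl⟩, (hcongr u hku _ _).1 r1⟩,
        (runs_middle_iff ha hca (rescale_self k sa β c) sc _ _).1 r2⟩,
        (hcongr v hkv _ _).1 r3⟩,
        (runs_bottom_iff hb hcb hs (rescale_self k sa β c) sc _ _).1 r4⟩, (hcongr w hkw _ _).1 r5⟩

theorem rescale_rescale (k : ℕ) (sa β : Bool) (c : ℕ → X) :
    rescale k sa (!β) X (rescale k sa β X c) = c := by
  ext e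
  by_cases h : e = k
  · subst h
    rw [rescale_self, rescale_self, smul_smul]
    have : tPow (xor sa (!β)) * tPow (xor sa β) = 1 := by
      rw [Bool.xor_not, mul_comm, tPow_mul_not]
    rw [this, one_smul]
  · rw [rescale_of_ne h, rescale_of_ne h]

theorem presents_triangleWord {p : Bool} {a b k : ℕ} {sa sb sc α β γ : Bool}
    {u v w : List Letter} (hβ : (α = β) ↔ (sb = sc)) (hγ : (α = γ) ↔ (sa = sc))
    (hw : IsGaussWord (triangleWord p a b k sa sb sc α β γ u v w))
    (hw' : IsGaussWord (triangleWord p a b k sa sb sc (!α) (!β) (!γ) u v w)) {M : Type}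
    [AddCommGroup M] [Module ℤ[T;T⁻¹] M]
    (h : Presents (triangleWord p a b k sa sb sc α β γ u v w) M) :
    Presents (triangleWord p a b k sa sb sc (!α) (!β) (!γ) u v w) M := by
  obtain ⟨c, hc⟩ := h
  have hnat : ∀ (β : Bool) (X Y : Type) [AddCommGroup X] [Module ℤ[T;T⁻¹] X]
      [AddCommGroup Y] [Module ℤ[T;T⁻¹] Y] (φ : X →ₗ[ℤ[T;T⁻¹]] Y) (c : ℕ → X),
      (fun a => φ (rescale k sa β X c a)) = rescale k sa β Y fun a => φ (c a) := by
    intro β X Y _ _ _ _ φ c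
    ext e
    by_cases h : e = k
    · rw [h, rescale_self, rescale_self, map_smul]
    · rw [rescale_of_ne h, rescale_of_ne h]
  refine ⟨_, hc.transport (rescale k sa β) (rescale k sa (!β))
    (fun X _ _ c hc => coloringSystem_triangleWord hβ hγ hw hc) (fun X _ _ c hc => ?_)
    (hnat β) (hnat !β) (fun X _ _ c _ => rescale_rescale k sa β c) (fun X _ _ c _ => ?_)⟩
  · have := coloringSystem_triangleWord (by simpa using hβ) (by simpa using hγ) hw' hc
    simpa using this
  · have := rescale_rescale k sa (!β) c
    simpa using this

theorem presents_triangleWord_iff {p : Bool} {a b k : ℕ} {sa sb sc α β γ : Bool}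
    {u v w : List Letter} (hβ : (α = β) ↔ (sb = sc)) (hγ : (α = γ) ↔ (sa = sc))
    (hw : IsGaussWord (triangleWord p a b k sa sb sc α β γ u v w))
    (hw' : IsGaussWord (triangleWord p a b k sa sb sc (!α) (!β) (!γ) u v w)) (M : Type)
    [AddCommGroup M] [Module ℤ[T;T⁻¹] M] :
    Presents (triangleWord p a b k sa sb sc α β γ u v w) M ↔
      Presents (triangleWord p a b k sa sb sc (!α) (!β) (!γ) u v w) M := by
  refine ⟨presents_triangleWord hβ hγ hw hw', fun h => ?_⟩
  have := presents_triangleWord (by simpa using hβ) (by simpa using hγ) hw'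
    (by simpa only [Bool.not_not] using hw) h
  simpa only [Bool.not_not] using this

theorem ReidemeisterStep.presents_iff {w w' : List Letter} (h : ReidemeisterStep w w')
    (hw : IsGaussWord w) (hw' : IsGaussWord w') (M : Type) [AddCommGroup M]
    [Module ℤ[T;T⁻¹] M] : Presents w M ↔ Presents w' M := by
  cases h with
  | rotate u v => exact ⟨Presents.rotate, Presents.rotate⟩
  | relabel f hf w => exact presents_relabel_iff f hf w M
  | r1 a o s w => exact presents_kink_iff a o s w hw' M
  | r2 a b s d u v => exact presents_r2_iff a b s d u v hw' M
  | r3 a b k sa sb sc α β γ u v w hβ hγ =>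
    exact presents_triangleWord_iff (p := true) hβ hγ hw hw' M
  | r3' a b k sa sb sc α β γ u v w hβ hγ =>
    exact presents_triangleWord_iff (p := false) hβ hγ hw hw' M

/-- Diagrams of the same knot have the same Alexander module. -/
theorem presents_iff_of_knot_eq {D D' : KnotDiagram} (h : D.knot = D'.knot) (M : Type)
    [AddCommGroup M] [Module ℤ[T;T⁻¹] M] : Presents D.word M ↔ Presents D'.word M := by
  have h' := Quot.eqvGen_exact h
  clear h
  induction h' with
  | rel D D' h => exact ReidemeisterStep.presents_iff h D.isGaussWord D'.isGaussWord M
  | refl => rfl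
  | symm D D' _ ih => exact ih.symm
  | trans D D' D'' _ _ ih ih' => exact ih.trans ih'

end ThirdMove

/-! ### Solutions of the Alexander matrix are colorings. -/

section Alexander

theorem val_finRotate {n : ℕ} (i : Fin n) : (finRotate n i : ℕ) = (i + 1) % n := by
  have : NeZero n := ⟨by have := i.2; omega⟩
  rw [finRotate_apply, Fin.val_add, Fin.val_one', Nat.add_mod_mod]

theorem Letter.mate_ne (x : Letter) : x.mate ≠ x := by
  intro h
  have := congrArg Letter.isOver h
  simp [Letter.mate] at this

theorem IsGaussWord.exists_mate {w : List Letter} (hw : IsGaussWord w) (i : Fin w.length) :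
    ∃ k, w.get k = (w.get i).mate ∧ ∀ e, Meets w i e ↔ e = k := by
  obtain ⟨k, hk⟩ := List.get_of_mem (hw.mate_mem _ (List.get_mem w i))
  refine ⟨k, hk, fun e => ⟨fun he => ?_, ?_⟩⟩
  · rcases hw.eq_or_eq_mate _ (List.get_mem w i) _ (List.get_mem w e) he.2.symm with h | h
    · exact absurd (hw.nodup.injective_get h) he.1.symm
    · exact hw.nodup.injective_get (h.trans hk.symm)
  · rintro rfl
    refine ⟨?_, by rw [hk]; rfl⟩
    rintro rfl
    exact Letter.mate_ne _ hk.symm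

variable {X : Type} [AddCommGroup X] [Module ℤ[T;T⁻¹] X]

theorem endColor_take_succ (c : ℕ → X) (w : List Letter) (x : X) (i : ℕ) (hi : i < w.length) :
    endColor c (w.take (i + 1)) x = pass c (endColor c (w.take i) x) w[i] := by
  rw [List.take_succ_eq_append_getElem hi, endColor, List.foldl_append]
  rfl

theorem runs_iff_getElem (c : ℕ → X) (w : List Letter) (x y : X) :
    Runs c w x y ↔ endColor c w x = y ∧ ∀ (i : ℕ) (hi : i < w.length),
      w[i].isOver = true → c w[i].label = endColor c (w.take i) x := by
  induction w generalizing x with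
  | nil => simp [Runs, endColor]
  | cons l w ih =>
    simp only [Runs, ih]
    constructor
    · rintro ⟨h1, h2, h3⟩
      refine ⟨h2, fun i hi => ?_⟩
      cases i with
      | zero => exact h1
      | succ i => exact h3 i (by simpa using hi)
    · rintro ⟨h1, h2⟩
      exact ⟨h2 0 (by simp), h1, fun i hi => h2 (i + 1) (by simpa using hi)⟩

/-- A color for each edge, subject to the relations of the crossings. -/
def IsEdgeColoring (w : List Letter) (Y : Fin w.length → X) : Prop :=
  ∀ j k : Fin w.length,
    ((w.get (finRotate _ j)).isOver = true → Y (finRotate _ j) = Y j) ∧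
    ((w.get (finRotate _ j)).isOver = false → Meets w (finRotate _ j) k →
      Y (finRotate _ j) = tPow (w.get (finRotate _ j)).isPos • Y j +
        (1 - tPow (w.get (finRotate _ j)).isPos) • Y k)

/-- The colors of the edges, if the edge behind the first passage has the color zero. -/
noncomputable def edgeColors (w : List Letter) (c : ℕ → X) (e : ℕ) : X :=
  endColor c ((w.rotate 1).take e) 0

theorem getElem_rotate_one (w : List Letter) (j : Fin w.length) :
    (w.rotate 1)[(j : ℕ)]'(by simp) = w.get (finRotate _ j) := by
  rw [List.getElem_rotate, List.get_eq_getElem]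
  congr 1
  rw [val_finRotate]

theorem edgeColors_finRotate {w : List Letter} {c : ℕ → X}
    (hc : coloringSystem (w.rotate 1) X c) (j : Fin w.length) :
    edgeColors w c (finRotate _ j) = pass c (edgeColors w c j) (w.get (finRotate _ j)) ∧
      ((w.get (finRotate _ j)).isOver = true →
        c (w.get (finRotate _ j)).label = edgeColors w c j) := by
  obtain ⟨h1, h2⟩ := (runs_iff_getElem _ _ _ _).1 hc.2
  have hj : (j : ℕ) < (w.rotate 1).length := by simp
  have h3 := endColor_take_succ c (w.rotate 1) 0 j hj
  have h4 := h2 j hj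
  rw [getElem_rotate_one] at h3 h4
  refine ⟨?_, h4⟩
  rw [← show _ = pass c (edgeColors w c j) (w.get (finRotate _ j)) from h3, edgeColors,
    val_finRotate]
  rcases Nat.lt_or_ge (j + 1) w.length with h | h
  · rw [Nat.mod_eq_of_lt h]
  · have : (j : ℕ) + 1 = w.length := by omega
    rw [this, Nat.mod_self, List.take_of_length_le (i := w.length) (by simp), h1]
    rfl

theorem isEdgeColoring_edgeColors {w : List Letter} (hw : IsGaussWord w) {c : ℕ → X}
    (hc : coloringSystem (w.rotate 1) X c) :
    IsEdgeColoring w (fun e => edgeColors w c e) ∧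
      ∀ e : Fin w.length, (w.get e).isOver = true → c (w.get e).label = edgeColors w c e := by
  have key : ∀ e : Fin w.length, (w.get e).isOver = true →
      c (w.get e).label = edgeColors w c e := by
    intro e he
    obtain ⟨j, rfl⟩ := (finRotate w.length).surjective e
    obtain ⟨h1, h2⟩ := edgeColors_finRotate hc j
    rw [h2 he, h1, pass, if_pos he]
  refine ⟨fun j k => ?_, key⟩
  obtain ⟨h1, h2⟩ := edgeColors_finRotate hc j
  refine ⟨fun ho => by simp only [h1, pass, if_pos ho], fun ho hk => ?_⟩
  obtain ⟨k', hk', hk''⟩ := hw.exists_mate (finRotate _ j)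
  obtain rfl := (hk'' k).1 hk
  simp only
  rw [h1, pass, if_neg (by rw [ho]; exact Bool.false_ne_true), hk.2, key k (by rw [hk', Letter.mate, ho]; rfl)]

open Classical in
/-- The colors of the upper strands, read off from the colors of the edges. -/
noncomputable def overColors {X : Type} [AddCommGroup X] (w : List Letter) (Y : Fin w.length → X) (a : ℕ) : X :=
  if h : ∃ i, (w.get i).label = a ∧ (w.get i).isOver = true then Y h.choose else 0

theorem overColors_get {X : Type} [AddCommGroup X] {w : List Letter} (hw : IsGaussWord w) (Y : Fin w.length → X)
    (i : Fin w.length) (hi : (w.get i).isOver = true) :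
    overColors w Y (w.get i).label = Y i := by
  have h : ∃ k, (w.get k).label = (w.get i).label ∧ (w.get k).isOver = true := ⟨i, rfl, hi⟩
  rw [overColors, dif_pos h]
  congr 1
  rcases hw.eq_or_eq_mate _ (List.get_mem w i) _ (List.get_mem w h.choose)
    h.choose_spec.1 with h' | h'
  · exact hw.nodup.injective_get h'
  · have := h.choose_spec.2
    rw [h', Letter.mate, hi] at this
    simp at this

theorem edgeColors_overColors {w : List Letter} (hw : IsGaussWord w) {Y : Fin w.length → X}
    (hY : IsEdgeColoring w Y) (h0 : ∀ e : Fin w.length, (e : ℕ) = 0 → Y e = 0) :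
    coloringSystem (w.rotate 1) X (overColors w Y) ∧
      ∀ e : Fin w.length, edgeColors w (overColors w Y) e = Y e := by
  set c := overColors w Y with hc
  have hpass : ∀ j, pass c (Y j) (w.get (finRotate _ j)) = Y (finRotate _ j) := by
    intro j
    obtain ⟨k, hk, hk'⟩ := hw.exists_mate (finRotate _ j)
    obtain ⟨h1, h2⟩ := hY j k
    unfold pass
    split_ifs with ho
    · rw [h1 ho]
    · rw [Bool.not_eq_true] at ho
      have hm := (hk' k).2 rfl
      rw [h2 ho hm, hm.2, hc, overColors_get hw]
      rw [hk, Letter.mate, ho]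
      rfl
  have hlt : ∀ (e : ℕ) (he : e < w.length), edgeColors w c e = Y ⟨e, he⟩ := by
    intro e
    induction e with
    | zero => intro he; rw [h0 ⟨0, he⟩ rfl]; rfl
    | succ e ih =>
      intro he
      have he' : e < w.length := by omega
      have h3 := endColor_take_succ c (w.rotate 1) 0 e (by simpa using he')
      rw [getElem_rotate_one w ⟨e, he'⟩] at h3
      rw [edgeColors, h3]
      change pass c (edgeColors w c e) _ = _
      rw [ih he', hpass]
      congr 1
      ext
      rw [val_finRotate]
      exact Nat.mod_eq_of_lt he
  refine ⟨⟨fun a ha => ?_, (runs_iff_getElem _ _ _ _).2 ⟨?_, ?_⟩⟩, fun e => hlt e e.2⟩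
  · rw [hc, overColors, dif_neg]
    rintro ⟨i, rfl, -⟩
    exact ha (List.mem_map_of_mem (List.mem_rotate.2 (List.get_mem w i)))
  · rcases Nat.eq_zero_or_pos w.length with hn | hn
    · rw [List.length_eq_zero_iff] at hn
      subst hn
      rfl
    · have hl : w.length - 1 < w.length := by omega
      have h3 := endColor_take_succ c (w.rotate 1) 0 (w.length - 1) (by simpa using hl)
      rw [getElem_rotate_one w ⟨_, hl⟩, List.take_of_length_le (by simp; omega)] at h3
      rw [h3]
      change pass c (edgeColors w c _) _ = _
      rw [hlt _ hl, hpass]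
      apply h0
      rw [val_finRotate]
      simp [Nat.sub_add_cancel hn]
  · intro i hi ho
    have hi' : i < w.length := by simpa using hi
    rw [getElem_rotate_one w ⟨i, hi'⟩] at ho ⊢
    rw [hc, overColors_get hw Y _ ho, ← hc]
    change _ = edgeColors w c i
    rw [hlt i hi', ← hpass, pass, if_pos ho]

/-- The colors of all edges, the first one having the color zero. -/
def extendEdges (n : ℕ) (y : {e : Fin n // (e : ℕ) ≠ 0} → X) (e : Fin n) : X :=
  if h : (e : ℕ) ≠ 0 then y ⟨e, h⟩ else 0

theorem sum_smul_extendEdges {n : ℕ} (f : Fin n → ℤ[T;T⁻¹])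
    (y : {e : Fin n // (e : ℕ) ≠ 0} → X) :
    ∑ e : {e : Fin n // (e : ℕ) ≠ 0}, f e.1 • y e = ∑ e, f e • extendEdges n y e := by
  rw [← Finset.sum_subset (Finset.subset_univ (Finset.univ.filter fun e : Fin n => (e : ℕ) ≠ 0)),
    Finset.sum_subtype (p := fun e : Fin n => (e : ℕ) ≠ 0) _ (by simp)]
  · refine Finset.sum_congr rfl fun e _ => ?_
    rw [extendEdges, dif_pos e.2]
  · intro e _ he
    rw [extendEdges, dif_neg (by simpa using he), smul_zero]

/-- A value zero for the first edge makes up for the deleted column. Rows are written as `finRotate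
_ j`, so that `j` is the incoming edge of the passage. -/
theorem matrixSystem_alexanderMatrix_iff (D : KnotDiagram)
    (y : {e : Fin D.word.length // (e : ℕ) ≠ 0} → X) :
    matrixSystem D.alexanderMatrix X y ↔ IsEdgeColoring D.word (extendEdges _ y) := by
  set Y := extendEdges _ y with hY
  have key : ∀ j k : Fin D.word.length, (∀ e, Meets D.word (finRotate _ j) e ↔ e = k) →
      ∑ e, D.alexanderMatrix (finRotate _ j) e • y e =
        if (D.word.get (finRotate _ j)).isOver then Y (finRotate _ j) - Y j
        else Y (finRotate _ j) - tPow (D.word.get (finRotate _ j)).isPos • Y j -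
          (1 - tPow (D.word.get (finRotate _ j)).isPos) • Y k := by
    intro j k hk
    simp only [KnotDiagram.alexanderMatrix, Matrix.of_apply, hk,
      (finRotate D.word.length).injective.eq_iff]
    split_ifs with ho
    · rw [sum_smul_extendEdges (fun e => (if e = finRotate _ j then 1 else 0) -
        (if e = j then 1 else 0))]
      simp [sub_smul, Finset.sum_sub_distrib, ite_smul, hY]
    · rw [sum_smul_extendEdges (fun e => (if e = finRotate _ j then 1 else 0) -
        (if e = j then tPow (D.word.get (finRotate _ j)).isPos else 0) -
        (if e = k then 1 - tPow (D.word.get (finRotate _ j)).isPos else 0))]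
      simp only [sub_smul, Finset.sum_sub_distrib, ite_smul, zero_smul, Finset.sum_ite_eq',
        Finset.mem_univ, if_true, one_smul, hY]
  constructor
  · intro h j k
    obtain ⟨k', hk, hk'⟩ := D.isGaussWord.exists_mate (finRotate _ j)
    have h1 := h (finRotate _ j)
    rw [key j k' hk'] at h1
    refine ⟨fun ho => ?_, fun ho hm => ?_⟩
    · rw [if_pos ho] at h1
      exact sub_eq_zero.1 h1
    · rw [if_neg (by rw [ho]; exact Bool.false_ne_true), sub_sub] at h1
      rw [(hk' k).1 hm]
      exact sub_eq_zero.1 h1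
  · intro h i
    obtain ⟨j, rfl⟩ := (finRotate D.word.length).surjective i
    obtain ⟨k, hk, hk'⟩ := D.isGaussWord.exists_mate (finRotate _ j)
    rw [key j k hk']
    split_ifs with ho
    · rw [(h j k).1 ho, sub_self]
    · rw [sub_sub, sub_eq_zero]
      exact (h j k).2 (by simpa using ho) ((hk' k).2 rfl)

theorem Presents.of_isRotated {w w' : List Letter} (h : w ~r w') {M : Type} [AddCommGroup M]
    [Module ℤ[T;T⁻¹] M] (hM : Presents w M) : Presents w' M := by
  obtain ⟨n, rfl⟩ := h
  rw [List.rotate_eq_drop_append_take_mod]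
  apply Presents.rotate
  rwa [List.take_append_drop]

/-- The Alexander matrix presents the module of the universal coloring. -/
theorem exists_isPresentation_alexanderMatrix_iff (D : KnotDiagram) (M : Type) [AddCommGroup M]
    [Module ℤ[T;T⁻¹] M] :
    Presents D.word M ↔ ∃ x : {e : Fin D.word.length // (e : ℕ) ≠ 0} → M,
      IsUniversal (matrixSystem D.alexanderMatrix) x := by
  have hw := D.isGaussWord
  let F : ∀ (X : Type) [AddCommGroup X] [Module ℤ[T;T⁻¹] X], (ℕ → X) →
      {e : Fin D.word.length // (e : ℕ) ≠ 0} → X := fun X _ _ c e => edgeColors D.word c e.1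
  let G : ∀ (X : Type) [AddCommGroup X] [Module ℤ[T;T⁻¹] X],
      ({e : Fin D.word.length // (e : ℕ) ≠ 0} → X) → ℕ → X :=
    fun X _ _ y => overColors D.word (extendEdges _ y)
  have hext : ∀ (X : Type) [AddCommGroup X] [Module ℤ[T;T⁻¹] X] (c : ℕ → X),
      extendEdges _ (F X c) = fun e : Fin D.word.length => edgeColors D.word c e := by
    intro X _ _ c
    ext e
    unfold extendEdges
    split_ifs with h
    · rfl
    · rw [not_not] at h
      rw [h]
      rfl
  have h0 : ∀ (X : Type) [AddCommGroup X] [Module ℤ[T;T⁻¹] X]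
      (y : {e : Fin D.word.length // (e : ℕ) ≠ 0} → X) (e : Fin D.word.length),
      (e : ℕ) = 0 → extendEdges _ y e = 0 := by
    intro X _ _ y e he
    rw [extendEdges, dif_neg (by simp [he])]
  have hF : ∀ (X : Type) [AddCommGroup X] [Module ℤ[T;T⁻¹] X] (c : ℕ → X),
      coloringSystem (D.word.rotate 1) X c → matrixSystem D.alexanderMatrix X (F X c) := by
    intro X _ _ c hc
    rw [matrixSystem_alexanderMatrix_iff, hext]
    exact (isEdgeColoring_edgeColors hw hc).1
  have hG : ∀ (X : Type) [AddCommGroup X] [Module ℤ[T;T⁻¹] X]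
      (y : {e : Fin D.word.length // (e : ℕ) ≠ 0} → X),
      matrixSystem D.alexanderMatrix X y → coloringSystem (D.word.rotate 1) X (G X y) := by
    intro X _ _ y hy
    rw [matrixSystem_alexanderMatrix_iff] at hy
    exact (edgeColors_overColors hw hy (h0 X y)).1
  have hFG : ∀ (X : Type) [AddCommGroup X] [Module ℤ[T;T⁻¹] X]
      (y : {e : Fin D.word.length // (e : ℕ) ≠ 0} → X),
      matrixSystem D.alexanderMatrix X y → F X (G X y) = y := by
    intro X _ _ y hy
    rw [matrixSystem_alexanderMatrix_iff] at hy
    ext e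
    have := (edgeColors_overColors hw hy (h0 X y)).2 e.1
    rw [extendEdges, dif_pos e.2] at this
    exact this
  have hGF : ∀ (X : Type) [AddCommGroup X] [Module ℤ[T;T⁻¹] X] (c : ℕ → X),
      coloringSystem (D.word.rotate 1) X c → G X (F X c) = c := by
    intro X _ _ c hc
    ext a
    simp only [G, hext]
    by_cases h : ∃ i, (D.word.get i).label = a ∧ (D.word.get i).isOver = true
    · obtain ⟨i, rfl, ho⟩ := h
      rw [overColors_get hw _ i ho, (isEdgeColoring_edgeColors hw hc).2 i ho]
    · rw [overColors, dif_neg h, hc.1]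
      simp only [List.mem_map, List.mem_rotate, not_exists, not_and]
      rintro x hx rfl
      obtain ⟨i, rfl⟩ := List.get_of_mem hx
      obtain ⟨k, hk, -⟩ := hw.exists_mate i
      cases ho : (D.word.get i).isOver
      · exact h ⟨k, by rw [hk]; rfl, by rw [hk, Letter.mate, ho]; rfl⟩
      · exact h ⟨i, rfl, ho⟩
  have hnF : ∀ (X Y : Type) [AddCommGroup X] [Module ℤ[T;T⁻¹] X] [AddCommGroup Y]
      [Module ℤ[T;T⁻¹] Y] (φ : X →ₗ[ℤ[T;T⁻¹]] Y) (c : ℕ → X),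
      (fun a => φ (F X c a)) = F Y fun a => φ (c a) := by
    intro X Y _ _ _ _ φ c
    ext e
    simp only [F, edgeColors, map_endColor, map_zero]
  have hnG : ∀ (X Y : Type) [AddCommGroup X] [Module ℤ[T;T⁻¹] X] [AddCommGroup Y]
      [Module ℤ[T;T⁻¹] Y] (φ : X →ₗ[ℤ[T;T⁻¹]] Y)
      (y : {e : Fin D.word.length // (e : ℕ) ≠ 0} → X),
      (fun a => φ (G X y a)) = G Y fun a => φ (y a) := by
    intro X Y _ _ _ _ φ y
    ext a
    simp only [G, overColors, extendEdges]
    split_ifs <;> simp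
  -- The edge with color zero lies behind the first passage, so the colorings belong to the word
  -- that starts with the second passage.
  have hrot : D.word ~r D.word.rotate 1 := ⟨1, rfl⟩
  constructor
  · intro h
    obtain ⟨c, hc⟩ := h.of_isRotated hrot
    exact ⟨_, hc.transport F G hF hG hnF hnG hGF hFG⟩
  · rintro ⟨x, hx⟩
    exact Presents.of_isRotated hrot.symm ⟨_, hx.transport G F hG hF hnG hnF hFG hGF⟩

theorem card_edges_ne_zero_le (n : ℕ) : Fintype.card {e : Fin n // (e : ℕ) ≠ 0} ≤ n :=
  (Fintype.card_subtype_le _).trans_eq (Fintype.card_fin n)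

/-- Alexander ideals can be computed from any presentation of the Alexander module. -/
theorem KnotDiagram.alexanderIdeal_eq (D : KnotDiagram) {M : Type} [AddCommGroup M]
    [Module ℤ[T;T⁻¹] M] (hM : Presents D.word M) {ι κ : Type} [Fintype κ]
    {A : Matrix ι κ ℤ[T;T⁻¹]} {x : κ → M} (hx : IsPresentation A x) (m : ℕ) :
    D.alexanderIdeal m = minorIdeal A (Fintype.card κ + 1 - m) := by
  obtain ⟨y, hy⟩ := (exists_isPresentation_alexanderMatrix_iff D M).1 hM
  rw [← hy.isPresentation.minorIdeal_eq_of_isPresentation hx, KnotDiagram.alexanderIdeal,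
    Fintype.card_fin, min_eq_right (card_edges_ne_zero_le _)]

theorem KnotDiagram.exists_presents (D : KnotDiagram) :
    ∃ (M : Type) (_ : AddCommGroup M) (_ : Module ℤ[T;T⁻¹] M), Presents D.word M := by
  obtain ⟨M, _, _, x, hx⟩ := exists_isUniversal_matrixSystem D.alexanderMatrix
  exact ⟨M, _, _, (exists_isPresentation_alexanderMatrix_iff D M).2 ⟨x, hx⟩⟩

end Alexander

/-! ### Homology modulo two of the sphere, from the Euler characteristic. -/

section Faces

theorem eq_of_finRotate_invariant {α : Type*} {n : ℕ} {g : Fin n → α}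
    (h : ∀ j, g (finRotate n j) = g j) (i j : Fin n) : g i = g j := by
  have key : ∀ (k : ℕ) (hk : k < n), g ⟨k, hk⟩ = g ⟨0, by omega⟩ := by
    intro k
    induction k with
    | zero => intro _; rfl
    | succ k ih =>
      intro hk
      rw [← ih (by omega), ← h ⟨k, by omega⟩]
      congr 1
      ext
      rw [val_finRotate]
      exact (Nat.mod_eq_of_lt hk).symm
  rw [key i i.2, key j j.2]

theorem Meets.symm {w : List Letter} {i k : Fin w.length} (h : Meets w i k) : Meets w k i :=
  ⟨h.1.symm, h.2.symm⟩

theorem IsGaussWord.get_eq_mate {w : List Letter} (hw : IsGaussWord w) {i k : Fin w.length}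
    (h : Meets w i k) : w.get k = (w.get i).mate := by
  obtain ⟨k', h1, h2⟩ := hw.exists_mate i
  rw [(h2 k).1 h, h1]

theorem IsGaussWord.fromRight_iff {w : List Letter} (hw : IsGaussWord w) {i k : Fin w.length}
    (h : Meets w i k) : FromRight w k ↔ ¬ FromRight w i := by
  unfold FromRight
  rw [hw.get_eq_mate h]
  unfold Letter.mate
  cases (w.get i).isOver <;> cases (w.get i).isPos <;> simp

/-- The face at the left of a dart. -/
def faceAt {w : List Letter} (d : Fin w.length × Bool) : Face w := Quot.mk _ d

theorem exists_faceAt_eq {w : List Letter} (x : Face w) : ∃ d, faceAt d = x := Quot.exists_rep x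

/-- The four corners at a crossing. -/
theorem IsGaussWord.face_eq {w : List Letter} (hw : IsGaussWord w) {j e : Fin w.length}
    (h : Meets w (finRotate _ j) (finRotate _ e)) (hr : FromRight w (finRotate _ j)) :
    faceAt (j, true) = faceAt (finRotate _ e, true) ∧
    faceAt (finRotate _ e, false) = faceAt (finRotate _ j, true) ∧
    faceAt (e, true) = faceAt (j, false) ∧
    faceAt (finRotate _ j, false) = faceAt (e, false) := by
  have hr' : ¬ FromRight w (finRotate _ e) := fun h' => (hw.fromRight_iff h).1 h' hr
  exact ⟨Quot.sound (.fwd_fwd _ _ h hr), Quot.sound (.bwd_fwd _ _ h.symm hr'),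
    Quot.sound (.fwd_bwd _ _ h.symm hr'), Quot.sound (.bwd_bwd _ _ h hr)⟩

/-- The sum of the values of a function on the two faces at an edge. -/
def coboundary (w : List Letter) : (Face w → ZMod 2) →ₗ[ZMod 2] (Fin w.length → ZMod 2) where
  toFun h i := h (faceAt (i, true)) + h (faceAt (i, false))
  map_add' h h' := by ext i; simp only [Pi.add_apply]; ring
  map_smul' r h := by ext i; simp only [Pi.smul_apply, smul_eq_mul, RingHom.id_apply]; ring

/-- The cycles modulo two of the diagram. -/
def cycles (w : List Letter) : Submodule (ZMod 2) (Fin w.length → ZMod 2) where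
  carrier := {f | ∀ j e, Meets w (finRotate _ j) (finRotate _ e) →
    f j + f (finRotate _ j) + f e + f (finRotate _ e) = 0}
  add_mem' {f g} hf hg j e h := by
    have h1 := hf j e h
    have h2 := hg j e h
    simp only [Pi.add_apply]
    linear_combination h1 + h2
  zero_mem' := by intro j e _; simp
  smul_mem' r f hf j e h := by
    have h1 := hf j e h
    simp only [Pi.smul_apply, smul_eq_mul]
    linear_combination r * h1

/-- Each of the four corners at a crossing adjoins two of its four edges, so every value occurs
twice. -/
theorem range_coboundary_le {w : List Letter} (hw : IsGaussWord w) :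
    LinearMap.range (coboundary w) ≤ cycles w := by
  rintro _ ⟨h, rfl⟩
  have key : ∀ j e, Meets w (finRotate _ j) (finRotate _ e) → FromRight w (finRotate _ j) →
      coboundary w h j + coboundary w h (finRotate _ j) + coboundary w h e +
        coboundary w h (finRotate _ e) = 0 := by
    intro j e hm hr
    obtain ⟨h1, h2, h3, h4⟩ := hw.face_eq hm hr
    simp only [coboundary, LinearMap.coe_mk, AddHom.coe_mk]
    rw [h1, h2, h3, h4]
    have h2 : (2 : ZMod 2) = 0 := rfl
    linear_combination (h (faceAt (finRotate _ e, true)) + h (faceAt (j, false)) +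
      h (faceAt (finRotate _ j, true)) + h (faceAt (e, false))) * h2
  intro j e hm
  by_cases hr : FromRight w (finRotate _ j)
  · exact key j e hm hr
  · rw [← key e j hm.symm ((hw.fromRight_iff hm).2 hr)]
    ring

/-- If the two sides of every edge have equal values, then a common corner transfers the value from
each edge to the next one along the knot, so the function is constant. -/
theorem finrank_ker_coboundary_le {w : List Letter} (hw : IsGaussWord w) :
    Module.finrank (ZMod 2) (LinearMap.ker (coboundary w)) ≤ 1 := by
  refine (Submodule.finrank_mono (t := Submodule.span (ZMod 2) {fun _ => 1}) ?_).trans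
    ((finrank_span_le_card _).trans (by simp))
  intro h hh
  have hab : ∀ a b : ZMod 2, a + b = 0 → a = b := by decide
  have h0 : ∀ i, h (faceAt (i, true)) = h (faceAt (i, false)) := fun i =>
    hab _ _ (congrFun hh i)
  have hrot : ∀ j, h (faceAt (finRotate _ j, true)) = h (faceAt (j, true)) := by
    intro j
    obtain ⟨k, -, hk⟩ := hw.exists_mate (finRotate _ j)
    obtain ⟨e, rfl⟩ := (finRotate w.length).surjective k
    have hm := (hk _).2 rfl
    by_cases hr : FromRight w (finRotate _ j)
    · obtain ⟨h1, h2, -, -⟩ := hw.face_eq hm hr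
      rw [h1, ← h2, h0]
    · obtain ⟨h1, -, h3, -⟩ := hw.face_eq hm.symm ((hw.fromRight_iff hm).2 hr)
      rw [← h1, h0 e, ← h3]
  have hc := eq_of_finRotate_invariant (g := fun i => h (faceAt (i, true))) hrot
  rw [Submodule.mem_span_singleton]
  by_cases hn : Nonempty (Fin w.length)
  · obtain ⟨i⟩ := hn
    refine ⟨h (faceAt (i, true)), ?_⟩
    ext x
    obtain ⟨⟨j, b⟩, rfl⟩ := exists_faceAt_eq x
    cases b
    · simp only [Pi.smul_apply, smul_eq_mul, mul_one]
      rw [← h0]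
      exact hc i j
    · simp only [Pi.smul_apply, smul_eq_mul, mul_one]
      exact hc i j
  · refine ⟨0, ?_⟩
    ext x
    obtain ⟨⟨j, b⟩, rfl⟩ := exists_faceAt_eq x
    exact absurd ⟨j⟩ hn

/-- Taking mates is an injection from upper to lower passages. -/
theorem IsGaussWord.two_mul_card_over_le {w : List Letter} (hw : IsGaussWord w) :
    2 * Fintype.card {i : Fin w.length // (w.get i).isOver = true} ≤ w.length := by
  choose μ hμ _ using hw.exists_mate
  have h1 : Fintype.card {i : Fin w.length // (w.get i).isOver = true} ≤
      Fintype.card {i : Fin w.length // ¬ (w.get i).isOver = true} := by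
    refine Fintype.card_le_of_injective (fun i => ⟨μ i.1, ?_⟩) ?_
    · rw [hμ, Letter.mate, i.2]
      simp
    · intro i j hij
      have : (w.get i.1).mate = (w.get j.1).mate := by
        rw [← hμ, ← hμ, show μ i.1 = μ j.1 from congrArg Subtype.val hij]
      have h2 : w.get i.1 = w.get j.1 := by
        have := congrArg Letter.mate this
        simpa only [Letter.mate, Bool.not_not] using this
      exact Subtype.ext (hw.nodup.injective_get h2)
  have h2 := Fintype.card_subtype_compl (fun i : Fin w.length => (w.get i).isOver = true)
  have h3 := Fintype.card_subtype_le (fun i : Fin w.length => (w.get i).isOver = true)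
  rw [Fintype.card_fin] at h2 h3
  omega

/-- A cycle is determined by its value on one edge and its jumps at the upper passages, because the
two strands at a crossing have the same jump. -/
theorem finrank_cycles_le {w : List Letter} (hw : IsGaussWord w) (hne : 0 < w.length) :
    Module.finrank (ZMod 2) (cycles w) ≤
      1 + Fintype.card {i : Fin w.length // (w.get i).isOver = true} := by
  let Φ : cycles w →ₗ[ZMod 2] ZMod 2 × ({i : Fin w.length // (w.get i).isOver = true} → ZMod 2) :=
    { toFun := fun f => (f.1 ⟨0, hne⟩, fun i => f.1 i.1 + f.1 ((finRotate _).symm i.1))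
      map_add' := fun f g => by
        ext
        · simp
        · simp; ring
      map_smul' := fun r f => by
        ext
        · simp
        · simp; ring }
  have hinj : Function.Injective Φ := by
    rw [← LinearMap.ker_eq_bot, LinearMap.ker_eq_bot']
    intro f hf
    have hab : ∀ a b : ZMod 2, a + b = 0 → a = b := by decide
    have h1 : f.1 ⟨0, hne⟩ = 0 := congrArg Prod.fst hf
    have h2 : ∀ j, (w.get (finRotate _ j)).isOver = true → f.1 (finRotate _ j) + f.1 j = 0 := by
      intro j hj
      have := congrFun (congrArg Prod.snd hf) ⟨_, hj⟩
      simpa only [Φ, LinearMap.coe_mk, AddHom.coe_mk, Equiv.symm_apply_apply, Prod.snd_zero,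
        Pi.zero_apply] using this
    have h3 : ∀ j, f.1 (finRotate _ j) = f.1 j := by
      intro j
      apply hab
      by_cases ho : (w.get (finRotate _ j)).isOver = true
      · exact h2 j ho
      · obtain ⟨k, hk, hk'⟩ := hw.exists_mate (finRotate _ j)
        obtain ⟨e, rfl⟩ := (finRotate w.length).surjective k
        have h4 := f.2 j e ((hk' _).2 rfl)
        have h5 := h2 e (by rw [hk, Letter.mate]; simpa using ho)
        linear_combination h4 - h5
    ext i
    rw [eq_of_finRotate_invariant h3 i ⟨0, hne⟩, h1]
    rfl
  refine (LinearMap.finrank_le_finrank_of_injective hinj).trans ?_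
  simp

/-- On the sphere every cycle modulo two is a sum of boundaries of faces. -/
theorem exists_coboundary_eq {w : List Letter} (hw : IsGaussWord w) (hs : IsSpherical w)
    (hne : 0 < w.length) {f : Fin w.length → ZMod 2} (hf : f ∈ cycles w) :
    ∃ h : Face w → ZMod 2, coboundary w h = f := by
  have hs' : 2 * Nat.card (Face w) = w.length + 4 := by
    rcases hs with rfl | hs
    · simp at hne
    · exact hs
  have hfin : Finite (Face w) := Quot.finite _
  have : Fintype (Face w) := Fintype.ofFinite _
  have h1 := LinearMap.finrank_range_add_finrank_ker (coboundary w)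
  rw [Module.finrank_fintype_fun_eq_card, ← Nat.card_eq_fintype_card] at h1
  have h2 := finrank_ker_coboundary_le hw
  have h3 := finrank_cycles_le hw hne
  have h4 := hw.two_mul_card_over_le
  -- For n edges there are n/2 + 2 faces. The kernel has dimension at most 1, so the range has
  -- dimension at least n/2 + 1, which bounds the dimension of the cycles.
  have := Submodule.eq_of_le_of_finrank_le (range_coboundary_le hw) (by omega)
  rw [← this] at hf
  exact hf

/-- Travelling along the knot, the value on the face at the left changes according to the edge at
the left of the passage. -/
theorem coboundary_left {w : List Letter} (hw : IsGaussWord w) (h : Face w → ZMod 2)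
    {j e : Fin w.length} (hm : Meets w (finRotate _ j) (finRotate _ e)) :
    (FromRight w (finRotate _ j) →
      h (faceAt (j, true)) = h (faceAt (finRotate _ e, true)) ∧
      h (faceAt (finRotate _ j, true)) =
        h (faceAt (j, true)) + coboundary w h (finRotate _ e)) ∧
    (¬ FromRight w (finRotate _ j) →
      h (faceAt (finRotate _ j, true)) = h (faceAt (j, true)) + coboundary w h e) := by
  have hab : ∀ a b : ZMod 2, a = b + (b + a) := by decide
  have hab' : ∀ a b : ZMod 2, a = b + (a + b) := by decide
  refine ⟨fun hr => ?_, fun hr => ?_⟩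
  · obtain ⟨h1, h2, -, -⟩ := hw.face_eq hm hr
    refine ⟨by rw [h1], ?_⟩
    simp only [coboundary, LinearMap.coe_mk, AddHom.coe_mk]
    rw [h1, h2]
    exact hab _ _
  · obtain ⟨h1, h2, h3, h4⟩ := hw.face_eq hm.symm ((hw.fromRight_iff hm).2 hr)
    simp only [coboundary, LinearMap.coe_mk, AddHom.coe_mk]
    rw [h1, h3]
    exact hab' _ _

end Faces

/-! ### Block words, and why pairs on the same side are not interlaced. -/

section Blocks

theorem FaceStep.map {w w' : List Letter} (e : Fin w.length ≃ Fin w'.length)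
    (hg : ∀ i, w'.get (e i) = w.get i) (hr : ∀ i, e (finRotate _ i) = finRotate _ (e i))
    {d d' : Fin w.length × Bool} (h : FaceStep w d d') :
    FaceStep w' (e d.1, d.2) (e d'.1, d'.2) := by
  have hm : ∀ {i k}, Meets w i k → Meets w' (e i) (e k) := fun h =>
    ⟨e.injective.ne h.1, by rw [hg, hg]; exact h.2⟩
  have hf : ∀ i, FromRight w' (e i) ↔ FromRight w i := fun i => by
    unfold FromRight
    rw [hg]
  cases h with
  | fwd_fwd i k h1 h2 => exact .fwd_fwd _ _ (hr i ▸ hm h1) (hr i ▸ (hf _).2 h2)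
  | fwd_bwd i k h1 h2 =>
    exact .fwd_bwd _ _ (hr i ▸ hr k ▸ hm h1) (hr i ▸ fun h => h2 ((hf _).1 h))
  | bwd_bwd i k h1 h2 => exact .bwd_bwd _ _ (hr k ▸ hm h1) ((hf _).2 h2)
  | bwd_fwd i k h1 h2 => exact .bwd_fwd _ _ (hm h1) (fun h => h2 ((hf _).1 h))

theorem IsSpherical.rotate_one {w : List Letter} (h : IsSpherical w) :
    IsSpherical (w.rotate 1) := by
  rcases h with rfl | h
  · exact Or.inl rfl
  right
  let e : Fin (w.rotate 1).length ≃ Fin w.length :=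
    (finCongr (List.length_rotate w 1)).trans (finRotate _)
  have hg : ∀ i, w.get (e i) = (w.rotate 1).get i := fun i =>
    (getElem_rotate_one w (finCongr (List.length_rotate w 1) i)).symm
  have hr : ∀ i, e (finRotate _ i) = finRotate _ (e i) := by
    intro i
    change finRotate _ (finCongr _ _) = finRotate _ (finRotate _ (finCongr _ _))
    congr 1
    ext
    rw [val_finRotate]
    simp only [finCongr_apply, Fin.val_cast]
    rw [val_finRotate]
    exact congrArg _ (List.length_rotate w 1)
  have hcard : Nat.card (Face (w.rotate 1)) = Nat.card (Face w) := by
    refine Nat.card_congr (Quot.congr (e.prodCongr (Equiv.refl Bool)) fun d d' => ⟨?_, ?_⟩)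
    · exact fun h => h.map e hg hr
    · intro h
      have := h.map e.symm (fun i => by rw [← hg, e.apply_symm_apply]) (fun i => by
        rw [e.symm_apply_eq, hr, e.apply_symm_apply])
      simpa using this
  rw [hcard, h, List.length_rotate]

theorem IsSpherical.of_isRotated {w w' : List Letter} (h : w ~r w') (hw : IsSpherical w) :
    IsSpherical w' := by
  obtain ⟨n, rfl⟩ := h
  induction n with
  | zero => simpa using hw
  | succ n ih => rw [← List.rotate_rotate]; exact ih.rotate_one

theorem IsGaussWord.of_isRotated {w w' : List Letter} (h : w ~r w') (hw : IsGaussWord w) :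
    IsGaussWord w' where
  nodup := h.nodup_iff.1 hw.nodup
  mate_mem x hx := h.mem_iff.1 (hw.mate_mem x (h.mem_iff.2 hx))
  eq_or_eq_mate x hx y hy := hw.eq_or_eq_mate x (h.mem_iff.2 hx) y (h.mem_iff.2 hy)

/-- The word consists of `L` blocks of two letters; the blocks `i` and `τ i` are the two strands of
a matched pair. -/
structure IsBlockWord (w : List Letter) (L : ℕ) (lab : Fin L → ℕ) (τ : Fin L → Fin L)
    (o s : Fin L → Bool) : Prop where
  length_eq : w.length = 2 * L
  get_even : ∀ (i : Fin L) (k : Fin w.length), (k : ℕ) = 2 * i → w.get k = ⟨lab i, o i, s i⟩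
  get_odd : ∀ (i : Fin L) (k : Fin w.length), (k : ℕ) = 2 * i + 1 →
    w.get k = ⟨lab (τ i), !o i, s i⟩
  lab_injective : Function.Injective lab
  partner_partner : ∀ i, τ (τ i) = i
  partner_ne : ∀ i, τ i ≠ i
  over_partner : ∀ i, o (τ i) = o i
  sign_partner : ∀ i, s (τ i) = s i

variable {w : List Letter} {L : ℕ} {lab : Fin L → ℕ} {τ : Fin L → Fin L} {o s : Fin L → Bool}

/-- The first letter of a block. -/
def IsBlockWord.fst (hB : IsBlockWord w L lab τ o s) (i : Fin L) : Fin w.length :=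
  ⟨2 * i, by have := hB.length_eq; omega⟩

/-- The second letter of a block. -/
def IsBlockWord.snd (hB : IsBlockWord w L lab τ o s) (i : Fin L) : Fin w.length :=
  ⟨2 * i + 1, by have := hB.length_eq; omega⟩

theorem IsBlockWord.finRotate_fst (hB : IsBlockWord w L lab τ o s) (i : Fin L) :
    finRotate _ (hB.fst i) = hB.snd i := by
  ext
  rw [val_finRotate]
  exact Nat.mod_eq_of_lt (hB.snd i).2

theorem IsBlockWord.eq_fst_or_eq_snd (hB : IsBlockWord w L lab τ o s) (k : Fin w.length) :
    (∃ i, k = hB.fst i) ∨ ∃ i, k = hB.snd i := by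
  have h := hB.length_eq
  have hk := k.2
  have hi : (k : ℕ) / 2 < L := by omega
  rcases Nat.mod_two_eq_zero_or_one k with h2 | h2
  · exact Or.inl ⟨⟨k / 2, hi⟩, Fin.ext (show (k : ℕ) = 2 * (k / 2) by omega)⟩
  · exact Or.inr ⟨⟨k / 2, hi⟩, Fin.ext (show (k : ℕ) = 2 * (k / 2) + 1 by omega)⟩

theorem IsBlockWord.meets_fst (hB : IsBlockWord w L lab τ o s) (i : Fin L) :
    Meets w (hB.fst i) (hB.snd (τ i)) := by
  refine ⟨fun h => ?_, ?_⟩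
  · have : 2 * (i : ℕ) = 2 * (τ i : ℕ) + 1 := congrArg Fin.val h
    omega
  · rw [hB.get_even i _ rfl, hB.get_odd (τ i) _ rfl, hB.partner_partner]

theorem IsBlockWord.fromRight_fst (hB : IsBlockWord w L lab τ o s) (i : Fin L) :
    FromRight w (hB.fst i) ↔ o i = s i := by
  unfold FromRight
  rw [hB.get_even i _ rfl]

theorem IsBlockWord.fromRight_snd (hB : IsBlockWord w L lab τ o s) (i : Fin L) :
    FromRight w (hB.snd i) ↔ ¬ o i = s i := by
  unfold FromRight
  rw [hB.get_odd i _ rfl]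
  cases o i <;> cases s i <;> simp

/-- The cycle that leaves the block `p` and returns at the block `τ p`. -/
def arcCycle (w : List Letter) (τ : Fin L → Fin L) (p : Fin L) (e : Fin w.length) : ZMod 2 :=
  if 2 * (p : ℕ) + 1 ≤ e ∧ (e : ℕ) < 2 * (τ p : ℕ) then 1 else 0

theorem IsBlockWord.arcCycle_jump (hB : IsBlockWord w L lab τ o s) {p : Fin L} (hp : p < τ p)
    (j : Fin w.length) : arcCycle w τ p j + arcCycle w τ p (finRotate _ j) =
      if finRotate _ j = hB.snd p ∨ finRotate _ j = hB.fst (τ p) then 1 else 0 := by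
  have hlen := hB.length_eq
  have hτ := (τ p).2
  have hj := j.2
  rw [Fin.lt_def] at hp
  simp only [Fin.ext_iff, IsBlockWord.fst, IsBlockWord.snd, arcCycle, val_finRotate]
  rcases Nat.lt_or_ge (j + 1) w.length with h | h
  · rw [Nat.mod_eq_of_lt h]
    split_ifs <;> first | omega | decide
  · have : (j : ℕ) + 1 = w.length := by omega
    rw [this, Nat.mod_self]
    rw [if_neg (by omega), if_neg (by omega), if_neg (by omega), add_zero]

/-- The arc is closed: the second passage of the block `p` and the first one of `τ p` go through the
same crossing. -/
theorem IsBlockWord.arcCycle_mem_cycles (hB : IsBlockWord w L lab τ o s) (hw : IsGaussWord w)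
    {p : Fin L} (hp : p < τ p) : arcCycle w τ p ∈ cycles w := by
  intro j e hm
  rw [add_assoc, hB.arcCycle_jump hp, hB.arcCycle_jump hp]
  have hS : ∀ {a b : Fin w.length}, Meets w a b → (a = hB.snd p ∨ a = hB.fst (τ p)) →
      (b = hB.snd p ∨ b = hB.fst (τ p)) := by
    intro a b hab ha
    obtain ⟨k, -, hk⟩ := hw.exists_mate a
    rw [(hk b).1 hab]
    have hm := hB.meets_fst (τ p)
    rw [hB.partner_partner] at hm
    rcases ha with rfl | rfl
    · exact Or.inr ((hk _).1 hm.symm).symm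
    · exact Or.inl ((hk _).1 hm).symm
  have h2 : (1 + 1 : ZMod 2) = 0 := rfl
  by_cases h : finRotate _ j = hB.snd p ∨ finRotate _ j = hB.fst (τ p)
  · rw [if_pos h, if_pos (hS hm h), h2]
  · rw [if_neg h, if_neg fun h' => h (hS hm.symm h'), add_zero]

/-- The condition `o i = s i` says that the other strand of the pair lies at the left of the block
`i`. The arc from `p` to `τ p` is a closed curve and hence bounds modulo two. The value `g` of the
bounding function at the left of the knot is compared along the way from `q` to `τ q` and directly
at the crossings of the pair of `q`. -/
theorem IsBlockWord.planar (hB : IsBlockWord w L lab τ o s) (hw : IsGaussWord w)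
    (hs : IsSpherical w) {p q : Fin L} (h1 : p < q) (h2 : q < τ p) (h3 : τ p < τ q) :
    (o p = s p) ↔ ¬ (o q = s q) := by
  have hlen := hB.length_eq
  obtain ⟨h, hh⟩ := exists_coboundary_eq hw hs (by have := p.2; omega)
    (hB.arcCycle_mem_cycles hw (h1.trans h2))
  set g : Fin w.length → ZMod 2 := fun i => h (faceAt (i, true)) with hg
  set f := arcCycle w τ p with hf
  have hfst : ∀ i, finRotate _ ((finRotate _).symm (hB.fst i)) = hB.fst i := fun i =>
    Equiv.apply_symm_apply _ _
  have key1 : ∀ i, o i = s i → g ((finRotate _).symm (hB.fst i)) = g (hB.snd (τ i)) ∧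
      g (hB.fst i) = g ((finRotate _).symm (hB.fst i)) + f (hB.snd (τ i)) := by
    intro i hi
    have := (coboundary_left hw h (j := (finRotate _).symm (hB.fst i)) (e := hB.fst (τ i))
      (by rw [hfst, hB.finRotate_fst]; exact hB.meets_fst i)).1
      (by rw [hfst, hB.fromRight_fst]; exact hi)
    rwa [hfst, hB.finRotate_fst, hh] at this
  have key2 : ∀ i, ¬ o i = s i →
      g (hB.fst i) = g ((finRotate _).symm (hB.fst i)) + f (hB.fst (τ i)) := by
    intro i hi
    have := (coboundary_left hw h (j := (finRotate _).symm (hB.fst i)) (e := hB.fst (τ i))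
      (by rw [hfst, hB.finRotate_fst]; exact hB.meets_fst i)).2
      (by rw [hfst, hB.fromRight_fst]; exact hi)
    rwa [hfst, hh] at this
  have hm' : ∀ i, Meets w (hB.snd i) (hB.fst (τ i)) := by
    intro i
    have := hB.meets_fst (τ i)
    rw [hB.partner_partner] at this
    exact this.symm
  have key3 : ∀ i, ¬ o i = s i → g (hB.fst i) = g (hB.fst (τ i)) ∧
      g (hB.snd i) = g (hB.fst i) + f (hB.fst (τ i)) := by
    intro i hi
    have := (coboundary_left hw h (j := hB.fst i) (e := (finRotate _).symm (hB.fst (τ i)))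
      (by rw [hfst, hB.finRotate_fst]; exact hm' i)).1
      (by rw [hB.finRotate_fst, hB.fromRight_snd]; exact hi)
    rwa [hfst, hB.finRotate_fst, hh] at this
  have key4 : ∀ i, o i = s i →
      g (hB.snd i) = g (hB.fst i) + f ((finRotate _).symm (hB.fst (τ i))) := by
    intro i hi
    have := (coboundary_left hw h (j := hB.fst i) (e := (finRotate _).symm (hB.fst (τ i)))
      (by rw [hfst, hB.finRotate_fst]; exact hm' i)).2
      (by rw [hB.finRotate_fst, hB.fromRight_snd]; exact fun h => h hi)
    rwa [hB.finRotate_fst, hh] at this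
  have hpq : o (τ p) = s (τ p) ↔ o p = s p := by rw [hB.over_partner, hB.sign_partner]
  have hqq : o (τ q) = s (τ q) ↔ o q = s q := by rw [hB.over_partner, hB.sign_partner]
  rw [Fin.lt_def] at h1 h2 h3
  have hzz : ∀ z : ZMod 2, z + z = 0 := by decide
  have hpred : ∀ (i i' : Fin L), (i' : ℕ) = i + 1 → (finRotate _).symm (hB.fst i') = hB.snd i := by
    intro i i' hi
    rw [Equiv.symm_apply_eq]
    ext
    have h5 := (hB.fst i').2
    rw [val_finRotate]
    simp only [IsBlockWord.fst, IsBlockWord.snd] at h5 ⊢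
    rw [show 2 * (i : ℕ) + 1 + 1 = 2 * i' by omega, Nat.mod_eq_of_lt h5]
  -- At a left block the value changes across the incoming and the outgoing edge of the partner
  -- block. There `f` differs only if the partner is `p`, since `p < i'` excludes that it is `τ p`.
  -- At a right block the value changes twice across the middle edge of the partner block.
  have hstep : ∀ (i i' : Fin L), (i' : ℕ) = i + 1 → (p : ℕ) < i' → g (hB.snd i') = g (hB.snd i) +
      if o p = s p ∧ i' = τ p then 1 else 0 := by
    intro i i' hi hpi
    by_cases hos : o i' = s i'
    · rw [key4 i' hos, (key1 i' hos).2, hpred i i' hi]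
      have hj := hB.arcCycle_jump (p := p) (by rw [Fin.lt_def]; omega)
        ((finRotate _).symm (hB.fst (τ i')))
      have hj' := hB.arcCycle_jump (p := p) (by rw [Fin.lt_def]; omega) (hB.fst (τ i'))
      rw [hfst] at hj
      rw [hB.finRotate_fst] at hj'
      have e1 : hB.fst (τ i') = hB.snd p ↔ False := by
        simp only [IsBlockWord.fst, IsBlockWord.snd, Fin.ext_iff, iff_false]; omega
      have e2 : hB.fst (τ i') = hB.fst (τ p) ↔ False := by
        have : τ i' ≠ τ p := fun h => by
          have := congrArg τ h
          rw [hB.partner_partner, hB.partner_partner] at this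
          rw [this] at hpi
          omega
        rw [Ne, Fin.ext_iff] at this
        simp only [IsBlockWord.fst, Fin.ext_iff, iff_false]; omega
      have e3 : hB.snd (τ i') = hB.snd p ↔ i' = τ p := by
        constructor
        · intro h
          have h : 2 * (τ i' : ℕ) + 1 = 2 * (p : ℕ) + 1 := congrArg Fin.val h
          have : τ i' = p := Fin.ext (by omega)
          rw [← this, hB.partner_partner]
        · rintro rfl; rw [hB.partner_partner]
      have e4 : hB.snd (τ i') = hB.fst (τ p) ↔ False := by
        simp only [IsBlockWord.fst, IsBlockWord.snd, Fin.ext_iff, iff_false]; omega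
      simp only [e1, e2, or_self, if_false] at hj
      simp only [e3, e4, or_false] at hj'
      have hcond : (o p = s p ∧ i' = τ p) ↔ i' = τ p :=
        ⟨fun h => h.2, fun h => ⟨hpq.1 (h ▸ hos), h⟩⟩
      simp only [hcond]
      rw [← hj']
      have : f ((finRotate _).symm (hB.fst (τ i'))) = f (hB.fst (τ i')) := by
        linear_combination hj - hzz (f (hB.fst (τ i')))
      rw [this]
      ring
    · rw [(key3 i' hos).2, key2 i' hos, hpred i i' hi, add_assoc, hzz, if_neg]
      rintro ⟨h5, rfl⟩
      exact hos (hpq.2 h5)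
  have htel : ∀ (d : ℕ) (hd : q + d < (τ q : ℕ)), g (hB.snd ⟨q + d, by omega⟩) = g (hB.snd q) +
      if o p = s p ∧ (τ p : ℕ) ≤ q + d then 1 else 0 := by
    intro d
    induction d with
    | zero =>
      intro hd
      rw [if_neg (by omega)]
      exact (add_zero _).symm
    | succ d ih =>
      intro hd
      rw [hstep ⟨q + d, by omega⟩ ⟨q + (d + 1), by omega⟩ rfl (by simp only; omega),
        ih (by omega)]
      simp only [Fin.ext_iff]
      by_cases hos : o p = s p
      · simp only [hos, true_and]
        split_ifs <;> first | omega | simp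
      · simp only [hos, false_and, if_false, add_zero]
  have hend := htel (τ q - q - 1) (by omega)
  rw [← hpred ⟨q + (τ q - q - 1), by omega⟩ (τ q) (by simp only; omega)] at hend
  have hcond : (o p = s p ∧ (τ p : ℕ) ≤ q + (τ q - q - 1)) ↔ o p = s p :=
    ⟨fun h => h.1, fun h => ⟨h, by omega⟩⟩
  simp only [hcond] at hend
  -- If `q` is at the left, the edges behind `q` and in front of `τ q` have the same face at their
  -- left, so there is no change in between. If `q` is at the right, the middle edge of `q` lies on
  -- the arc and that of `τ q` does not, which forces a change.
  by_cases hq : o q = s q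
  · have := (key1 (τ q) (hqq.2 hq)).1
    rw [hB.partner_partner] at this
    rw [this] at hend
    simp only [hq, not_true, iff_false]
    intro hp
    rw [if_pos hp] at hend
    have : (1 : ZMod 2) = 0 := by linear_combination -hend
    exact absurd this (by decide)
  · simp only [hq, not_false_iff, iff_true]
    by_contra hp
    rw [if_neg hp] at hend
    have a1 := (key3 q hq).1
    have a2 := (key3 q hq).2
    have a3 := key2 (τ q) (fun h => hq (hqq.1 h))
    rw [hB.partner_partner] at a3
    have f1 : f (hB.fst q) = 1 := by
      rw [hf, arcCycle, if_pos]
      simp only [IsBlockWord.fst]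
      omega
    have f2 : f (hB.fst (τ q)) = 0 := by
      rw [hf, arcCycle, if_neg]
      simp only [IsBlockWord.fst]
      omega
    rw [f1] at a3
    rw [f2] at a2
    have : (1 : ZMod 2) = 0 := by linear_combination -(a1 + a2 + a3 + hend)
    exact absurd this (by decide)

/-- The contribution of the block `j` to the change of color between the blocks `i` and `τ i`. -/
def crossCount (τ : Fin L → Fin L) (i j : Fin L) : ℤ :=
  (if j < τ i then 1 else 0) - (if j ≤ i then 1 else 0)

/-- Matched pairs at the same side of the knot are not interlaced. -/
theorem IsBlockWord.crossCount_partner (hB : IsBlockWord w L lab τ o s) (hw : IsGaussWord w)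
    (hs : IsSpherical w) {i j : Fin L} (hij : (o i = s i) ↔ (o j = s j)) :
    crossCount τ i (τ j) = crossCount τ i j := by
  have key : ∀ p q : Fin L, ((o p = s p) ↔ (o q = s q)) → ¬ (p < q ∧ q < τ p ∧ τ p < τ q) := by
    rintro p q h ⟨h1, h2, h3⟩
    have := hB.planar hw hs h1 h2 h3
    tauto
  have hside : ∀ i, (o (τ i) = s (τ i)) ↔ (o i = s i) := fun i => by
    rw [hB.over_partner, hB.sign_partner]
  have hti := hB.partner_partner i
  have htj := hB.partner_partner j
  -- `planar` fixes the order of the four blocks, so all ways of naming the ends of the two chords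
  -- are needed.
  have k1 := key i j hij
  have k2 := key j i hij.symm
  have k3 := key (τ i) j ((hside i).trans hij)
  have k4 := key j (τ i) ((hside i).trans hij).symm
  have k5 := key i (τ j) (hij.trans (hside j).symm)
  have k6 := key (τ j) i (hij.trans (hside j).symm).symm
  have k7 := key (τ i) (τ j) ((hside i).trans (hij.trans (hside j).symm))
  have k8 := key (τ j) (τ i) ((hside i).trans (hij.trans (hside j).symm)).symm
  rw [hti] at k3 k4 k7 k8
  rw [htj] at k5 k6 k7 k8
  have hni := hB.partner_ne i
  have hnj := hB.partner_ne j
  unfold crossCount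
  by_cases h1 : j = i
  · subst h1
    simp only [Ne, Fin.ext_iff, Fin.lt_def, Fin.le_def] at *
    split_ifs <;> omega
  by_cases h2 : j = τ i
  · subst h2
    rw [hti] at *
    simp only [Ne, Fin.ext_iff, Fin.lt_def, Fin.le_def] at *
    split_ifs <;> omega
  have h3 : τ j ≠ i := fun h => h2 (by rw [← h, htj])
  have h4 : τ j ≠ τ i := fun h => h1 (by rw [← htj, h, hti])
  clear hside key hti htj hij hs hw hB
  simp only [Ne, Fin.ext_iff, Fin.lt_def, Fin.le_def] at *
  split_ifs <;> omega

end Blocks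

/-! ### Matched diagrams are block words. -/

section Matched

theorem Follows.of_isRotated {w w' : List Letter} (h : w ~r w') {x y : Letter}
    (hf : Follows w x y) : Follows w' x y := by
  obtain ⟨u, hu⟩ := hf
  exact ⟨u, h.symm.trans hu⟩

theorem Follows.mem_left {w : List Letter} {x y : Letter} (hf : Follows w x y) : x ∈ w := by
  obtain ⟨u, hu⟩ := hf
  exact hu.mem_iff.2 (by simp)

theorem Follows.get_finRotate {w : List Letter} (hw : w.Nodup) {x y : Letter}
    (hf : Follows w x y) {k : Fin w.length} (hk : w.get k = x) : w.get (finRotate _ k) = y := by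
  obtain ⟨u, hu⟩ := hf
  obtain ⟨n, rfl⟩ := hu.symm
  have hnd : (x :: y :: u).Nodup := List.nodup_rotate.1 hw
  rw [List.get_eq_getElem, List.getElem_rotate] at hk
  rw [List.get_eq_getElem, List.getElem_rotate]
  have h0 : ((k : ℕ) + n) % (x :: y :: u).length = 0 := by
    have : (x :: y :: u)[((k : ℕ) + n) % (x :: y :: u).length]'(Nat.mod_lt _ (by simp)) =
        (x :: y :: u)[0] := hk
    exact (hnd.getElem_inj_iff).1 this
  have h1 : ((finRotate _ k : ℕ) + n) % (x :: y :: u).length = 1 := by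
    have aux : ∀ m l : ℕ, l = (x :: y :: u).length → (m + n) % (x :: y :: u).length = 0 →
        ((m + 1) % l + n) % (x :: y :: u).length = 1 := by
      rintro m _ rfl h
      rw [Nat.mod_add_mod, add_right_comm, Nat.add_mod, h]
      simp
    rw [val_finRotate]
    exact aux _ _ (List.length_rotate _ _) h0
  simp only [h1]
  rfl

theorem Follows.finRotate_eq {w : List Letter} (hw : w.Nodup) {x y : Letter}
    (hf : Follows w x y) {k k' : Fin w.length} (hk : w.get k = x) (hk' : w.get k' = y) :
    finRotate _ k = k' :=
  hw.injective_get ((hf.get_finRotate hw hk).trans hk'.symm)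

/-- The letter `x` is the first one of a strand of a matched pair. -/
def IsInitial (w : List Letter) (σ : ℕ → ℕ) (x : Letter) : Prop :=
  Follows w x ⟨σ x.label, !x.isOver, x.isPos⟩

theorem IsInitial.not_isInitial_finRotate {w : List Letter} (hw : IsGaussWord w) {σ : ℕ → ℕ}
    {k : Fin w.length} (hσ : σ (σ (w.get k).label) = (w.get k).label)
    (hne : (w.get k).label ≠ σ (w.get k).label)
    (h : IsInitial w σ (w.get k)) : ¬ IsInitial w σ (w.get (finRotate _ k)) := by
  intro h'
  have h1 := h.get_finRotate hw.nodup rfl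
  have h2 : w.get (finRotate _ (finRotate _ k)) = w.get k := by
    have := h'.get_finRotate hw.nodup rfl
    rw [this, h1]
    simp only [Bool.not_not]
    rw [hσ]
  have h3 := congrArg Fin.val (hw.nodup.injective_get h2)
  rw [val_finRotate, val_finRotate, Nat.mod_add_mod] at h3
  -- Two steps lead back to the same letter only in a word of at most two letters, but the letter,
  -- its mate and its successor are distinct.
  have hlen : 3 ≤ w.length := by
    have hsub : [w.get k, (w.get k).mate, w.get (finRotate _ k)] ⊆ w := by
      intro x hx
      simp only [List.mem_cons, List.not_mem_nil, or_false] at hx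
      rcases hx with rfl | rfl | rfl
      · exact List.get_mem _ _
      · exact hw.mate_mem _ (List.get_mem _ _)
      · exact List.get_mem _ _
    have hnd : [w.get k, (w.get k).mate, w.get (finRotate _ k)].Nodup := by
      rw [h1]
      simp only [List.nodup_cons, List.mem_cons, List.not_mem_nil, or_false, not_or, not_false_iff,
        List.nodup_nil, and_true]
      refine ⟨⟨(Letter.mate_ne _).symm, fun h => hne (congrArg Letter.label h)⟩, fun h => ?_⟩
      exact hne (congrArg Letter.label h)
    simpa using (hnd.subperm hsub).length_le
  have hk := k.2
  rcases Nat.lt_or_ge (k + 1 + 1) w.length with h4 | h4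
  · rw [Nat.mod_eq_of_lt h4] at h3
    omega
  · rw [Nat.mod_eq_sub_mod h4, Nat.mod_eq_of_lt (by omega)] at h3
    omega

/-- A matched diagram is, up to the choice of the starting point, a block word. -/
theorem KnotDiagram.IsMatched.exists_isBlockWord {D : KnotDiagram} (hD : D.IsMatched) :
    ∃ w, D.word ~r w ∧ ∃ (L : ℕ) (lab : Fin L → ℕ) (τ : Fin L → Fin L) (o s : Fin L → Bool),
      IsBlockWord w L lab τ o s := by
  obtain ⟨σ, hσ⟩ := hD
  rcases hword : D.word with _ | ⟨x₀, w₀⟩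
  · refine ⟨[], List.IsRotated.refl _, 0, Fin.elim0, Fin.elim0, Fin.elim0, Fin.elim0, ?_⟩
    constructor <;> first | rfl | exact fun i => i.elim0
  rw [← hword]
  obtain ⟨-, -, o₀, s₀, ⟨u₀, hu₀⟩, -⟩ := hσ x₀ (by simp [hword])
  set w := (⟨x₀.label, o₀, s₀⟩ : Letter) :: ⟨σ x₀.label, !o₀, s₀⟩ :: u₀ with hwdef
  have hw : IsGaussWord w := D.isGaussWord.of_isRotated hu₀
  have hpair : ∀ k : Fin w.length, σ (σ (w.get k).label) = (w.get k).label ∧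
      (w.get k).label ≠ σ (w.get k).label ∧ ∃ o s : Bool,
        Follows w ⟨(w.get k).label, o, s⟩ ⟨σ (w.get k).label, !o, s⟩ ∧
        Follows w ⟨σ (w.get k).label, o, s⟩ ⟨(w.get k).label, !o, s⟩ := by
    intro k
    obtain ⟨h1, h2, o, s, h3, h4⟩ := hσ (w.get k) (hu₀.mem_iff.2 (List.get_mem w k))
    exact ⟨h1, h2, o, s, h3.of_isRotated hu₀, h4.of_isRotated hu₀⟩
  -- By `hA` and `hB`, exactly one of two successive letters is initial. As the word was rotated to
  -- start with an initial letter, the initial ones are those at even positions.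
  have hA : ∀ k : Fin w.length, IsInitial w σ (w.get k) →
      ¬ IsInitial w σ (w.get (finRotate _ k)) := fun k =>
    IsInitial.not_isInitial_finRotate hw (hpair k).1 (hpair k).2.1
  have hB : ∀ k : Fin w.length, ¬ IsInitial w σ (w.get (finRotate _ k)) →
      IsInitial w σ (w.get k) := by
    intro k hk
    obtain ⟨h1, h2, o, s, h3, h4⟩ := hpair (finRotate _ k)
    rcases hw.eq_or_eq_mate _ h3.mem_left _ (List.get_mem w (finRotate _ k)) rfl with h5 | h5
    · refine absurd ?_ hk
      rw [h5] at h3 ⊢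
      exact h3
    · obtain ⟨e, he⟩ := List.get_of_mem h4.mem_left
      have h6 := h4.finRotate_eq hw.nodup he h5
      rw [(finRotate _).injective h6] at he
      rw [he]
      unfold IsInitial
      simp only
      rw [h1]
      exact h4
  have hpos : 0 < w.length := by simp [hwdef]
  have h0 : IsInitial w σ (w.get ⟨0, hpos⟩) := ⟨u₀, List.IsRotated.refl _⟩
  have heven : ∀ (k : ℕ) (hk : k < w.length), IsInitial w σ (w.get ⟨k, hk⟩) ↔ k % 2 = 0 := by
    intro k
    induction k with
    | zero => exact fun hk => ⟨fun _ => rfl, fun _ => h0⟩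
    | succ k ih =>
      intro hk
      have hk' : k < w.length := by omega
      have hr : (⟨k + 1, hk⟩ : Fin w.length) = finRotate _ ⟨k, hk'⟩ := by
        ext
        rw [val_finRotate]
        exact (Nat.mod_eq_of_lt hk).symm
      have h1 := hA ⟨k, hk'⟩
      have h2 := hB ⟨k, hk'⟩
      rw [← hr] at h1 h2
      have h3 := ih hk'
      by_cases h : k % 2 = 0
      · have := h1 (h3.2 h)
        exact ⟨fun h => absurd h this, fun h => by omega⟩
      · refine ⟨fun _ => by omega, fun _ => by_contra fun h' => h (h3.1 (h2 h'))⟩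
  -- The first letter is initial, so the last one is not and has an odd position.
  obtain ⟨L, hL⟩ : ∃ L, w.length = 2 * L := by
    have hl : w.length - 1 < w.length := by omega
    have hr : finRotate _ (⟨w.length - 1, hl⟩ : Fin w.length) = ⟨0, hpos⟩ := by
      ext
      rw [val_finRotate]
      simp [Nat.sub_add_cancel hpos]
    have h1 := hA ⟨_, hl⟩
    rw [hr, heven _ hl] at h1
    have h2 : ¬ (w.length - 1) % 2 = 0 := fun h => h1 h h0
    exact ⟨w.length / 2, by omega⟩
  let E : Fin L → Fin w.length := fun i => ⟨2 * i, by omega⟩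
  have hE : ∀ i, IsInitial w σ (w.get (E i)) := fun i => (heven _ _).2 (by simp)
  have hE' : ∀ k, IsInitial w σ (w.get k) → ∃ i, E i = k := by
    intro k hk
    have h1 := (heven k k.2).1 hk
    have h2 := k.2
    exact ⟨⟨k / 2, by omega⟩, Fin.ext (show 2 * ((k : ℕ) / 2) = k by omega)⟩
  -- Of the two passages through a crossing only the one named by the matched pair is initial; the
  -- other one follows an initial letter.
  have hchar : ∀ (k : Fin w.length), IsInitial w σ (w.get k) → ∀ o s : Bool,
      Follows w ⟨(w.get k).label, o, s⟩ ⟨σ (w.get k).label, !o, s⟩ →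
      Follows w ⟨σ (w.get k).label, o, s⟩ ⟨(w.get k).label, !o, s⟩ →
      w.get k = ⟨(w.get k).label, o, s⟩ ∧ IsInitial w σ ⟨σ (w.get k).label, o, s⟩ := by
    intro k hk o s h3 h4
    obtain ⟨h1, -⟩ := hpair k
    have h6 : IsInitial w σ ⟨σ (w.get k).label, o, s⟩ := by
      unfold IsInitial
      simp only
      rw [h1]
      exact h4
    refine ⟨?_, h6⟩
    rcases hw.eq_or_eq_mate _ h3.mem_left _ (List.get_mem w k) rfl with h5 | h5
    · exact h5
    · obtain ⟨e, he⟩ := List.get_of_mem h4.mem_left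
      have h7 := h4.finRotate_eq hw.nodup he h5
      rw [← he] at h6
      exact absurd (h7 ▸ hk) (hA e h6)
  have hpartner : ∀ i : Fin L, ∃ j : Fin L, w.get (E j) =
      ⟨σ (w.get (E i)).label, (w.get (E i)).isOver, (w.get (E i)).isPos⟩ := by
    intro i
    obtain ⟨h1, h2, o, s, h3, h4⟩ := hpair (E i)
    obtain ⟨h5, h6⟩ := hchar (E i) (hE i) o s h3 h4
    obtain ⟨k, hk⟩ := List.get_of_mem h6.mem_left
    rw [← hk] at h6
    obtain ⟨j, rfl⟩ := hE' k h6
    refine ⟨j, ?_⟩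
    rw [hk, show (w.get (E i)).isOver = o from congrArg Letter.isOver h5,
      show (w.get (E i)).isPos = s from congrArg Letter.isPos h5]
  choose τ hτ using hpartner
  have hlab : Function.Injective fun i => (w.get (E i)).label := by
    intro i j hij
    simp only at hij
    obtain ⟨h1, h2, o, s, h3, h4⟩ := hpair (E i)
    obtain ⟨h5, -⟩ := hchar (E i) (hE i) o s h3 h4
    rw [hij] at h3 h4 h5
    obtain ⟨h6, -⟩ := hchar (E j) (hE j) o s h3 h4
    have := congrArg Fin.val (hw.nodup.injective_get (h5.trans h6.symm))
    simp only [E] at this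
    exact Fin.ext (by omega)
  refine ⟨w, hu₀, L, fun i => (w.get (E i)).label, τ, fun i => (w.get (E i)).isOver,
    fun i => (w.get (E i)).isPos, hL, ?_, ?_, hlab, ?_, ?_, ?_, ?_⟩
  · intro i k hk
    rw [show k = E i from Fin.ext hk]
  · intro i k hk
    have : k = finRotate _ (E i) := by
      ext
      have := k.2
      rw [val_finRotate, hk]
      exact (Nat.mod_eq_of_lt (by omega)).symm
    rw [this, (hE i).get_finRotate hw.nodup rfl, hτ]
  · intro i
    apply hlab
    simp only [hτ]
    exact (hpair (E i)).1
  · intro i hi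
    have := hτ i
    rw [hi] at this
    exact (hpair (E i)).2.1 (congrArg Letter.label this)
  · intro i
    rw [hτ]
  · intro i
    rw [hτ]

end Matched

/-! ### Colorings of block words in terms of the changes along the blocks. -/

section BlockColoring

variable {w : List Letter} {L : ℕ} {lab : Fin L → ℕ} {τ : Fin L → Fin L} {o s : Fin L → Bool}
variable {X : Type} [AddCommGroup X] [Module ℤ[T;T⁻¹] X]

/-- The ratio of the change of color along a block and the difference of the colors between the
two blocks of a matched pair. -/
noncomputable def blockCoeff (o s : Bool) : ℤ[T;T⁻¹] :=
  if o then tPow (!s) - 1 else 1 - tPow s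

/-- The sum of the first `k` members of a family. -/
def partialSum {X : Type} [AddCommGroup X] (d : Fin L → X) (k : ℕ) : X :=
  ∑ j : Fin L, if (j : ℕ) < k then d j else 0

theorem partialSum_zero {X : Type} [AddCommGroup X] (d : Fin L → X) : partialSum d 0 = 0 := by simp [partialSum]

theorem partialSum_succ {X : Type} [AddCommGroup X] (d : Fin L → X) (i : Fin L) :
    partialSum d (i + 1) = partialSum d i + d i := by
  have : ∀ j : Fin L, (if (j : ℕ) < i + 1 then d j else 0) =
      (if (j : ℕ) < i then d j else 0) + if j = i then d j else 0 := by
    intro j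
    simp only [Fin.ext_iff]
    split_ifs <;> first | omega | simp
  simp only [partialSum, this, Finset.sum_add_distrib]
  simp

theorem sum_crossCount (τ : Fin L → Fin L) (d : Fin L → X) (i : Fin L) :
    ∑ j, (crossCount τ i j : ℤ[T;T⁻¹]) • d j = partialSum d (τ i) - partialSum d i - d i := by
  rw [sub_sub, ← partialSum_succ, partialSum, partialSum, ← Finset.sum_sub_distrib]
  refine Finset.sum_congr rfl fun j _ => ?_
  simp only [crossCount, Fin.lt_def, Fin.le_def, Nat.lt_succ_iff]
  split_ifs <;> simp

/-- The possible changes of color along the blocks of a block word. -/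
def jumpSystem (τ : Fin L → Fin L) (o s : Fin L → Bool) : System ℤ[T;T⁻¹] (Fin L) :=
  fun _ _ _ d => (∀ i, d (τ i) = - d i) ∧
    ∀ i, d i = blockCoeff (o i) (s i) • ∑ j, (crossCount τ i j : ℤ[T;T⁻¹]) • d j

/-- Here `x`, `x'` are the colors in front of the two strands of a pair, `d`, `d'` their changes,
and `z`, `z'` the colors with which they pass above. The relations at the two lower passages, added
up, give `d' = -d`; then `d` is eliminated from the right side of the first one. -/
theorem eq_smul_of_tPow {o s : Bool} {x x' d d' z z' : X}
    (hz : z = if o then x else x + d) (hz' : z' = if o then x' else x' + d')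
    (h : d = (1 - tPow s) • (z' - x)) (h' : d' = (1 - tPow s) • (z - x')) :
    d' = - d ∧ d = blockCoeff o s • (x' - x - d) := by
  cases o
  · simp only [Bool.false_eq_true, if_false] at hz hz'
    subst hz hz'
    have hs : tPow s • (d' + d) = 0 := by
      have e : (1 - tPow s) • (x' + d' - x) + (1 - tPow s) • (x + d - x') =
          (1 - tPow s) • (d' + d) := by module
      rw [← h, ← h'] at e
      calc tPow s • (d' + d) = (d' + d) - (1 - tPow s) • (d' + d) := by module
        _ = 0 := by rw [← e]; abel
    have hd : d' = - d := by
      have := tPow_not_smul s (d' + d)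
      rw [hs, smul_zero] at this
      exact eq_neg_of_add_eq_zero_left this.symm
    refine ⟨hd, ?_⟩
    simp only [blockCoeff, Bool.false_eq_true, if_false]
    conv_lhs => rw [h, hd]
    congr 1
    abel
  · simp only [if_true] at hz hz'
    subst hz hz'
    refine ⟨by rw [h, h']; module, ?_⟩
    simp only [blockCoeff, if_true]
    have hd : tPow s • d = (1 - tPow s) • (z' - z - d) := by
      calc tPow s • d = d - (1 - tPow s) • d := by module
        _ = (1 - tPow s) • (z' - z) - (1 - tPow s) • d := by rw [← h]
        _ = _ := by module
    calc d = tPow (!s) • (1 - tPow s) • (z' - z - d) := by rw [← hd, tPow_not_smul]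
      _ = _ := by rw [smul_smul, mul_sub, mul_one, mul_comm (tPow (!s)) (tPow s), tPow_mul_not]

theorem tPow_of_eq_smul {o s : Bool} {x x' d : X} (h : d = blockCoeff o s • (x' - x - d)) :
    x + d = tPow s • x + (1 - tPow s) • (if o then x' else x' - d) := by
  cases o
  · simp only [blockCoeff, Bool.false_eq_true, if_false] at h ⊢
    conv_lhs => rw [h]
    module
  · simp only [blockCoeff, if_true] at h ⊢
    have h2 : tPow s • d = (1 - tPow s) • (x' - x - d) := by
      conv_lhs => rw [h, smul_smul, mul_sub, mul_one, tPow_mul_not]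
    calc x + d = x + tPow s • d + (1 - tPow s) • d := by module
      _ = _ := by rw [h2]; module

theorem endColor_take_block (hB : IsBlockWord w L lab τ o s) (c : ℕ → X) (i : Fin L) :
    endColor c (w.take (2 * i + 1)) 0 =
      pass c (endColor c (w.take (2 * i)) 0) ⟨lab i, o i, s i⟩ ∧
    endColor c (w.take (2 * (i + 1))) 0 =
      pass c (endColor c (w.take (2 * i + 1)) 0) ⟨lab (τ i), !o i, s i⟩ := by
  constructor
  · rw [endColor_take_succ c w 0 (2 * i) (hB.fst i).2, ← hB.get_even i (hB.fst i) rfl]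
    rfl
  · rw [show 2 * ((i : ℕ) + 1) = 2 * i + 1 + 1 by ring,
      endColor_take_succ c w 0 (2 * i + 1) (hB.snd i).2, ← hB.get_odd i (hB.snd i) rfl]
    rfl

theorem runs_iff_block (hB : IsBlockWord w L lab τ o s) (c : ℕ → X) :
    Runs c w 0 0 ↔ endColor c w 0 = 0 ∧ ∀ i,
      (o i = true → c (lab i) = endColor c (w.take (2 * i)) 0) ∧
      (o i = false → c (lab (τ i)) = endColor c (w.take (2 * i + 1)) 0) := by
  rw [runs_iff_getElem]
  refine and_congr_right fun _ => ⟨fun h i => ⟨fun ho => ?_, fun ho => ?_⟩, fun h k hk hko => ?_⟩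
  · have h1 := h (2 * i) (hB.fst i).2
    rw [show w[2 * (i : ℕ)]'(hB.fst i).2 = _ from hB.get_even i (hB.fst i) rfl] at h1
    exact h1 ho
  · have h1 := h (2 * i + 1) (hB.snd i).2
    rw [show w[2 * (i : ℕ) + 1]'(hB.snd i).2 = _ from hB.get_odd i (hB.snd i) rfl] at h1
    exact h1 (by simp [ho])
  · rcases hB.eq_fst_or_eq_snd ⟨k, hk⟩ with ⟨i, hi⟩ | ⟨i, hi⟩
    · obtain rfl : k = 2 * i := congrArg Fin.val hi
      rw [show w[2 * (i : ℕ)]'hk = _ from hB.get_even i ⟨_, hk⟩ rfl] at hko ⊢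
      exact (h i).1 hko
    · obtain rfl : k = 2 * i + 1 := congrArg Fin.val hi
      rw [show w[2 * (i : ℕ) + 1]'hk = _ from hB.get_odd i ⟨_, hk⟩ rfl] at hko ⊢
      exact (h i).2 (by simpa using hko)

/-- The changes of color along the blocks. -/
noncomputable def blockJumps (w : List Letter) (L : ℕ) (c : ℕ → X) (i : Fin L) : X :=
  endColor c (w.take (2 * (i + 1))) 0 - endColor c (w.take (2 * i)) 0

theorem endColor_take_eq_partialSum (w : List Letter) (L : ℕ) (c : ℕ → X) {k : ℕ} (hk : k ≤ L) :
    endColor c (w.take (2 * k)) 0 = partialSum (blockJumps w L c) k := by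
  induction k with
  | zero => rw [partialSum_zero]; rfl
  | succ k ih =>
    have := partialSum_succ (blockJumps w L c) ⟨k, hk⟩
    simp only at this
    rw [this, ← ih (by omega), blockJumps]
    simp

theorem jumpSystem_blockJumps (hB : IsBlockWord w L lab τ o s) {c : ℕ → X}
    (hc : coloringSystem w X c) :
    jumpSystem τ o s X (blockJumps w L c) ∧
      ∀ i, c (lab i) = if o i then partialSum (blockJumps w L c) i
        else partialSum (blockJumps w L c) (τ i) + blockJumps w L c (τ i) := by
  obtain ⟨-, hr⟩ := (runs_iff_block hB c).1 hc.2
  set d := blockJumps w L c with hd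
  have hV : ∀ i : Fin L, endColor c (w.take (2 * i)) 0 = partialSum d i := fun i =>
    endColor_take_eq_partialSum w L c i.2.le
  have hV' : ∀ i : Fin L, endColor c (w.take (2 * (i + 1))) 0 = partialSum d i + d i := fun i => by
    rw [endColor_take_eq_partialSum w L c i.2, ← partialSum_succ]
  have hlab : ∀ i, c (lab i) = if o i then partialSum d i else partialSum d (τ i) + d (τ i) := by
    intro i
    cases ho : o i
    · have h1 := (hr (τ i)).2 (by rw [hB.over_partner, ho])
      have h2 := (endColor_take_block hB c (τ i)).2
      rw [hB.partner_partner] at h1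
      rw [hV', pass, if_pos (by rw [hB.over_partner, ho]; rfl)] at h2
      rw [h1, ← h2]
      rfl
    · rw [(hr i).1 ho, hV]
      rfl
  have hrel : ∀ i, d i = (1 - tPow (s i)) •
      ((if o i then partialSum d (τ i) else partialSum d (τ i) + d (τ i)) - partialSum d i) := by
    intro i
    obtain ⟨h1, h2⟩ := endColor_take_block hB c i
    have h3 := hlab i
    have h4 := hlab (τ i)
    rw [hB.over_partner] at h4
    rw [hV'] at h2
    rw [hV] at h1
    cases ho : o i
    · rw [ho] at h1 h2 h3
      simp only [pass, Bool.false_eq_true, if_false, Bool.not_false, if_true] at h1 h2 h3 ⊢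
      rw [h1, h3] at h2
      rw [eq_sub_of_add_eq' h2]
      module
    · rw [ho] at h1 h2 h4
      simp only [pass, Bool.false_eq_true, if_false, Bool.not_true, if_true] at h1 h2 h4 ⊢
      rw [h1, h4] at h2
      rw [eq_sub_of_add_eq' h2]
      module
  refine ⟨?_, hlab⟩
  have hfin : ∀ i, d (τ i) = - d i ∧
      d i = blockCoeff (o i) (s i) • (partialSum d (τ i) - partialSum d i - d i) := by
    intro i
    have h' := hrel (τ i)
    rw [hB.partner_partner, hB.over_partner, hB.sign_partner] at h'
    exact eq_smul_of_tPow rfl rfl (hrel i) h'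
  refine ⟨fun i => (hfin i).1, fun i => ?_⟩
  rw [sum_crossCount]
  exact (hfin i).2

open Classical in
/-- The coloring of a block word with given changes of color along the blocks. -/
noncomputable def blockColors {X : Type} [AddCommGroup X] (lab : Fin L → ℕ) (τ : Fin L → Fin L) (o : Fin L → Bool)
    (d : Fin L → X) (a : ℕ) : X :=
  if h : ∃ i, lab i = a then
    if o h.choose then partialSum d h.choose
    else partialSum d (τ h.choose) + d (τ h.choose)
  else 0

theorem blockColors_lab {X : Type} [AddCommGroup X] (hB : IsBlockWord w L lab τ o s) (d : Fin L → X) (i : Fin L) :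
    blockColors lab τ o d (lab i) =
      if o i then partialSum d i else partialSum d (τ i) + d (τ i) := by
  have h : ∃ j, lab j = lab i := ⟨i, rfl⟩
  rw [blockColors, dif_pos h, hB.lab_injective h.choose_spec]

theorem IsBlockWord.mem_labels_iff (hB : IsBlockWord w L lab τ o s) (a : ℕ) :
    a ∈ w.map Letter.label ↔ ∃ i, lab i = a := by
  rw [List.mem_map]
  constructor
  · rintro ⟨x, hx, rfl⟩
    obtain ⟨k, rfl⟩ := List.get_of_mem hx
    rcases hB.eq_fst_or_eq_snd k with ⟨i, rfl⟩ | ⟨i, rfl⟩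
    · exact ⟨i, by rw [hB.get_even i _ rfl]⟩
    · exact ⟨τ i, by rw [hB.get_odd i _ rfl]⟩
  · rintro ⟨i, rfl⟩
    exact ⟨_, List.get_mem w (hB.fst i), by rw [hB.get_even i _ rfl]⟩

theorem coloringSystem_blockColors (hB : IsBlockWord w L lab τ o s) {d : Fin L → X}
    (hd : jumpSystem τ o s X d) :
    coloringSystem w X (blockColors lab τ o d) ∧ blockJumps w L (blockColors lab τ o d) = d := by
  set c := blockColors lab τ o d with hc
  have hlab := blockColors_lab hB d
  rw [← hc] at hlab
  have hblock : ∀ i : Fin L, endColor c (w.take (2 * i)) 0 = partialSum d i →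
      endColor c (w.take (2 * (i + 1))) 0 = partialSum d i + d i ∧
      (o i = false → endColor c (w.take (2 * i + 1)) 0 = partialSum d i + d i) := by
    intro i hi
    obtain ⟨h1, h2⟩ := endColor_take_block hB c i
    have h3 := hlab i
    have h4 := hlab (τ i)
    rw [hB.over_partner] at h4
    have h5 := hd.2 i
    rw [sum_crossCount] at h5
    have h6 := tPow_of_eq_smul h5
    have h7 := hd.1 i
    rw [hi] at h1
    cases ho : o i
    · rw [ho] at h1 h2 h3 h6
      simp only [pass, Bool.false_eq_true, if_false, Bool.not_false, if_true] at h1 h2 h3 h6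
      rw [h3, h7, ← sub_eq_add_neg, ← h6] at h1
      exact ⟨h2.trans h1, fun _ => h1⟩
    · rw [ho] at h1 h2 h4 h6
      simp only [pass, Bool.false_eq_true, if_false, Bool.not_true, if_true] at h1 h2 h4 h6
      rw [h1, h4, ← h6] at h2
      exact ⟨h2, fun h => absurd h (by simp)⟩
  have hV : ∀ k ≤ L, endColor c (w.take (2 * k)) 0 = partialSum d k := by
    intro k
    induction k with
    | zero => intro _; rw [partialSum_zero]; rfl
    | succ k ih =>
      intro hk
      have h1 := (hblock ⟨k, hk⟩ (ih (by omega))).1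
      have h2 := partialSum_succ d ⟨k, hk⟩
      exact h1.trans h2.symm
  refine ⟨⟨fun a ha => ?_, (runs_iff_block hB c).2 ⟨?_, fun i => ⟨fun ho => ?_, fun ho => ?_⟩⟩⟩, ?_⟩
  · rw [hB.mem_labels_iff] at ha
    rw [hc, blockColors, dif_neg ha]
  · have := hV L le_rfl
    rw [← hB.length_eq, List.take_length] at this
    rw [this, partialSum]
    simp only [Fin.is_lt, if_true]
    -- The color returns to zero at the end because the changes of the two blocks of each pair
    -- cancel.
    refine Finset.sum_involution (fun i _ => τ i) (fun i _ => ?_) (fun i _ _ => hB.partner_ne i)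
      (fun i _ => Finset.mem_univ _) (fun i _ => hB.partner_partner i)
    rw [hd.1, add_neg_cancel]
  · rw [hV i i.2.le, hlab, ho]
    rfl
  · rw [(hblock i (hV i i.2.le)).2 ho, hlab, hB.over_partner, ho, hB.partner_partner]
    rfl
  · ext i
    rw [blockJumps, hV i i.2.le, hV (i + 1) i.2, partialSum_succ]
    abel

theorem exists_isUniversal_jumpSystem (hB : IsBlockWord w L lab τ o s) {M : Type} [AddCommGroup M]
    [Module ℤ[T;T⁻¹] M] (h : Presents w M) :
    ∃ d : Fin L → M, IsUniversal (jumpSystem τ o s) d := by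
  obtain ⟨c, hc⟩ := h
  have hps : ∀ (X Y : Type) [AddCommGroup X] [Module ℤ[T;T⁻¹] X] [AddCommGroup Y]
      [Module ℤ[T;T⁻¹] Y] (φ : X →ₗ[ℤ[T;T⁻¹]] Y) (d : Fin L → X) (k : ℕ),
      φ (partialSum d k) = partialSum (fun i => φ (d i)) k := by
    intro X Y _ _ _ _ φ d k
    simp only [partialSum, map_sum]
    refine Finset.sum_congr rfl fun j _ => ?_
    split_ifs <;> simp
  refine ⟨_, hc.transport (fun X _ _ c => blockJumps w L c) (fun X _ _ d => blockColors lab τ o d)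
    (fun X _ _ c hc => (jumpSystem_blockJumps hB hc).1)
    (fun X _ _ d hd => (coloringSystem_blockColors hB hd).1) ?_ ?_ (fun X _ _ c hc => ?_)
    (fun X _ _ d hd => (coloringSystem_blockColors hB hd).2)⟩
  · intro X Y _ _ _ _ φ c
    ext i
    simp only [blockJumps, map_sub, map_endColor, map_zero]
  · intro X Y _ _ _ _ φ d
    ext a
    simp only [blockColors]
    split_ifs <;> simp [hps]
  · ext a
    by_cases ha : ∃ i, lab i = a
    · obtain ⟨i, rfl⟩ := ha
      rw [blockColors_lab hB, (jumpSystem_blockJumps hB hc).2 i]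
    · rw [blockColors, dif_neg ha, hc.1 a (by rwa [hB.mem_labels_iff])]

end BlockColoring

/-! ### Ideals generated by symmetric Laurent polynomials. -/

section Symmetric

-- For monomials this follows inductively from t^{n+1} - t^{-n-1} = t (t^n - t^{-n}) + t^{-n} (t -
-- t⁻¹).
open LaurentPolynomial in
theorem exists_sub_invert_eq (r : ℤ[T;T⁻¹]) : ∃ q, r - invert r = (T 1 - T (-1)) * q := by
  induction r using LaurentPolynomial.induction_on with
  | h_C a => exact ⟨0, by simp⟩
  | h_add hp hq' =>
    obtain ⟨q, hq⟩ := hp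
    obtain ⟨q', hq'⟩ := hq'
    exact ⟨q + q', by rw [map_add]; linear_combination hq + hq'⟩
  | h_C_mul_T n a h =>
    obtain ⟨q, hq⟩ := h
    simp only [map_mul, invert_C, invert_T] at hq ⊢
    refine ⟨T 1 * q + C a * T (-n), ?_⟩
    rw [neg_add, T_add, T_add]
    linear_combination T 1 * hq
  | h_C_mul_T_Z n a h =>
    obtain ⟨q, hq⟩ := h
    simp only [map_mul, invert_C, invert_T] at hq ⊢
    refine ⟨T (-1) * q - C a * T n, ?_⟩
    rw [neg_neg] at hq
    rw [show -(-(n : ℤ) - 1) = n + 1 by ring, sub_eq_add_neg (-(n : ℤ)), T_add, T_add]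
    linear_combination T (-1) * hq

open LaurentPolynomial in
/-- An ideal generated by symmetric Laurent polynomials that contains `1 + t` is trivial. -/
theorem span_eq_top_of_one_add_T_mem {S : Set ℤ[T;T⁻¹]} (hS : ∀ r ∈ S, invert r = r)
    (h : 1 + T 1 ∈ Ideal.span S) : Ideal.span S = ⊤ := by
  have key : ∀ r ∈ Ideal.span S, ∃ q ∈ Ideal.span S, r - invert r = (T 1 - T (-1)) * q := by
    intro r hr
    induction hr using Submodule.span_induction with
    | mem r hr => exact ⟨0, Ideal.zero_mem _, by rw [hS r hr]; simp⟩
    | zero => exact ⟨0, Ideal.zero_mem _, by simp⟩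
    | add r r' _ _ h h' =>
      obtain ⟨q, hq, e⟩ := h
      obtain ⟨q', hq', e'⟩ := h'
      exact ⟨q + q', Ideal.add_mem _ hq hq', by rw [map_add]; linear_combination e + e'⟩
    | smul a r hr h =>
      obtain ⟨q, hq, e⟩ := h
      obtain ⟨b, hb⟩ := exists_sub_invert_eq a
      -- Writing r̄ for r(t⁻¹): ar - ār̄ = a (r - r̄) + (a - ā) r̄, and r̄ = r - (t - t⁻¹) q lies in
      -- the ideal.
      refine ⟨a * q + b * (r - (T 1 - T (-1)) * q),
        Ideal.add_mem _ (Ideal.mul_mem_left _ _ hq) (Ideal.mul_mem_left _ _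
          (Ideal.sub_mem _ hr (Ideal.mul_mem_left _ _ hq))), ?_⟩
      rw [smul_eq_mul, map_mul]
      linear_combination a * e + invert r * hb - b * (T 1 - T (-1)) * e
  obtain ⟨q, hq, e⟩ := key _ h
  have h1 : (T 1 - T (-1) : ℤ[T;T⁻¹]) ≠ 0 := by
    intro h0
    have := congrArg (fun p : ℤ[T;T⁻¹] => p.coeff 1) h0
    simp at this
  have : q = 1 := by
    apply mul_left_cancel₀ h1
    rw [← e, map_add, map_one, invert_T]
    ring
  rw [Ideal.eq_top_iff_one, ← this]
  exact hq

open LaurentPolynomial in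
theorem minorIdeal_eq_top_of_one_add_T_mem {ι κ : Type} {A : Matrix ι κ ℤ[T;T⁻¹]}
    (hA : ∀ i j, invert (A i j) = A i j) {k : ℕ} (h : 1 + T 1 ∈ minorIdeal A k) :
    minorIdeal A k = ⊤ := by
  refine span_eq_top_of_one_add_T_mem ?_ h
  rintro _ ⟨⟨p, q⟩, rfl⟩
  have := (invert (R := ℤ)).toRingEquiv.toRingHom.map_det (A.submatrix p q)
  refine Eq.trans this ?_
  congr 1
  ext1 i j
  exact hA _ _

end Symmetric

/-! ### Elimination of the right blocks, and the symmetric presentation matrix. -/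

section LeftBlocks

variable {w : List Letter} {L : ℕ} {lab : Fin L → ℕ} {τ : Fin L → Fin L} {o s : Fin L → Bool}
variable {X : Type} [AddCommGroup X] [Module ℤ[T;T⁻¹] X]

/-- The coefficients of the relations between the blocks at the left, after elimination of those at
the right. -/
noncomputable def leftCoeff (τ : Fin L → Fin L) (o s : Fin L → Bool) (i k : Fin L) : ℤ[T;T⁻¹] :=
  ∑ j, if o j = s j then 0 else
    blockCoeff (o i) (s i) * blockCoeff (o j) (s j) * (crossCount τ i j * crossCount τ j k : ℤ)

/-- A presentation matrix of the Alexander module of a matched diagram. -/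
noncomputable def leftMatrix (τ : Fin L → Fin L) (o s : Fin L → Bool) :
    Matrix ({i : Fin L // o i = s i} ⊕ {i : Fin L // o i = s i}) {i : Fin L // o i = s i}
      ℤ[T;T⁻¹] :=
  Matrix.of <| Sum.elim
    (fun i k => (if k.1 = i.1 then 1 else 0) + (if k.1 = τ i.1 then 1 else 0))
    (fun i k => (if k.1 = i.1 then 1 else 0) - leftCoeff τ o s i.1 k.1)

theorem invert_tPow (s : Bool) : LaurentPolynomial.invert (tPow s) = tPow (!s) := by
  cases s <;> simp [tPow]

/-- The block coefficient is ±(1 - t⁻¹) for the left block `i` and ±(1 - t) for every right block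
`j`. Their product is symmetric and the remaining factors are integers. -/
theorem invert_leftCoeff {i : Fin L} (hi : o i = s i) (k : Fin L) :
    LaurentPolynomial.invert (leftCoeff τ o s i k) = leftCoeff τ o s i k := by
  rw [leftCoeff, map_sum]
  refine Finset.sum_congr rfl fun j _ => ?_
  split_ifs with hj
  · simp
  · rw [map_mul, map_intCast]
    congr 1
    unfold blockCoeff
    rw [← hi]
    have hj' : s j = !o j := by cases h : o j <;> cases h' : s j <;> simp_all
    rw [hj']
    cases o i <;> cases o j <;> simp [invert_tPow] <;> ring

theorem invert_leftMatrix (i : {i : Fin L // o i = s i} ⊕ {i : Fin L // o i = s i})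
    (k : {i : Fin L // o i = s i}) :
    LaurentPolynomial.invert (leftMatrix τ o s i k) = leftMatrix τ o s i k := by
  rcases i with i | i
  · simp only [leftMatrix, Matrix.of_apply, Sum.elim_inl, map_add]
    split_ifs <;> simp
  · simp only [leftMatrix, Matrix.of_apply, Sum.elim_inr, map_sub, invert_leftCoeff i.2]
    split_ifs <;> simp

/-- The color changes at the left, extended by zero. -/
def extendLeft {X : Type} [AddCommGroup X] (o s : Fin L → Bool) (y : {i : Fin L // o i = s i} → X)
    (k : Fin L) : X :=
  if h : o k = s k then y ⟨k, h⟩ else 0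

/-- The color changes at all blocks, computed from those at the left. -/
noncomputable def extendRight (τ : Fin L → Fin L) (o s : Fin L → Bool) (Y : Fin L → X)
    (i : Fin L) : X :=
  if o i = s i then Y i else
    blockCoeff (o i) (s i) • ∑ k, (crossCount τ i k : ℤ[T;T⁻¹]) • Y k

theorem sum_smul_extendLeft (f : Fin L → ℤ[T;T⁻¹]) (y : {i : Fin L // o i = s i} → X) :
    ∑ k : {i : Fin L // o i = s i}, f k.1 • y k = ∑ k, f k • extendLeft o s y k := by
  rw [← Finset.sum_subset (Finset.subset_univ (Finset.univ.filter fun k => o k = s k)),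
    Finset.sum_subtype (p := fun k => o k = s k) _ (by simp)]
  · refine Finset.sum_congr rfl fun k _ => ?_
    rw [extendLeft, dif_pos k.2]
  · intro k _ hk
    rw [extendLeft, dif_neg (by simpa using hk), smul_zero]

theorem sum_leftCoeff (Y : Fin L → X) (i : Fin L) :
    ∑ k, leftCoeff τ o s i k • Y k = blockCoeff (o i) (s i) • ∑ j, if o j = s j then 0 else
      (crossCount τ i j : ℤ[T;T⁻¹]) • extendRight τ o s Y j := by
  simp only [leftCoeff, Finset.sum_smul]
  rw [Finset.sum_comm, Finset.smul_sum]
  refine Finset.sum_congr rfl fun j _ => ?_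
  split_ifs with hj
  · simp
  · rw [extendRight, if_neg hj]
    simp only [Finset.smul_sum]
    refine Finset.sum_congr rfl fun k _ => ?_
    simp only [smul_smul]
    congr 1
    push_cast
    ring

/-- Blocks at the same side do not contribute to the change of color between the two blocks of a
matched pair. -/
theorem sum_crossCount_same_side (hB : IsBlockWord w L lab τ o s) (hw : IsGaussWord w)
    (hs : IsSpherical w) {d : Fin L → X} (hd : ∀ i, d (τ i) = - d i) (i : Fin L) :
    ∑ j, (crossCount τ i j : ℤ[T;T⁻¹]) • d j =
      ∑ j, if (o j = s j ↔ o i = s i) then 0 else (crossCount τ i j : ℤ[T;T⁻¹]) • d j := by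
  rw [← sub_eq_zero, ← Finset.sum_sub_distrib]
  have hside : ∀ j, (o (τ j) = s (τ j)) ↔ (o j = s j) := fun j => by
    rw [hB.over_partner, hB.sign_partner]
  refine Finset.sum_involution (fun j _ => τ j) (fun j _ => ?_) (fun j _ _ => hB.partner_ne j)
    (fun j _ => Finset.mem_univ _) (fun j _ => hB.partner_partner j)
  simp only [hside]
  split_ifs with h
  · rw [hB.crossCount_partner hw hs h.symm, hd]
    simp
  · simp

/-- Only left blocks contribute to the change at a right block, so `extendRight` recovers all
changes. Substituting these into the relations of the left blocks gives the second half of the rows.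
-/
theorem matrixSystem_leftMatrix (hB : IsBlockWord w L lab τ o s) (hw : IsGaussWord w)
    (hs : IsSpherical w) {d : Fin L → X} (hd : jumpSystem τ o s X d) :
    matrixSystem (leftMatrix τ o s) X (fun k => d k.1) ∧
      extendRight τ o s (extendLeft o s fun k => d k.1) = d := by
  set Y := extendLeft o s fun k => d k.1 with hY
  have hright : extendRight τ o s Y = d := by
    ext i
    unfold extendRight
    split_ifs with hi
    · rw [hY, extendLeft, dif_pos hi]
    · rw [hd.2 i, sum_crossCount_same_side hB hw hs hd.1]
      congr 1
      refine Finset.sum_congr rfl fun k _ => ?_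
      by_cases hk : o k = s k
      · rw [if_neg (by tauto), hY, extendLeft, dif_pos hk]
      · rw [if_pos (by tauto), hY, extendLeft, dif_neg hk, smul_zero]
  refine ⟨fun i => ?_, hright⟩
  rcases i with i | i
  · simp only [leftMatrix, Matrix.of_apply, Sum.elim_inl]
    rw [sum_smul_extendLeft (o := o) (s := s)
      (fun k => (if k = i.1 then 1 else 0) + (if k = τ i.1 then 1 else 0)) fun k => d k.1]
    simp only [add_smul, Finset.sum_add_distrib, ite_smul, one_smul, zero_smul,
      Finset.sum_ite_eq', Finset.mem_univ, if_true]
    rw [extendLeft, extendLeft, dif_pos i.2, dif_pos (by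
      rw [hB.over_partner, hB.sign_partner]; exact i.2), hd.1, add_neg_cancel]
  · simp only [leftMatrix, Matrix.of_apply, Sum.elim_inr]
    rw [sum_smul_extendLeft (o := o) (s := s)
      (fun k => (if k = i.1 then 1 else 0) - leftCoeff τ o s i.1 k) fun k => d k.1]
    simp only [sub_smul, Finset.sum_sub_distrib, ite_smul, one_smul, zero_smul,
      Finset.sum_ite_eq', Finset.mem_univ, if_true]
    rw [sum_leftCoeff, ← hY, hright, hY, extendLeft, dif_pos i.2, sub_eq_zero]
    conv_lhs => rw [hd.2 i.1, sum_crossCount_same_side hB hw hs hd.1]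
    congr 1
    refine Finset.sum_congr rfl fun k _ => ?_
    simp only [i.2, iff_true]

theorem jumpSystem_extendRight (hB : IsBlockWord w L lab τ o s) (hw : IsGaussWord w)
    (hs : IsSpherical w) {y : {i : Fin L // o i = s i} → X}
    (hy : matrixSystem (leftMatrix τ o s) X y) :
    jumpSystem τ o s X (extendRight τ o s (extendLeft o s y)) := by
  set Y := extendLeft o s y with hY
  set d := extendRight τ o s Y with hdef
  have hside : ∀ j, (o (τ j) = s (τ j)) ↔ (o j = s j) := fun j => by
    rw [hB.over_partner, hB.sign_partner]
  have hleft : ∀ i, o i = s i → d i = Y i := fun i hi => by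
    rw [hdef, extendRight, if_pos hi]
  have hzero : ∀ i, ¬ o i = s i → Y i = 0 := fun i hi => by
    rw [hY, extendLeft, dif_neg hi]
  have h1 : ∀ i, o i = s i → Y i + Y (τ i) = 0 := by
    intro i hi
    have := hy (Sum.inl ⟨i, hi⟩)
    simp only [leftMatrix, Matrix.of_apply, Sum.elim_inl] at this
    rw [sum_smul_extendLeft (o := o) (s := s)
      (fun k => (if k = i then 1 else 0) + (if k = τ i then 1 else 0)) y] at this
    simpa only [add_smul, Finset.sum_add_distrib, ite_smul, one_smul, zero_smul,
      Finset.sum_ite_eq', Finset.mem_univ, if_true] using this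
  have h2 : ∀ i, o i = s i → Y i = ∑ k, leftCoeff τ o s i k • Y k := by
    intro i hi
    have := hy (Sum.inr ⟨i, hi⟩)
    simp only [leftMatrix, Matrix.of_apply, Sum.elim_inr] at this
    rw [sum_smul_extendLeft (o := o) (s := s)
      (fun k => (if k = i then 1 else 0) - leftCoeff τ o s i k) y] at this
    simp only [sub_smul, Finset.sum_sub_distrib, ite_smul, one_smul, zero_smul,
      Finset.sum_ite_eq', Finset.mem_univ, if_true] at this
    exact sub_eq_zero.1 this
  have hanti : ∀ i, d (τ i) = - d i := by
    intro i
    by_cases hi : o i = s i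
    · rw [hleft i hi, hleft (τ i) ((hside i).2 hi)]
      exact eq_neg_of_add_eq_zero_right (h1 i hi)
    · rw [hdef, extendRight, extendRight, if_neg hi, if_neg (mt (hside i).1 hi),
        hB.over_partner, hB.sign_partner, ← smul_neg, ← Finset.sum_neg_distrib]
      congr 1
      refine Finset.sum_congr rfl fun k _ => ?_
      by_cases hk : o k = s k
      · have e1 : k ≠ i := by rintro rfl; exact hi hk
        have e2 : k ≠ τ i := by rintro rfl; exact hi ((hside i).1 hk)
        -- Exchanging the two blocks of the pair reverses the way between them. The inequalities
        -- that are strict at one end only do no harm, since the left block `k` is neither `i` nor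
        -- `τ i`.
        have : crossCount τ (τ i) k = - crossCount τ i k := by
          unfold crossCount
          rw [hB.partner_partner]
          rw [Ne, Fin.ext_iff] at e1 e2
          simp only [Fin.lt_def, Fin.le_def]
          split_ifs <;> omega
        rw [this]
        push_cast
        rw [neg_smul]
      · rw [hzero k hk]
        simp
  refine ⟨hanti, fun i => ?_⟩
  rw [sum_crossCount_same_side hB hw hs hanti]
  by_cases hi : o i = s i
  · rw [hleft i hi, h2 i hi, sum_leftCoeff]
    congr 1
    refine Finset.sum_congr rfl fun k _ => ?_
    simp only [hi, iff_true, hdef]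
  · conv_lhs => rw [hdef, extendRight, if_neg hi]
    congr 1
    refine Finset.sum_congr rfl fun k _ => ?_
    by_cases hk : o k = s k
    · rw [if_neg (by tauto), hleft k hk]
    · rw [if_pos (by tauto), hzero k hk, smul_zero]

theorem exists_isUniversal_leftMatrix (hB : IsBlockWord w L lab τ o s) (hw : IsGaussWord w)
    (hs : IsSpherical w) {M : Type} [AddCommGroup M] [Module ℤ[T;T⁻¹] M] (h : Presents w M) :
    ∃ y : {i : Fin L // o i = s i} → M, IsUniversal (matrixSystem (leftMatrix τ o s)) y := by
  obtain ⟨d, hd⟩ := exists_isUniversal_jumpSystem hB h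
  refine ⟨_, hd.transport (Q := matrixSystem (leftMatrix τ o s)) (fun X _ _ d k => d k.1)
    (fun X _ _ y => extendRight τ o s (extendLeft o s y))
    (fun X _ _ d hd => (matrixSystem_leftMatrix hB hw hs hd).1)
    (fun X _ _ y hy => jumpSystem_extendRight hB hw hs hy) (fun _ _ _ _ _ _ _ _ => rfl) ?_
    (fun X _ _ d hd => (matrixSystem_leftMatrix hB hw hs hd).2) (fun X _ _ y _ => ?_)⟩
  · intro X Y _ _ _ _ φ y
    have hφ : ∀ k, φ (extendLeft o s y k) = extendLeft o s (fun k => φ (y k)) k := by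
      intro k
      unfold extendLeft
      split_ifs <;> simp
    ext i
    simp only [extendRight]
    split_ifs <;> simp [hφ]
  · ext k
    rw [extendRight, if_pos k.2, extendLeft, dif_pos k.2]

/-- The Alexander ideals of a bipartite knot contain `1 + t` only if they are trivial. -/
theorem one_add_T_notMem_alexanderIdeal {D D' : KnotDiagram} (hD : D.IsMatched)
    (h : D.knot = D'.knot) {m : ℕ} (hm : D'.alexanderIdeal m ≠ ⊤) :
    (1 + LaurentPolynomial.T 1 : ℤ[T;T⁻¹]) ∉ D'.alexanderIdeal m := by
  obtain ⟨M, _, _, hM⟩ := D'.exists_presents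
  obtain ⟨w, hrot, L, lab, τ, o, s, hB⟩ := hD.exists_isBlockWord
  have hM' : Presents w M := ((presents_iff_of_knot_eq h M).2 hM).of_isRotated hrot
  obtain ⟨y, hy⟩ := exists_isUniversal_leftMatrix hB (D.isGaussWord.of_isRotated hrot)
    (D.isSpherical.of_isRotated hrot) hM'
  rw [D'.alexanderIdeal_eq hM hy.isPresentation] at hm ⊢
  exact fun hmem => hm (minorIdeal_eq_top_of_one_add_T_mem invert_leftMatrix hmem)

end LeftBlocks

/-! ### The pretzel knot (3, -3, 3): its diagram, Alexander module and second Alexander ideal. -/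

section Pretzel

/-- A signed Gauss word of the pretzel knot with the parameters `3`, `-3`, `3`. -/
def pretzelWord : List Letter :=
  [⟨0, true, true⟩, ⟨1, false, true⟩, ⟨2, true, true⟩,
   ⟨5, true, false⟩, ⟨4, false, false⟩, ⟨3, true, false⟩,
   ⟨6, true, true⟩, ⟨7, false, true⟩, ⟨8, true, true⟩,
   ⟨2, false, true⟩, ⟨1, true, true⟩, ⟨0, false, true⟩,
   ⟨3, false, false⟩, ⟨4, true, false⟩, ⟨5, false, false⟩,
   ⟨8, false, true⟩, ⟨7, true, true⟩, ⟨6, false, true⟩]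

theorem isGaussWord_pretzelWord : IsGaussWord pretzelWord where
  nodup := by decide
  mate_mem := by decide
  eq_or_eq_mate := by decide

instance (w : List Letter) (i : Fin w.length) : Decidable (FromRight w i) :=
  inferInstanceAs (Decidable (_ = _))

/-- The number of the face at the left of a dart. -/
def pretzelFace (d : Fin pretzelWord.length × Bool) : Fin 11 :=
  if d.2 then [0, 2, 0, 5, 0, 8, 3, 10, 3, 2, 3, 8, 6, 5, 6, 10, 6, 8].getD d.1 0
  else [1, 3, 4, 6, 7, 6, 9, 6, 4, 0, 1, 0, 7, 0, 4, 3, 9, 3].getD d.1 0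

/-- A dart with a given face at its left. -/
def pretzelDart (k : Fin 11) : Fin pretzelWord.length × Bool :=
  [((0 : Fin 18), true), (0, false), (1, true), (1, false), (2, false), (3, true), (3, false),
    (4, false), (5, true), (6, false), (7, true)].getD k (0, true)

theorem pretzelFace_eq_of_faceStep {d d' : Fin pretzelWord.length × Bool}
    (h : FaceStep pretzelWord d d') : pretzelFace d = pretzelFace d' := by
  cases h with
  | fwd_fwd i k h1 h2 => revert i k; decide +kernel
  | fwd_bwd i k h1 h2 => revert i k; decide +kernel
  | bwd_bwd i k h1 h2 => revert i k; decide +kernel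
  | bwd_fwd i k h1 h2 => revert i k; decide +kernel

/-- The other passage through the same crossing. -/
def pretzelMate (i : Fin pretzelWord.length) : Fin pretzelWord.length :=
  [(11 : Fin 18), 10, 9, 14, 13, 12, 17, 16, 15, 2, 1, 0, 5, 4, 3, 8, 7, 6].getD i 0

theorem meets_pretzelMate : ∀ i, Meets pretzelWord i (pretzelMate i) := by decide +kernel

/-- The dart that follows on the boundary of the face at the left. -/
def pretzelNext : Fin pretzelWord.length × Bool → Fin pretzelWord.length × Bool
  | (i, true) =>
    if FromRight pretzelWord (finRotate _ i) then (pretzelMate (finRotate _ i), true)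
    else ((finRotate _).symm (pretzelMate (finRotate _ i)), false)
  | (i, false) =>
    if FromRight pretzelWord i then ((finRotate _).symm (pretzelMate i), false)
    else (pretzelMate i, true)

theorem faceStep_pretzelNext (d : Fin pretzelWord.length × Bool) :
    FaceStep pretzelWord d (pretzelNext d) := by
  rcases d with ⟨i, _ | _⟩
  · simp only [pretzelNext]
    split_ifs with h
    · exact .bwd_bwd _ _ (by rw [Equiv.apply_symm_apply]; exact meets_pretzelMate i) h
    · exact .bwd_fwd _ _ (meets_pretzelMate i) h
  · simp only [pretzelNext]
    split_ifs with h
    · exact .fwd_fwd _ _ (meets_pretzelMate _) h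
    · exact .fwd_bwd _ _ (by rw [Equiv.apply_symm_apply]; exact meets_pretzelMate _) h

/-- No face has more than six sides, so walking around it reaches the chosen dart in fewer than
seven steps. -/
theorem exists_iterate_pretzelNext :
    ∀ d, ∃ j : Fin 7, pretzelNext^[j] d = pretzelDart (pretzelFace d) := by
  decide +kernel

theorem card_face_pretzelWord : Nat.card (Face pretzelWord) = 11 := by
  have hiter : ∀ (j : ℕ) (d : Fin pretzelWord.length × Bool),
      faceAt (pretzelNext^[j] d) = faceAt d := by
    intro j
    induction j with
    | zero => exact fun _ => rfl
    | succ j ih =>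
      intro d
      rw [Function.iterate_succ_apply, ih]
      exact (Quot.sound (faceStep_pretzelNext d)).symm
  let e : Face pretzelWord ≃ Fin 11 :=
    { toFun := Quot.lift pretzelFace fun _ _ h => pretzelFace_eq_of_faceStep h
      invFun := fun k => faceAt (pretzelDart k)
      left_inv := by
        intro x
        obtain ⟨d, rfl⟩ := exists_faceAt_eq x
        obtain ⟨j, hj⟩ := exists_iterate_pretzelNext d
        change faceAt (pretzelDart (pretzelFace d)) = _
        rw [← hj, hiter]
      right_inv := by
        have : ∀ k, pretzelFace (pretzelDart k) = k := by decide
        exact this }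
  rw [Nat.card_congr e, Nat.card_eq_fintype_card, Fintype.card_fin]

/-- The pretzel knot with the parameters `3`, `-3`, `3`. -/
def pretzelDiagram : KnotDiagram where
  word := pretzelWord
  isGaussWord := isGaussWord_pretzelWord
  isSpherical := Or.inr (by rw [card_face_pretzelWord]; rfl)

section Coloring

variable {X : Type} [AddCommGroup X] [Module ℤ[T;T⁻¹] X]

theorem runs_nil (c : ℕ → X) (x y : X) : Runs c [] x y ↔ x = y := Iff.rfl

theorem runs_cons_over (c : ℕ → X) (a : ℕ) (s : Bool) (w : List Letter) (x y : X) :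
    Runs c (⟨a, true, s⟩ :: w) x y ↔ c a = x ∧ Runs c w (c a) y := by
  simp only [Runs, pass, if_true, true_imp_iff]
  exact and_congr_right fun h => by rw [h]

theorem runs_cons_under (c : ℕ → X) (a : ℕ) (s : Bool) (w : List Letter) (x y : X) :
    Runs c (⟨a, false, s⟩ :: w) x y ↔ Runs c w (tPow s • x + (1 - tPow s) • c a) y := by
  simp [Runs, pass]

theorem coloringSystem_pretzelWord_iff (c : ℕ → X) :
    coloringSystem pretzelWord X c ↔ (∀ a, 9 ≤ a → c a = 0) ∧ c 0 = 0 ∧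
      c 2 = tPow true • c 0 + (1 - tPow true) • c 1 ∧ c 5 = c 2 ∧
      c 3 = tPow false • c 5 + (1 - tPow false) • c 4 ∧ c 6 = c 3 ∧
      c 8 = tPow true • c 6 + (1 - tPow true) • c 7 ∧
      c 1 = tPow true • c 8 + (1 - tPow true) • c 2 ∧
      c 4 = tPow false • (tPow true • c 1 + (1 - tPow true) • c 0) + (1 - tPow false) • c 3 ∧
      c 7 = tPow true • (tPow false • c 4 + (1 - tPow false) • c 5) + (1 - tPow true) • c 8 ∧
      tPow true • c 7 + (1 - tPow true) • c 6 = 0 := by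
  have hlab : ∀ a, a ∉ pretzelWord.map Letter.label ↔ 9 ≤ a := by
    intro a
    simp only [pretzelWord, List.map_cons, List.map_nil, List.mem_cons, List.not_mem_nil, or_false]
    omega
  simp only [coloringSystem, hlab]
  refine and_congr_right fun _ => ?_
  simp only [pretzelWord, runs_cons_over, runs_cons_under, runs_nil]

variable {R : Type} [CommRing R] {Y : Type} [AddCommGroup Y] [Module R Y]

/-- Here `a`, `b`, `e` are the colors at the middle crossings 1, 4, 7 of the three columns, which
determine the colors at the other crossings. Up to units the first three relations become a + (1 -
t) b - (1 - t) e = 0, (2 - t⁻¹)(a - b) = 0 and (2 - t)(e - b) = 0, and the last one, which closes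
the knot, follows from these. -/
theorem pretzel_relations {t t' : R} (h : t * t' = 1) {a b e c₂ c₃ c₈ : Y} (h₂ : c₂ = (1 - t) • a)
    (h₃ : c₃ = t' • c₂ + (1 - t') • b) (h₈ : c₈ = t • c₃ + (1 - t) • e) :
    t • c₈ + (1 - t) • c₂ = a - t • (a + (1 - t) • b - (1 - t) • e) ∧
    t' • t • a + (1 - t') • c₃ = b + t' • (2 - t') • (a - b) ∧
    t • (t' • b + (1 - t') • c₂) + (1 - t) • c₈ = e - t • (2 - t) • (e - b) ∧
    t • e + (1 - t) • c₃ = t • (a + (1 - t) • b - (1 - t) • e) + t • (2 - t) • (e - b) -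
      (2 - t') • (a - b) := by
  subst h₂
  subst h₃
  subst h₈
  refine ⟨?_, ?_, ?_, ?_⟩ <;> match_scalars <;> grind

/-- A presentation matrix of the Alexander module of the pretzel knot. -/
noncomputable def pretzelMatrix : Matrix (Fin 2) (Fin 2) ℤ[T;T⁻¹] :=
  !![2 - tPow false, 0; 0, 2 - tPow true]

theorem matrixSystem_pretzelMatrix_iff (y : Fin 2 → X) :
    matrixSystem pretzelMatrix X y ↔ (2 - tPow false) • y 0 = 0 ∧ (2 - tPow true) • y 1 = 0 := by
  simp [matrixSystem, pretzelMatrix, Fin.forall_fin_two]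

/-- The colors in the middle of the first and the third column, relative to the second one. -/
def pretzelParams (X : Type) [AddCommGroup X] [Module ℤ[T;T⁻¹] X] (c : ℕ → X) : Fin 2 → X :=
  ![c 1 - c 4, c 7 - c 4]

/-- The coloring of the pretzel knot with given parameters. -/
noncomputable def pretzelColors (X : Type) [AddCommGroup X] [Module ℤ[T;T⁻¹] X] (y : Fin 2 → X) :
    ℕ → X :=
  let t := tPow true
  let t' := tPow false
  -- The solution of a - b = y 0, e - b = y 1 and a + (1 - t) b - (1 - t) e = 0.
  let a := (1 - t) • y 1
  let b := (1 - t) • y 1 - y 0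
  let e := y 1 + ((1 - t) • y 1 - y 0)
  let c₂ := (1 - t) • a
  let c₃ := t' • c₂ + (1 - t') • b
  let c₈ := t • c₃ + (1 - t) • e
  fun k => match k with
    | 1 => a
    | 2 => c₂
    | 3 => c₃
    | 4 => b
    | 5 => c₂
    | 6 => c₃
    | 7 => e
    | 8 => c₈
    | _ => 0

theorem pretzelParams_pretzelColors (y : Fin 2 → X) :
    pretzelParams X (pretzelColors X y) = y := by
  ext i
  fin_cases i <;> simp [pretzelParams, pretzelColors]

theorem coloringSystem_pretzelColors {y : Fin 2 → X} (hy : matrixSystem pretzelMatrix X y) :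
    coloringSystem pretzelWord X (pretzelColors X y) := by
  obtain ⟨h0, h1⟩ := (matrixSystem_pretzelMatrix_iff y).1 hy
  have ht : tPow true * tPow false = 1 := tPow_mul_not true
  rw [coloringSystem_pretzelWord_iff]
  set c := pretzelColors X y with hc
  have e0 : c 0 = 0 := rfl
  have e2 : c 2 = (1 - tPow true) • c 1 := rfl
  have e3 : c 3 = tPow false • c 2 + (1 - tPow false) • c 4 := rfl
  have e8 : c 8 = tPow true • c 3 + (1 - tPow true) • c 7 := rfl
  have e5 : c 5 = c 2 := rfl
  have e6 : c 6 = c 3 := rfl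
  have p1 : c 1 = (1 - tPow true) • y 1 := rfl
  have p4 : c 4 = (1 - tPow true) • y 1 - y 0 := rfl
  have p7 : c 7 = y 1 + ((1 - tPow true) • y 1 - y 0) := rfl
  obtain ⟨r1, r2, r3, r4⟩ := pretzel_relations ht e2 e3 e8
  have q0 : c 1 - c 4 = y 0 := by rw [p1, p4]; abel
  have q1 : c 7 - c 4 = y 1 := by rw [p7, p4]; abel
  have q : c 1 + (1 - tPow true) • c 4 - (1 - tPow true) • c 7 = 0 := by
    rw [p1, p4, p7]; module
  rw [q, smul_zero, sub_zero] at r1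
  rw [q0, h0, smul_zero, add_zero] at r2
  rw [q1, h1, smul_zero, sub_zero] at r3
  rw [q, q0, q1, h0, h1, smul_zero, add_zero, sub_zero] at r4
  refine ⟨fun k hk => ?_, e0, ?_, e5, ?_, e6, ?_, r1.symm, ?_, ?_, ?_⟩
  · obtain ⟨k, rfl⟩ := Nat.exists_eq_add_of_le' hk
    rfl
  · rw [e0, smul_zero, zero_add, e2]
  · rw [e5, e3]
  · rw [e6, e8]
  · rw [e0, smul_zero, add_zero, r2]
  · rw [e5, r3]
  · rw [e6, r4]

theorem matrixSystem_pretzelParams {c : ℕ → X} (hc : coloringSystem pretzelWord X c) :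
    matrixSystem pretzelMatrix X (pretzelParams X c) ∧
      pretzelColors X (pretzelParams X c) = c := by
  have ht : tPow true * tPow false = 1 := tPow_mul_not true
  obtain ⟨h9, e0, e2, e5, e3, e6, e8, e1, e4, e7, -⟩ := (coloringSystem_pretzelWord_iff c).1 hc
  rw [e0, smul_zero, zero_add] at e2
  rw [e5] at e3 e7
  rw [e6] at e8
  rw [e0, smul_zero, add_zero] at e4
  obtain ⟨r1, r2, r3, -⟩ := pretzel_relations ht e2 e3 e8
  rw [← e1] at r1
  rw [← e4] at r2
  rw [← e7] at r3
  -- In each of the three relations the unit t or t⁻¹ is cancelled.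
  have q : c 1 + (1 - tPow true) • c 4 - (1 - tPow true) • c 7 = 0 := by
    have := tPow_not_smul true (c 1 + (1 - tPow true) • c 4 - (1 - tPow true) • c 7)
    rw [eq_comm, sub_eq_self] at r1
    rwa [r1, smul_zero, eq_comm] at this
  have q0 : (2 - tPow false) • (c 1 - c 4) = 0 := by
    have := tPow_not_smul false ((2 - tPow false) • (c 1 - c 4))
    rw [eq_comm, add_eq_left] at r2
    rwa [r2, smul_zero, eq_comm] at this
  have q1 : (2 - tPow true) • (c 7 - c 4) = 0 := by
    have := tPow_not_smul true ((2 - tPow true) • (c 7 - c 4))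
    rw [eq_comm, sub_eq_self] at r3
    rwa [r3, smul_zero, eq_comm] at this
  refine ⟨(matrixSystem_pretzelMatrix_iff _).2 ⟨q0, q1⟩, ?_⟩
  set d := pretzelColors X (pretzelParams X c) with hd
  have d1 : d 1 = c 1 := by
    change (1 - tPow true) • (c 7 - c 4) = c 1
    rw [← sub_eq_zero, ← neg_eq_zero, ← q]
    module
  have d4 : d 4 = c 4 := by
    change d 1 - (c 1 - c 4) = c 4
    rw [d1]; abel
  have d7 : d 7 = c 7 := by
    change (c 7 - c 4) + d 4 = c 7
    rw [d4]; abel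
  have d2 : d 2 = c 2 := by
    change (1 - tPow true) • d 1 = c 2
    rw [d1, e2]
  have d3 : d 3 = c 3 := by
    change tPow false • d 2 + (1 - tPow false) • d 4 = c 3
    rw [d2, d4, e3]
  have d8 : d 8 = c 8 := by
    change tPow true • d 3 + (1 - tPow true) • d 7 = c 8
    rw [d3, d7, e8]
  ext k
  match k with
  | 0 => exact e0.symm
  | 1 => exact d1
  | 2 => exact d2
  | 3 => exact d3
  | 4 => exact d4
  | 5 => exact d2.trans e5.symm
  | 6 => exact d3.trans e6.symm
  | 7 => exact d7
  | 8 => exact d8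
  | k + 9 => exact (h9 (k + 9) (by omega)).symm

theorem exists_isUniversal_pretzelMatrix {M : Type} [AddCommGroup M] [Module ℤ[T;T⁻¹] M]
    (h : Presents pretzelWord M) :
    ∃ y : Fin 2 → M, IsUniversal (matrixSystem pretzelMatrix) y := by
  obtain ⟨c, hc⟩ := h
  refine ⟨_, hc.transport pretzelParams pretzelColors
    (fun X _ _ c hc => (matrixSystem_pretzelParams hc).1)
    (fun X _ _ y hy => coloringSystem_pretzelColors hy) ?_ ?_
    (fun X _ _ c hc => (matrixSystem_pretzelParams hc).2)
    (fun X _ _ y _ => pretzelParams_pretzelColors y)⟩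
  · intro X Y _ _ _ _ φ c
    ext i
    fin_cases i <;> simp [pretzelParams]
  · intro X Y _ _ _ _ φ y
    ext k
    match k with
    | 0 | 1 | 2 | 3 | 4 | 5 | 6 | 7 | 8 => simp [pretzelColors]
    | k + 9 => simp [pretzelColors]

end Coloring

theorem pretzelDiagram_alexanderIdeal_two :
    pretzelDiagram.alexanderIdeal 2 = minorIdeal pretzelMatrix 1 := by
  obtain ⟨M, _, _, hM⟩ := pretzelDiagram.exists_presents
  obtain ⟨y, hy⟩ := exists_isUniversal_pretzelMatrix hM
  exact pretzelDiagram.alexanderIdeal_eq hM hy.isPresentation 2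

open LaurentPolynomial in
theorem one_add_T_mem_alexanderIdeal_pretzelDiagram :
    (1 + T 1 : ℤ[T;T⁻¹]) ∈ pretzelDiagram.alexanderIdeal 2 := by
  rw [pretzelDiagram_alexanderIdeal_two]
  have h : ∀ i j, pretzelMatrix i j ∈ minorIdeal pretzelMatrix 1 := fun i j => by
    have := det_mem_minorIdeal pretzelMatrix (k := 1) (fun _ => i) (fun _ => j)
    simpa using this
  have h0 : 2 - tPow false ∈ minorIdeal pretzelMatrix 1 := h 0 0
  have h1 : 2 - tPow true ∈ minorIdeal pretzelMatrix 1 := h 1 1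
  have ht : tPow true * tPow false = 1 := tPow_mul_not true
  have : (1 + T 1 : ℤ[T;T⁻¹]) = tPow true * (2 - tPow false) + (2 - tPow true) := by
    change 1 + tPow true = _
    linear_combination ht
  rw [this]
  exact Ideal.add_mem _ (Ideal.mul_mem_left _ _ h0) h1

theorem alexanderIdeal_pretzelDiagram_ne_top : pretzelDiagram.alexanderIdeal 2 ≠ ⊤ := by
  rw [pretzelDiagram_alexanderIdeal_two]
  intro h
  -- At t = -1 modulo 3 both 2 - t and 2 - t⁻¹ become 3 = 0, so the ideal lies in a proper kernel.
  let ψ : ℤ[T;T⁻¹] →+* ZMod 3 := LaurentPolynomial.eval₂ (Int.castRingHom (ZMod 3)) (-1)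
  have ht : ψ (tPow true) = -1 := by
    simp [ψ, tPow]
  have ht' : ψ (tPow false) = -1 := by
    simp [ψ, tPow]
  have hle : minorIdeal pretzelMatrix 1 ≤ RingHom.ker ψ := by
    rw [minorIdeal_le_iff]
    intro p q
    rw [RingHom.mem_ker, Matrix.det_fin_one, Matrix.submatrix_apply]
    have h3 : ψ 2 + 1 = 0 := by
      rw [map_ofNat]
      decide
    have : ∀ i j, ψ (pretzelMatrix i j) = 0 := by
      intro i j
      fin_cases i <;> fin_cases j <;> simp [pretzelMatrix, ht, ht', h3]
    exact this _ _
  rw [h, top_le_iff] at hle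
  have : (1 : ℤ[T;T⁻¹]) ∈ RingHom.ker ψ := by rw [hle]; trivial
  rw [RingHom.mem_ker, map_one] at this
  exact absurd this (by decide)

theorem not_isBipartite_pretzelDiagram : ¬ pretzelDiagram.knot.IsBipartite := by
  rintro ⟨D, h, hD⟩
  exact one_add_T_notMem_alexanderIdeal hD h alexanderIdeal_pretzelDiagram_ne_top
    one_add_T_mem_alexanderIdeal_pretzelDiagram

end Pretzel

end BipartiteKnots

theorem mainTheorem1 :
    (∀ K : BipartiteKnots.Knot, K.IsBipartite →
      ∀ D : BipartiteKnots.KnotDiagram, D.knot = K →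
        ∀ m : ℕ, D.alexanderIdeal m ≠ ⊤ →
          (1 + LaurentPolynomial.T 1 : LaurentPolynomial ℤ) ∉ D.alexanderIdeal m) ∧
    (∃ K : BipartiteKnots.Knot, ¬ K.IsBipartite) := by
  refine ⟨?_, _, BipartiteKnots.not_isBipartite_pretzelDiagram⟩
  rintro K ⟨D₀, h₀, hD₀⟩ D hD m hm
  exact BipartiteKnots.one_add_T_notMem_alexanderIdeal hD₀ (h₀.trans hD.symm) hm
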